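/- **Setting.** Let $d,T\ge 1$, $0<\gamma<1$, $T_\gamma=\frac1{1-\gamma}$, $\alpha>0$, and let $\Theta\subset\mathbb R^d$ be closed and convex with $\mathbb B\subseteq\Theta\subseteq R\,\mathbb B$, where $\mathbb B$ is the closed Euclidean unit ball. A type is a triple $a=(x,y,c)$ with features $x\in R\,\mathbb B$, label $y\in\{-1,1\}$ and manipulation cost $c(\hat x,x)=f(\hat x-x)$, where $f:\mathbb R^d\to\mathbb R$ is $\alpha$-strongly convex and positively homogeneous of degree $2$. Against a classifier $\theta$ the agent's payoff is $v_a(\theta,\hat x)=\langle\theta,\hat x\rangle-c(\hat x,x)$, except that $v_a(\theta,\hat x)=-\infty$ if $y=1$ and $\hat x\ne x$. The principal's loss $\ell(\theta,\hat x,y)$ is either the logistic loss $\log(1+e^{-y\langle\theta,\hat x\rangle})$ or the hinge loss $\max\{0,1-y\langle\theta,\hat x\rangle\}$. Let $(a_t)_{t=1}^T$ be a (deterministic or random) sequence of types, independent of the principal's randomization. In round $t$ the principal plays $\theta_t$, the agent, who knows the principal's algorithm, observes $\theta_t$, the past play, $a_1,\dots,a_t$ and possibly further private information and randomness (independent of the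 principal's), and responds with $\hat x_t$; the principal then observes $\ell(\theta_t,\hat x_t,y_t)$. A $\gamma$-discounting agent uses a policy that maximizes $\mathbb E\big[\sum_{t=1}^T\gamma^t v_{a_t}(\theta_t,\hat x_t)\big]$ among all its policies. With $\mathrm{br}_t(\theta)$ the best response to $\theta$ of an agent with type $a_t$, the Stackelberg regret is $$\mathbb E\Big[\sum_{t=1}^T\ell(\theta_t,\hat x_t,y_t)\Big]-\min_{\theta\in\Theta}\mathbb E\Big[\sum_{t=1}^T\ell(\theta,\mathrm{br}_t(\theta),y_t)\Big].$$ **Algorithm.** Put $\varepsilon=\alpha(R^4dT^{2.5})^{-1}$, $D=\max\{1,\lceil T_\gamma\log(R^2(1+1/\alpha)T_\gamma/\varepsilon)\rceil\}$, $n=\lceil T/D\rceil$, $C=1+R^2+R^2/\alpha$, $L=R+2R/\alpha$, $\delta=\min\big\{1,\sqrt{\tfrac{RdC}{3(L+C)}}\;n^{-1/4}\big\}$ and $\eta=\frac{R}{C\sqrt n}$. Run $D$ independent copies of gradient descent without a gradient, copy $r\in\{1,\dots,D\}$ being active in the rounds $t=D(k-1)+r$, $k=1,2,\dots$. Each copy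 keeps an iterate, initially $0$. In a round $t$ in which the active copy has iterate $v$, a fresh uniformly random unit vector $s_t$ is drawn, $\theta_t=v+\delta s_t$ is played, and that copy's iterate is replaced by the Euclidean projection of $v-\eta\,\ell(\theta_t,\hat x_t,y_t)\,s_t$ onto $(1-\delta)\Theta$. **Theorem.** Suppose that $R$ and $\alpha^{-1}$ are polylogarithmic in $T$ and $d$. Then the regret of this algorithm against $\gamma$-discounting agents is $\widetilde O\big(T_\gamma^{1/4}\sqrt d\,T^{3/4}+d^2\big)$. Precisely: for all $K\in\mathbb R$ and $p\in\mathbb N$ there are $c\in\mathbb R$ and $q\in\mathbb N$, depending only on $K$ and $p$, such that whenever $R\le K\log^p(T+d+1)$ and $\alpha^{-1}\le K\log^p(T+d+1)$, against every $\gamma$-discounting agent the expectations defining the regret are finite and the regret is at most $$c\,\log^q(T+d+1)\,\big(T_\gamma^{1/4}\sqrt d\,T^{3/4}+d^2\big).$$ -/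

import Mathlib

open MeasureTheory ProbabilityTheory Set

noncomputable section

/-- Feature and classifier space `ℝ^d` with its Euclidean norm. -/
abbrev Vec (d : ℕ) := EuclideanSpace ℝ (Fin d)

/-! ### Losses and the stage game -/

/-- Logistic loss `log (1 + exp (-y ⟨θ, x⟩))`. -/
def logisticLoss {d : ℕ} (θ x : Vec d) (y : ℝ) : ℝ :=
  Real.log (1 + Real.exp (-(y * inner ℝ θ x)))

/-- Hinge loss `max {0, 1 - y ⟨θ, x⟩}`. -/
def hingeLoss {d : ℕ} (θ x : Vec d) (y : ℝ) : ℝ :=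
  max 0 (1 - y * inner ℝ θ x)

/-- The type of an agent: original features, label, and manipulation cost
(`cost x' x` is the cost of presenting `x'` when the original features are `x`). -/
structure AgentType (d : ℕ) where
  x : Vec d
  y : ℝ
  cost : Vec d → Vec d → ℝ

namespace AgentType

variable {d : ℕ}

open Classical in
/-- Stage payoff `⟨θ, x'⟩ - cost x' x`, except that an agent with label `1` is non-strategic:
presenting anything but `x` gives `-∞`. -/
def payoff (a : AgentType d) (θ x' : Vec d) : EReal :=
  if a.y = 1 ∧ x' ≠ a.x then ⊥ else ((inner ℝ θ x' - a.cost x' a.x : ℝ) : EReal)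

/-- The set of best responses to the classifier `θ`. -/
def bestResp (a : AgentType d) (θ : Vec d) : Set (Vec d) :=
  {x' | ∀ z, a.payoff θ z ≤ a.payoff θ x'}

/-- The loss of the principal when the agent best-responds to `θ`, ties being broken in favour
of the principal. -/
def bestRespLoss (ℓ : Vec d → Vec d → ℝ → ℝ) (a : AgentType d) (θ : Vec d) : ℝ :=
  sInf ((fun x' => ℓ θ x' a.y) '' a.bestResp θ)

/-- Regularity of an agent: label `±1`, features in the ball of radius `R`, and a cost
`f (x' - x)` with `f` `α`-strongly convex and positively homogeneous of degree `2`. -/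
structure Regular (R α : ℝ) (a : AgentType d) : Prop where
  label : a.y = -1 ∨ a.y = 1
  feature : ‖a.x‖ ≤ R
  cost : ∃ f : Vec d → ℝ, StrongConvexOn univ α f ∧
    (∀ r : ℝ, 0 < r → ∀ v, f (r • v) = r ^ 2 * f v) ∧
    ∀ x' x, a.cost x' x = f (x' - x)

end AgentType

/-! ### Gradient descent without a gradient -/

/-- Euclidean projection onto `K` (a nearest point of `K`; it exists and is unique for
nonempty closed convex `K`). -/
def euclideanProj {d : ℕ} (K : Set (Vec d)) (w : Vec d) : Vec d :=
  Classical.epsilon fun z => z ∈ K ∧ ∀ z' ∈ K, dist w z ≤ dist w z'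

/-- The uniform probability measure on the unit sphere of `ℝ^d`, as a measure on `ℝ^d`. -/
def uniformSphere (d : ℕ) : Measure (Vec d) :=
  (((volume : Measure (Vec d)).toSphere univ)⁻¹ • (volume : Measure (Vec d)).toSphere).map
    Subtype.val

/-- A copy of gradient descent without a gradient: its domain `S`, exploration radius `δ` and
step size `η`. -/
structure GDwoG (d : ℕ) where
  S : Set (Vec d)
  δ : ℝ
  η : ℝ

namespace GDwoG

variable {d : ℕ}

/-- The parameters for horizon `n`, domain between the unit ball and the `R`-ball, and
`L`-Lipschitz losses with values in `[-C, C]`.  The exploration radius is capped at `1`, so that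
all queries stay in the domain. -/
def tuned (S : Set (Vec d)) (R C L : ℝ) (n : ℕ) : GDwoG d where
  S := S
  δ := min 1 (Real.sqrt (R * d * C / (3 * (L + C))) * (n : ℝ) ^ (-(1 / 4) : ℝ))
  η := R / (C * Real.sqrt n)

/-- The query `u = v + δ s` at iterate `v` and random direction `s`. -/
def query (G : GDwoG d) (v s : Vec d) : Vec d := v + G.δ • s

/-- The next iterate, the projection of `v - η c s` onto `(1 - δ) S`, where `c` is the observed
loss of the query. -/
def update (G : GDwoG d) (v s : Vec d) (c : ℝ) : Vec d :=
  euclideanProj ((fun z => (1 - G.δ) • z) '' G.S) (v - (G.η * c) • s)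

end GDwoG

/-! ### The non-myopic learning algorithm -/

/-- The discounted horizon `T_γ = 1 / (1 - γ)`. -/
def discHorizon (γ : ℝ) : ℝ := 1 / (1 - γ)

/-- `ε = α / (R^4 d T^{5/2})`. -/
def targetAccuracy (d T : ℕ) (R α : ℝ) : ℝ := α / (R ^ 4 * d * (T : ℝ) ^ (5 / 2 : ℝ))

/-- `D = ⌈T_γ log (R^2 (1 + 1/α) T_γ / ε)⌉`, and at least one copy. -/
def numCopies (d T : ℕ) (R α γ : ℝ) : ℕ :=
  max 1 ⌈discHorizon γ *
    Real.log (R ^ 2 * (1 + 1 / α) * discHorizon γ / targetAccuracy d T R α)⌉₊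

/-- The parameters of each of the `D` copies: domain `Θ`, `C = 1 + R^2 + R^2/α`,
`L = R + 2R/α`, and horizon `⌈T / D⌉`. -/
def copyParams {d : ℕ} (Θ : Set (Vec d)) (T : ℕ) (R α γ : ℝ) : GDwoG d :=
  GDwoG.tuned Θ R (1 + R ^ 2 + R ^ 2 / α) (R + 2 * R / α)
    ⌈(T : ℝ) / (numCopies d T R α γ : ℝ)⌉₊

section Play

variable {d : ℕ} (G : GDwoG d) (D : ℕ) (ℓ : Vec d → Vec d → ℝ → ℝ)
  (a : ℕ → AgentType d) (B : (t : ℕ) → (Fin t → Vec d × Vec d) → Vec d → Vec d)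
  (s : ℕ → Vec d)

/-- The play of `D` parallel copies of `G` on the sequence of types `a`, against the agent
strategy `B` (history and classifier to response), with random directions `s`.
Rounds are numbered from `0`; in round `t` the copy number `t % D` is active and receives the
feedback `ℓ(θ_t, x'_t, y_t)`.  The state before round `t` consists of the current iterate of each
copy (initially `0`) and of the history of pairs (classifier, response). -/
def playState : (t : ℕ) → (ℕ → Vec d) × (Fin t → Vec d × Vec d)
  | 0 => (fun _ => 0, Fin.elim0)
  | t + 1 =>
    let st := playState t
    let θ := G.query (st.1 (t % D)) (s t)
    let x' := B t st.2 θ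
    (Function.update st.1 (t % D) (G.update (st.1 (t % D)) (s t) (ℓ θ x' (a t).y)),
      Fin.snoc st.2 (θ, x'))

/-- The classifier `θ_t`. -/
def classifierAt (t : ℕ) : Vec d :=
  G.query ((playState G D ℓ a B s t).1 (t % D)) (s t)

/-- The response of the agent in round `t`. -/
def responseAt (t : ℕ) : Vec d :=
  B t (playState G D ℓ a B s t).2 (classifierAt G D ℓ a B s t)

end Play

/-! ### The repeated game -/

/-- The expectation `∫ X⁺ - ∫ X⁻` of an extended-real random variable. -/
def erealExpectation {Ω : Type*} [MeasurableSpace Ω] (μ : Measure Ω) (X : Ω → EReal) : EReal :=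
  ((∫⁻ ω, (X ω).toENNReal ∂μ : ENNReal) : EReal) - ((∫⁻ ω, (-X ω).toENNReal ∂μ : ENNReal) : EReal)

/-- The data of a repeated classification game of `T` rounds with features in `ℝ^d`.  The
probability space `(Ω, P)` carries the (possibly random) types and all private randomness of the
agent; `𝓕 t` is what the agent knows in round `t` apart from the history of play. -/
structure ClassificationGame (d T : ℕ) (Ω : Type*) [m : MeasurableSpace Ω] where
  P : Measure Ω
  𝓕 : Filtration ℕ m
  types : ℕ → Ω → AgentType d
  Θ : Set (Vec d)
  ℓ : Vec d → Vec d → ℝ → ℝ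
  R : ℝ
  α : ℝ
  γ : ℝ

/-- A (possibly random) policy of the agent: the response in round `t` is a measurable function
of the agent's information, the history of play, and the current classifier. -/
structure AgentPolicy (d : ℕ) {Ω : Type*} {m : MeasurableSpace Ω} (𝓕 : Filtration ℕ m) where
  act : (t : ℕ) → Ω → (Fin t → Vec d × Vec d) → Vec d → Vec d
  measurable_act : ∀ t, Measurable[(𝓕 t).prod inferInstance]
    (fun p : Ω × ((Fin t → Vec d × Vec d) × Vec d) => act t p.1 p.2.1 p.2.2)

namespace ClassificationGame

variable {d T : ℕ} {Ω : Type*} [MeasurableSpace Ω]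

/-- The assumptions on the game. -/
structure Regular (G : ClassificationGame d T Ω) : Prop where
  prob : IsProbabilityMeasure G.P
  loss : G.ℓ = logisticLoss ∨ G.ℓ = hingeLoss
  convex : Convex ℝ G.Θ
  closed : IsClosed G.Θ
  ball_subset : Metric.closedBall 0 1 ⊆ G.Θ
  subset_ball : G.Θ ⊆ Metric.closedBall 0 G.R
  alpha_pos : 0 < G.α
  gamma_pos : 0 < G.γ
  gamma_lt_one : G.γ < 1
  types_regular : ∀ t < T, ∀ ω, (G.types t ω).Regular G.R G.α
  measurable_x : ∀ t < T, Measurable[G.𝓕 t] fun ω => (G.types t ω).x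
  measurable_y : ∀ t < T, Measurable[G.𝓕 t] fun ω => (G.types t ω).y
  measurable_cost : ∀ t < T, ∀ x' x, Measurable[G.𝓕 t] fun ω => (G.types t ω).cost x' x

variable (G : ClassificationGame d T Ω)

/-- The joint law of `Ω` and of the directions sampled by the learning algorithm, which are
uniform on the sphere and independent of each other and of `Ω`. -/
def law : Measure (Ω × (Fin T → Vec d)) :=
  G.P.prod (Measure.pi fun _ => uniformSphere d)

/-- The sampled directions as a sequence (only rounds `t < T` matter). -/
def directions (σ : Fin T → Vec d) (t : ℕ) : Vec d :=
  if h : t < T then σ ⟨t, h⟩ else 0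

/-- The classifier `θ_t` when the principal runs the non-myopic learning algorithm and the agent
follows `B`. -/
def classifier (B : AgentPolicy d G.𝓕) (t : ℕ) (p : Ω × (Fin T → Vec d)) : Vec d :=
  classifierAt (copyParams G.Θ T G.R G.α G.γ) (numCopies d T G.R G.α G.γ) G.ℓ
    (fun t => G.types t p.1) (fun t => B.act t p.1) (directions p.2) t

/-- The response of the agent in round `t`. -/
def response (B : AgentPolicy d G.𝓕) (t : ℕ) (p : Ω × (Fin T → Vec d)) : Vec d :=
  responseAt (copyParams G.Θ T G.R G.α G.γ) (numCopies d T G.R G.α G.γ) G.ℓ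
    (fun t => G.types t p.1) (fun t => B.act t p.1) (directions p.2) t

/-- The expected `γ`-discounted utility of the agent. -/
def agentUtility (B : AgentPolicy d G.𝓕) : EReal :=
  erealExpectation G.law fun p => ∑ t ∈ Finset.range T,
    ((G.γ ^ (t + 1) : ℝ) : EReal) *
      (G.types t p.1).payoff (G.classifier B t p) (G.response B t p)

/-- `B` is a policy of a (rational) `γ`-discounting agent: it maximizes expected `γ`-discounted
utility against the learning algorithm. -/
def IsDiscounting (B : AgentPolicy d G.𝓕) : Prop :=
  ∀ B' : AgentPolicy d G.𝓕, G.agentUtility B' ≤ G.agentUtility B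

/-- The total loss of the principal. -/
def totalLoss (B : AgentPolicy d G.𝓕) (p : Ω × (Fin T → Vec d)) : ℝ :=
  ∑ t ∈ Finset.range T, G.ℓ (G.classifier B t p) (G.response B t p) (G.types t p.1).y

/-- The total loss of the fixed classifier `θ` against best responses. -/
def benchmarkLoss (θ : Vec d) (ω : Ω) : ℝ :=
  ∑ t ∈ Finset.range T, (G.types t ω).bestRespLoss G.ℓ θ

/-- Stackelberg regret of the learning algorithm against `B`. -/
def stackelbergRegret (B : AgentPolicy d G.𝓕) : EReal :=
  ⨆ θ ∈ G.Θ, (((∫ p, G.totalLoss B p ∂G.law) - ∫ ω, G.benchmarkLoss θ ω ∂G.P : ℝ) : EReal)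

end ClassificationGame

end

/-! The influence of the agent is delayed. The `D` copies take turns, so the response in round `t`
affects no classifier before round `t + D`. Compare the policy of a `γ`-discounting agent with the
policy that follows it before round `t` and best-responds from round `t` on (`myopicFrom`). Until
round `t + D` both face the same classifiers. By strong convexity of the cost, the deviation
therefore gains at least `α/2` times the squared distance of the response in round `t` from the best
response. It can lose at most the range of the payoffs times the discounted tail from round `t + D`
on. Optimality of the agent and the choice of `D` bound the mean square of this distance by `4 /
(R^4 d T^(5/2))` (`realUtility_add_le`, `IsDiscounting.integral_responseError_sq_le'`). This is
negligible even after multiplication by the factor `d / δ` of the gradient estimate.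

The principal thus faces, up to small errors, the losses `brLoss` at best responses, and these are
convex in `θ`. For label `-1` the largest surplus `sup_z (⟨θ, z⟩ - f z)` is a supremum of affine
functions of `θ`. Homogeneity gives `⟨θ, z⟩ = 2 f z` at the maximiser, so the linear gain `⟨θ, z⟩`
there is twice the largest surplus. Hence the argument of the margin loss is convex, and the margin
loss is itself convex and nondecreasing (`inner_optShift`, `margin_eq`, `convexOn_brLoss`).

For convex `h` and `s` uniform on the sphere, `(d / δ) h(v + δ s) s` is in the mean almost a
subgradient at `v` (`integral_uniformSphere_mul_inner_le`). No differentiability of `h` is used. The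
difference quotients fall on an even radial cutoff; convexity is applied to translates of `h`; then
the cutoff tends to the indicator of the ball, and its gradient concentrates on the sphere. Since
the direction of round `t` is independent of the types and of the iterate, it can be integrated out
alone (`integral_prod_pi_le_of_update`).

The projection inequality, summed with a potential that adds the squared distances of all copies
from the comparator, gives the explicit bound `IsDiscounting.regret_le`. Arithmetic with fourth
roots (`tuned_regret_le`, `numCopies_le`) turns it into the rate. If `T` is at most `T_γ d^2` up to
logarithmic factors, the trivial bound of order `T` already has the order `T_γ^(1/4) √d T^(3/4)`, so
the proof does not need the summand `d^2`. -/

noncomputable section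

/-! ### Manipulation costs -/

/-- A manipulation cost as a function of the displacement: `α`-strongly convex and positively
homogeneous of degree `2`. -/
structure IsManipulationCost {d : ℕ} (α : ℝ) (f : Vec d → ℝ) : Prop where
  pos : 0 < α
  strong : StrongConvexOn univ α f
  homog : ∀ r : ℝ, 0 < r → ∀ v, f (r • v) = r ^ 2 * f v

/-- The gain from the displacement `z` against the classifier `θ`. -/
def surplus {d : ℕ} (f : Vec d → ℝ) (θ z : Vec d) : ℝ := inner ℝ θ z - f z

/-- The displacement of largest gain. -/
def optShift {d : ℕ} (f : Vec d → ℝ) (θ : Vec d) : Vec d :=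
  Classical.epsilon fun z => ∀ z', surplus f θ z' ≤ surplus f θ z

/-- Let `t → 0`. This replaces derivatives in the first-order conditions below: inequalities along a
segment or a ray are divided by `t` and passed to the limit, as `f` need not be differentiable. -/
lemma le_of_forall_mul_one_sub_le {a b : ℝ} (h : ∀ t : ℝ, 0 < t → t < 1 → (1 - t) * a ≤ b) :
    a ≤ b := by
  have h1 : Filter.Tendsto (fun t : ℝ => (1 - t) * a) (nhdsWithin 0 (Ioi 0)) (nhds a) := by
    have : Filter.Tendsto (fun t : ℝ => (1 - t) * a) (nhds 0) (nhds ((1 - 0) * a)) := by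
      apply Continuous.tendsto; fun_prop
    simpa using this.mono_left nhdsWithin_le_nhds
  refine le_of_tendsto h1 ?_
  filter_upwards [Ioo_mem_nhdsGT (zero_lt_one' ℝ)] with t ht using h t ht.1 ht.2

namespace IsManipulationCost

variable {d : ℕ} {α : ℝ} {f : Vec d → ℝ}

lemma convexOn (hf : IsManipulationCost α f) : ConvexOn ℝ univ f :=
  UniformConvexOn.convexOn hf.strong (fun r => by
    have := hf.pos
    simp only [Pi.zero_apply]; positivity)

lemma continuous (hf : IsManipulationCost α f) : Continuous f :=
  hf.convexOn.locallyLipschitz.continuous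

lemma map_zero (hf : IsManipulationCost α f) : f 0 = 0 := by
  have := hf.homog 2 (by norm_num) 0
  rw [smul_zero] at this
  linarith

lemma strong_ineq (hf : IsManipulationCost α f) (x y : Vec d) {t : ℝ} (h0 : 0 < t) (h1 : t < 1) :
    f ((1 - t) • x + t • y) ≤ (1 - t) * f x + t * f y - (1 - t) * t * (α / 2 * ‖x - y‖ ^ 2) := by
  have := hf.strong.2 (mem_univ x) (mem_univ y) (by linarith : 0 ≤ 1 - t) h0.le (by ring)
  simpa only [smul_eq_mul] using this

/-- Strong convexity at the midpoint of `0` and `v`, where homogeneity makes the value of `f` a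
quarter of `f v`. -/
lemma sq_le (hf : IsManipulationCost α f) (v : Vec d) : α / 2 * ‖v‖ ^ 2 ≤ f v := by
  have h := hf.strong_ineq 0 v (t := 1 / 2) (by norm_num) (by norm_num)
  rw [smul_zero, zero_add, hf.homog _ (by norm_num), hf.map_zero, zero_sub, norm_neg] at h
  linarith

/-- Outside the ball of radius `2‖θ‖ / α` the quadratic lower bound on `f` makes the surplus
nonpositive, hence no better than at `0`; inside, compactness applies. -/
lemma exists_forall_surplus_le (hf : IsManipulationCost α f) (θ : Vec d) :
    ∃ z, ∀ z', surplus f θ z' ≤ surplus f θ z := by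
  have hα := hf.pos
  have hc : Continuous (surplus f θ) := by
    have := hf.continuous
    unfold surplus; fun_prop
  obtain ⟨z, -, hz⟩ := (isCompact_closedBall (0 : Vec d) (2 * ‖θ‖ / α)).exists_isMaxOn
    ⟨0, Metric.mem_closedBall_self (by positivity)⟩ hc.continuousOn
  refine ⟨z, fun z' => ?_⟩
  by_cases h : z' ∈ Metric.closedBall (0 : Vec d) (2 * ‖θ‖ / α)
  · exact hz h
  · have h0 : surplus f θ 0 ≤ surplus f θ z := hz (Metric.mem_closedBall_self (by positivity))
    have h1 : surplus f θ 0 = 0 := by simp [surplus, hf.map_zero]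
    rw [mem_closedBall_zero_iff, not_le, div_lt_iff₀ hα] at h
    have h2 := hf.sq_le z'
    have h3 := real_inner_le_norm θ z'
    have h4 : surplus f θ z' ≤ 0 := by
      unfold surplus
      nlinarith [norm_nonneg z']
    linarith

lemma surplus_le (hf : IsManipulationCost α f) (θ z : Vec d) :
    surplus f θ z ≤ surplus f θ (optShift f θ) :=
  Classical.epsilon_spec (hf.exists_forall_surplus_le θ) z

/-- Quadratic growth of the loss of surplus. -/
lemma sq_norm_sub_optShift_le (hf : IsManipulationCost α f) (θ z : Vec d) :
    α / 2 * ‖z - optShift f θ‖ ^ 2 ≤ surplus f θ (optShift f θ) - surplus f θ z := by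
  -- The maximiser `x` is compared with `(1 - t) x + t z`; the strong convexity term is `(1 - t) t
  -- α/2 ‖x - z‖²`, and the common factor `t` is cancelled.
  refine le_of_forall_mul_one_sub_le fun t h0 h1 => ?_
  set x := optShift f θ
  have h := hf.strong_ineq x z h0 h1
  have h2 := hf.surplus_le θ ((1 - t) • x + t • z)
  unfold surplus at h2 ⊢
  rw [inner_add_right, real_inner_smul_right, real_inner_smul_right] at h2
  rw [norm_sub_rev]
  refine le_of_mul_le_mul_left ?_ h0
  change _ - _ ≤ inner ℝ θ x - f x at h2
  nlinarith

/-- Euler's identity combined with the first-order condition. On the ray through the maximiser the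
surplus is `r ⟨θ, x⟩ - r² f x`, which is largest at `r = 1`; `r = 1 + t` yields one inequality and
`r = 1 - t` the other. -/
lemma inner_optShift (hf : IsManipulationCost α f) (θ : Vec d) :
    inner ℝ θ (optShift f θ) = 2 * f (optShift f θ) := by
  set x := optShift f θ with hx
  have key : ∀ r : ℝ, 0 < r → r * inner ℝ θ x - r ^ 2 * f x ≤ inner ℝ θ x - f x := by
    intro r hr
    have := hf.surplus_le θ (r • x)
    unfold surplus at this
    rwa [real_inner_smul_right, hf.homog r hr] at this
  have hpos : 0 ≤ f x := by
    have := hf.sq_le x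
    have := hf.pos
    have : 0 ≤ α / 2 * ‖x‖ ^ 2 := by positivity
    linarith
  apply le_antisymm
  · refine le_of_forall_mul_one_sub_le fun t h0 h1 => ?_
    have h := key (1 + t) (by linarith)
    have : t * inner ℝ θ x ≤ t * ((2 + t) * f x) := by nlinarith
    have h3 := mul_le_mul_of_nonneg_left (le_of_mul_le_mul_left this h0) (by linarith : 0 ≤ 1 - t)
    nlinarith [mul_nonneg h0.le hpos, mul_nonneg (mul_nonneg h0.le h0.le) hpos]
  · refine le_of_forall_mul_one_sub_le fun t h0 h1 => ?_
    have h := key (1 - t) (by linarith)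
    have : t * ((2 - t) * f x) ≤ t * inner ℝ θ x := by nlinarith
    have h3 := le_of_mul_le_mul_left this h0
    nlinarith

/-- At the maximiser `z`, `α ‖z‖² ≤ 2 f z = ⟨θ, z⟩ ≤ ‖θ‖ ‖z‖`. -/
lemma norm_optShift_le (hf : IsManipulationCost α f) (θ : Vec d) :
    ‖optShift f θ‖ ≤ ‖θ‖ / α := by
  have hα := hf.pos
  have h1 := hf.inner_optShift θ
  have h2 := hf.sq_le (optShift f θ)
  have h3 := real_inner_le_norm θ (optShift f θ)
  rw [le_div_iff₀ hα]
  rcases (norm_nonneg (optShift f θ)).eq_or_lt with h | h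
  · rw [← h]; simp
  · refine le_of_mul_le_mul_right ?_ h
    nlinarith

/-- The largest surplus, as a function of the classifier, is half of `⟨θ, z*(θ)⟩`. -/
lemma two_mul_surplus_optShift (hf : IsManipulationCost α f) (θ : Vec d) :
    2 * surplus f θ (optShift f θ) = inner ℝ θ (optShift f θ) := by
  have := hf.inner_optShift θ
  unfold surplus
  linarith

lemma surplus_optShift_le (hf : IsManipulationCost α f) (θ : Vec d) :
    surplus f θ (optShift f θ) ≤ ‖θ‖ ^ 2 / (2 * α) := by
  have hα := hf.pos
  have h1 := hf.two_mul_surplus_optShift θ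
  have h2 := real_inner_le_norm θ (optShift f θ)
  have h3 := mul_le_mul_of_nonneg_left (hf.norm_optShift_le θ) (norm_nonneg θ)
  have : ‖θ‖ ^ 2 / (2 * α) = ‖θ‖ * (‖θ‖ / α) / 2 := by field_simp
  linarith

lemma surplus_optShift_nonneg (hf : IsManipulationCost α f) (θ : Vec d) :
    0 ≤ surplus f θ (optShift f θ) := by
  have := hf.surplus_le θ 0
  simpa [surplus, hf.map_zero] using this

/-- A supremum over `z` of functions affine in `θ`: the maximiser at the convex combination is a
competitor at both end points. -/
lemma convexOn_surplus_optShift (hf : IsManipulationCost α f) :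
    ConvexOn ℝ univ fun θ => surplus f θ (optShift f θ) := by
  refine ⟨convex_univ, fun x _ y _ a b ha hb hab => ?_⟩
  have h1 := mul_le_mul_of_nonneg_left (hf.surplus_le x (optShift f (a • x + b • y))) ha
  have h2 := mul_le_mul_of_nonneg_left (hf.surplus_le y (optShift f (a • x + b • y))) hb
  simp only [smul_eq_mul]
  refine le_trans (le_of_eq ?_) (add_le_add h1 h2)
  simp only [surplus, inner_add_left, real_inner_smul_left]
  linear_combination (f (optShift f (a • x + b • y))) * hab

/-- Envelope argument: the maximiser for `θ` is a competitor for `θ'`, and the two surpluses of this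
one displacement differ by an inner product with `θ - θ'`. -/
lemma surplus_optShift_sub_le (hf : IsManipulationCost α f) (θ θ' : Vec d) :
    surplus f θ (optShift f θ) - surplus f θ' (optShift f θ') ≤ ‖θ‖ / α * ‖θ - θ'‖ := by
  have h1 := hf.surplus_le θ' (optShift f θ)
  have h2 := real_inner_le_norm (θ - θ') (optShift f θ)
  have h3 := mul_le_mul_of_nonneg_left (hf.norm_optShift_le θ) (norm_nonneg (θ - θ'))
  have h4 : surplus f θ (optShift f θ) - surplus f θ' (optShift f θ) =
      inner ℝ (θ - θ') (optShift f θ) := by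
    simp only [surplus, inner_sub_left]; ring
  linarith

end IsManipulationCost

/-- Joint measurability of the optimal displacement in the cost and the classifier. -/
lemma measurable_optShift {Ω : Type*} [MeasurableSpace Ω] {d : ℕ} {α : ℝ}
    {f : Ω → Vec d → ℝ} (hf : ∀ ω, IsManipulationCost α (f ω))
    (hm : ∀ z, Measurable fun ω => f ω z) :
    Measurable fun p : Ω × Vec d => optShift (f p.1) p.2 := by
  classical
  let q : ℕ → Vec d := TopologicalSpace.denseSeq (Vec d)
  have hq : DenseRange q := TopologicalSpace.denseRange_denseSeq _
  have hcont : ∀ ω θ, Continuous (surplus (f ω) θ) := by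
    intro ω θ
    have := (hf ω).continuous
    unfold surplus; fun_prop
  have hs : ∀ z, Measurable fun p : Ω × Vec d => surplus (f p.1) p.2 z := by
    intro z
    unfold surplus
    have h1 := hm z
    fun_prop
  -- `q k` is optimal up to `1 / (n + 1)` among the points of the dense sequence, which is a
  -- measurable condition on `p`. The first such `k` is measurable in `p`, and quadratic growth
  -- makes the chosen points converge to the maximiser.
  let Q : ℕ → Ω × Vec d → ℕ → Prop := fun n p k =>
    ∀ j, surplus (f p.1) p.2 (q j) ≤ surplus (f p.1) p.2 (q k) + 1 / ((n : ℝ) + 1)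
  have hex : ∀ n p, ∃ k, Q n p k := by
    intro n p
    have hpos : (0 : ℝ) < 1 / ((n : ℝ) + 1) := by positivity
    obtain ⟨k, hk⟩ := hq.exists_mem_open
      (isOpen_lt continuous_const (hcont p.1 p.2) : IsOpen {z |
        surplus (f p.1) p.2 (optShift (f p.1) p.2) - 1 / ((n : ℝ) + 1) < surplus (f p.1) p.2 z})
      ⟨optShift (f p.1) p.2, by simp only [mem_ofPred_eq]; linarith⟩
    refine ⟨k, fun j => ?_⟩
    have := (hf p.1).surplus_le p.2 (q j)
    simp only [mem_ofPred_eq] at hk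
    linarith
  have hQ : ∀ n p k, Q n p k →
      surplus (f p.1) p.2 (optShift (f p.1) p.2) ≤ surplus (f p.1) p.2 (q k) + 1 / ((n : ℝ) + 1) := by
    intro n p k hk
    have hcl : IsClosed {z | surplus (f p.1) p.2 z ≤ surplus (f p.1) p.2 (q k) + 1 / ((n : ℝ) + 1)} :=
      isClosed_le (hcont p.1 p.2) continuous_const
    have := hq.induction_on (p := fun z =>
      surplus (f p.1) p.2 z ≤ surplus (f p.1) p.2 (q k) + 1 / ((n : ℝ) + 1))
      (optShift (f p.1) p.2) hcl hk
    exact this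
  let z : ℕ → Ω × Vec d → Vec d := fun n p => q (Nat.find (hex n p))
  refine measurable_of_tendsto_metrizable (f := z) (fun n => ?_) ?_
  · refine (measurable_from_nat (f := q)).comp (measurable_find (hex n) fun k => ?_)
    have : {x | Q n x k} = ⋂ j, {p : Ω × Vec d |
        surplus (f p.1) p.2 (q j) ≤ surplus (f p.1) p.2 (q k) + 1 / ((n : ℝ) + 1)} := by
      ext p; simp [Q]
    rw [this]
    exact MeasurableSet.iInter fun j => measurableSet_le (hs _) ((hs _).add_const _)
  · rw [tendsto_pi_nhds]
    intro p
    have hα := (hf p.1).pos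
    rw [tendsto_iff_norm_sub_tendsto_zero]
    have hlim : Filter.Tendsto (fun n : ℕ => Real.sqrt (2 / α * (1 / ((n : ℝ) + 1)))) Filter.atTop
        (nhds 0) := by
      have := (tendsto_one_div_add_atTop_nhds_zero_nat (𝕜 := ℝ)).const_mul (2 / α)
      have h2 := (Real.continuous_sqrt.tendsto _).comp this
      simpa [Function.comp_def] using h2
    refine squeeze_zero (fun _ => norm_nonneg _) (fun n => ?_) hlim
    apply Real.le_sqrt_of_sq_le
    have h1 := (hf p.1).sq_norm_sub_optShift_le p.2 (z n p)
    have h2 := hQ n p _ (Nat.find_spec (hex n p))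
    have h3 : α / 2 * ‖z n p - optShift (f p.1) p.2‖ ^ 2 ≤ 1 / ((n : ℝ) + 1) := by
      simp only [z] at h1 ⊢; linarith
    calc _ = 2 / α * (α / 2 * ‖z n p - optShift (f p.1) p.2‖ ^ 2) := by field_simp
      _ ≤ _ := by gcongr

/-! ### Losses -/

/-- The properties of the margin functions `z ↦ log (1 + exp z)` and `z ↦ max 0 (1 + z)`. -/
structure IsMarginLoss (g : ℝ → ℝ) : Prop where
  convex : ConvexOn ℝ univ g
  mono : Monotone g
  lipschitz : ∀ a b, |g a - g b| ≤ |a - b|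
  nonneg : ∀ a, 0 ≤ g a
  zero_le_one : g 0 ≤ 1

lemma isMarginLoss_hinge : IsMarginLoss fun z => max 0 (1 + z) where
  convex := by
    refine (convexOn_const 0 convex_univ).sup ((convexOn_const 1 convex_univ).add ?_)
    exact convexOn_id convex_univ
  mono a b h := by dsimp only; gcongr
  lipschitz a b := by
    refine (abs_max_sub_max_le_max _ _ _ _).trans ?_
    simp
  nonneg a := le_max_left _ _
  zero_le_one := by simp

lemma isMarginLoss_softplus : IsMarginLoss fun z => Real.log (1 + Real.exp z) := by
  have hd : ∀ z, HasDerivAt (fun z => Real.log (1 + Real.exp z))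
      (Real.exp z / (1 + Real.exp z)) z := by
    intro z
    have h := ((Real.hasDerivAt_exp z).const_add 1).log (by positivity)
    exact h
  have hde : deriv (fun z => Real.log (1 + Real.exp z)) = fun z =>
      Real.exp z / (1 + Real.exp z) := funext fun z => (hd z).deriv
  have hmono : Monotone fun z => Real.log (1 + Real.exp z) := by
    intro a b h
    dsimp only
    gcongr
  have hstep : ∀ a b : ℝ, a ≤ b → Real.log (1 + Real.exp b) - Real.log (1 + Real.exp a) ≤ b - a := by
    intro a b h
    have : Real.log (1 + Real.exp b) ≤ Real.log (Real.exp (b - a) * (1 + Real.exp a)) := by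
      gcongr
      rw [mul_add, ← Real.exp_add, mul_one, sub_add_cancel]
      have := Real.one_le_exp (sub_nonneg.2 h)
      linarith
    rw [Real.log_mul (by positivity) (by positivity), Real.log_exp] at this
    linarith
  refine ⟨?_, hmono, fun a b => ?_, fun a => Real.log_nonneg (by linarith [Real.exp_pos a]), ?_⟩
  · refine Monotone.convexOn_univ_of_deriv (fun z => (hd z).differentiableAt) ?_
    rw [hde]
    intro a b h
    have h1 := Real.exp_le_exp.2 h
    dsimp only
    rw [div_le_div_iff₀ (by positivity) (by positivity)]
    nlinarith
  · rcases le_total a b with h | h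
    · have h1 := hstep a b h
      have h2 := hmono h
      dsimp only at h2
      rw [abs_sub_comm, abs_sub_comm a, abs_of_nonneg (by linarith), abs_of_nonneg (by linarith)]
      exact h1
    · have h1 := hstep b a h
      have h2 := hmono h
      dsimp only at h2
      rw [abs_of_nonneg (by linarith), abs_of_nonneg (by linarith)]
      exact h1
  · simp only [Real.exp_zero]
    have := Real.log_le_sub_one_of_pos (show (0 : ℝ) < 1 + 1 by norm_num)
    linarith

lemma IsMarginLoss.continuous {g : ℝ → ℝ} (hg : IsMarginLoss g) : Continuous g :=
  hg.convex.locallyLipschitz.continuous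

lemma IsMarginLoss.le_one_add_abs {g : ℝ → ℝ} (hg : IsMarginLoss g) (a : ℝ) : g a ≤ 1 + |a| := by
  have h1 := (abs_le.1 (hg.lipschitz a 0)).2
  have h2 := hg.zero_le_one
  rw [sub_zero] at h1
  linarith

lemma exists_isMarginLoss {d : ℕ} {ℓ : Vec d → Vec d → ℝ → ℝ}
    (h : ℓ = logisticLoss ∨ ℓ = hingeLoss) :
    ∃ g, IsMarginLoss g ∧ ℓ = fun θ x y => g (-(y * inner ℝ θ x)) := by
  rcases h with rfl | rfl
  · exact ⟨_, isMarginLoss_softplus, rfl⟩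
  · refine ⟨_, isMarginLoss_hinge, ?_⟩
    ext θ x y
    simp [hingeLoss, sub_eq_add_neg]

/-! ### Best responses -/

namespace AgentType

variable {d : ℕ}

/-- The cost as a function of the displacement. -/
def manipCost (a : AgentType d) : Vec d → ℝ := fun z => a.cost z 0

open Classical in
/-- The best response to `θ`. -/
def response (a : AgentType d) (θ : Vec d) : Vec d :=
  if a.y = 1 then a.x else a.x + optShift a.manipCost θ

/-- The stage payoff without the infinite penalty. -/
def realPayoff (a : AgentType d) (θ z : Vec d) : ℝ := inner ℝ θ z - a.cost z a.x

/-- The argument of the margin loss when the agent best-responds. -/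
def margin (a : AgentType d) (θ : Vec d) : ℝ := -(a.y * inner ℝ θ (a.response θ))

lemma payoff_le_realPayoff (a : AgentType d) (θ z : Vec d) : a.payoff θ z ≤ a.realPayoff θ z := by
  unfold payoff realPayoff
  split_ifs
  · exact bot_le
  · exact le_rfl

lemma payoff_eq_of_ne_bot {a : AgentType d} {θ z : Vec d} (h : a.payoff θ z ≠ ⊥) :
    a.payoff θ z = a.realPayoff θ z := by
  unfold payoff realPayoff at *
  split_ifs at h ⊢ with h1
  · exact absurd rfl h
  · rfl

lemma payoff_response (a : AgentType d) (θ : Vec d) :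
    a.payoff θ (a.response θ) = a.realPayoff θ (a.response θ) := by
  unfold payoff response
  by_cases h : a.y = 1 <;> simp [h, realPayoff]

namespace Regular

variable {R α : ℝ} {a : AgentType d}

lemma isManipulationCost (ha : a.Regular R α) (hα : 0 < α) : IsManipulationCost α a.manipCost := by
  obtain ⟨f, h1, h2, h3⟩ := ha.cost
  have : a.manipCost = f := by
    ext z; simp [manipCost, h3]
  rw [this]
  exact ⟨hα, h1, h2⟩

lemma cost_eq (ha : a.Regular R α) (x' x : Vec d) : a.cost x' x = a.manipCost (x' - x) := by
  obtain ⟨f, h1, h2, h3⟩ := ha.cost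
  simp [manipCost, h3]

lemma abs_label (ha : a.Regular R α) : |a.y| = 1 := by
  rcases ha.label with h | h <;> simp [h]

lemma realPayoff_eq (ha : a.Regular R α) (θ z : Vec d) :
    a.realPayoff θ z = inner ℝ θ a.x + surplus a.manipCost θ (z - a.x) := by
  unfold realPayoff surplus
  rw [ha.cost_eq, inner_sub_right]
  ring

/-- Quadratic growth of the payoff lost by a suboptimal response. -/
lemma sq_norm_sub_response_le (ha : a.Regular R α) (hα : 0 < α) {θ z : Vec d}
    (hz : a.payoff θ z ≠ ⊥) :
    α / 2 * ‖z - a.response θ‖ ^ 2 ≤ a.realPayoff θ (a.response θ) - a.realPayoff θ z := by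
  by_cases h : a.y = 1
  · have : z = a.x := by
      by_contra hne
      exact hz (by simp [payoff, h, hne])
    simp [response, h, this]
  · have h1 := (ha.isManipulationCost hα).sq_norm_sub_optShift_le θ (z - a.x)
    rw [ha.realPayoff_eq, ha.realPayoff_eq]
    have h2 : a.response θ = a.x + optShift a.manipCost θ := by simp [response, h]
    rw [h2, add_sub_cancel_left, ← sub_sub]
    linarith

lemma payoff_le_response (ha : a.Regular R α) (hα : 0 < α) (θ z : Vec d) :
    a.payoff θ z ≤ a.payoff θ (a.response θ) := by
  by_cases hz : a.payoff θ z = ⊥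
  · rw [hz]; exact bot_le
  · rw [payoff_response, payoff_eq_of_ne_bot hz, EReal.coe_le_coe_iff]
    have := ha.sq_norm_sub_response_le hα hz
    have : 0 ≤ α / 2 * ‖z - a.response θ‖ ^ 2 := by positivity
    linarith

/-- Quadratic growth leaves no ties, so the tie-breaking rule in `bestRespLoss` is immaterial. -/
lemma bestResp_eq (ha : a.Regular R α) (hα : 0 < α) (θ : Vec d) :
    a.bestResp θ = {a.response θ} := by
  ext z
  simp only [bestResp, mem_ofPred_eq, mem_singleton_iff]
  refine ⟨fun h => ?_, fun h => h ▸ ha.payoff_le_response hα θ⟩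
  have h1 := h (a.response θ)
  have hne : a.payoff θ z ≠ ⊥ := by
    intro hb
    rw [hb, le_bot_iff, payoff_response] at h1
    exact EReal.coe_ne_bot _ h1
  rw [payoff_response, payoff_eq_of_ne_bot hne, EReal.coe_le_coe_iff] at h1
  have h2 := ha.sq_norm_sub_response_le hα hne
  have h3 : ‖z - a.response θ‖ ^ 2 ≤ 0 := by
    by_contra hlt
    push Not at hlt
    have : 0 < α / 2 * ‖z - a.response θ‖ ^ 2 := by positivity
    linarith
  have h4 : ‖z - a.response θ‖ = 0 := by
    have := sq_nonneg ‖z - a.response θ‖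
    exact pow_eq_zero_iff two_ne_zero |>.1 (le_antisymm h3 this)
  exact sub_eq_zero.1 (norm_eq_zero.1 h4)

lemma bestRespLoss_eq (ha : a.Regular R α) (hα : 0 < α) (ℓ : Vec d → Vec d → ℝ → ℝ) (θ : Vec d) :
    a.bestRespLoss ℓ θ = ℓ θ (a.response θ) a.y := by
  rw [bestRespLoss, ha.bestResp_eq hα, image_singleton, csInf_singleton]

lemma abs_inner_feature_le (ha : a.Regular R α) (θ : Vec d) : |inner ℝ θ a.x| ≤ ‖θ‖ * R :=
  (abs_real_inner_le_norm θ a.x).trans (mul_le_mul_of_nonneg_left ha.feature (norm_nonneg _))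

lemma le_realPayoff_response (ha : a.Regular R α) (hα : 0 < α) (θ : Vec d) :
    -(‖θ‖ * R) ≤ a.realPayoff θ (a.response θ) := by
  have h0 := (abs_le.1 (ha.abs_inner_feature_le θ)).1
  have hf := ha.isManipulationCost hα
  rw [ha.realPayoff_eq]
  by_cases h : a.y = 1
  · simpa [response, h, surplus, hf.map_zero] using h0
  · have := hf.surplus_optShift_nonneg θ
    simp only [response, h, if_false, add_sub_cancel_left]
    linarith

lemma realPayoff_le (ha : a.Regular R α) (hα : 0 < α) (θ z : Vec d) :
    a.realPayoff θ z ≤ ‖θ‖ * R + ‖θ‖ ^ 2 / (2 * α) := by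
  have h0 := (abs_le.1 (ha.abs_inner_feature_le θ)).2
  have hf := ha.isManipulationCost hα
  rw [ha.realPayoff_eq]
  have h1 := hf.surplus_le θ (z - a.x)
  have h2 := hf.surplus_optShift_le θ
  linarith

/-- The source of convexity. For `y = -1` the manipulation contributes `⟨θ, z⟩`, which is twice the
largest surplus; for `y = 1` there is no manipulation. The factor `1 - y` covers both cases and is
nonnegative. -/
lemma margin_eq (ha : a.Regular R α) (hα : 0 < α) (θ : Vec d) :
    a.margin θ = -(a.y * inner ℝ θ a.x) +
      (1 - a.y) * surplus a.manipCost θ (optShift a.manipCost θ) := by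
  have hf := (ha.isManipulationCost hα).two_mul_surplus_optShift θ
  unfold margin response
  rcases ha.label with h | h
  · have : (-1 : ℝ) ≠ 1 := by norm_num
    simp only [h, this, if_false, inner_add_right]
    linarith
  · simp [h]

lemma convexOn_margin (ha : a.Regular R α) (hα : 0 < α) : ConvexOn ℝ univ a.margin := by
  have hy : 0 ≤ 1 - a.y := by rcases ha.label with h | h <;> rw [h] <;> norm_num
  have h1 : ConvexOn ℝ univ fun θ : Vec d => -(a.y * inner ℝ θ a.x) := by
    refine ⟨convex_univ, fun x _ y _ s t _ _ _ => le_of_eq ?_⟩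
    simp only [inner_add_left, real_inner_smul_left, smul_eq_mul]
    ring
  have h2 := (ha.isManipulationCost hα).convexOn_surplus_optShift.smul hy
  refine (h1.add h2).congr fun θ _ => ?_
  simp [ha.margin_eq hα]

lemma abs_margin_sub_le (ha : a.Regular R α) (hα : 0 < α) {θ θ' : Vec d} (h : ‖θ‖ ≤ R)
    (h' : ‖θ'‖ ≤ R) : |a.margin θ - a.margin θ'| ≤ (R + 2 * R / α) * ‖θ - θ'‖ := by
  have hf := ha.isManipulationCost hα
  have h1 := hf.surplus_optShift_sub_le θ θ'
  have h2 := hf.surplus_optShift_sub_le θ' θ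
  rw [norm_sub_rev] at h2
  have h3 : ‖θ‖ / α * ‖θ - θ'‖ ≤ R / α * ‖θ - θ'‖ := by gcongr
  have h4 : ‖θ'‖ / α * ‖θ - θ'‖ ≤ R / α * ‖θ - θ'‖ := by gcongr
  have h5 : |inner ℝ (θ - θ') a.x| ≤ ‖θ - θ'‖ * R := ha.abs_inner_feature_le _
  rw [inner_sub_left, abs_le] at h5
  rw [ha.margin_eq hα, ha.margin_eq hα, abs_le]
  have h6 : (R + 2 * R / α) * ‖θ - θ'‖ = ‖θ - θ'‖ * R + 2 * (R / α * ‖θ - θ'‖) := by ring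
  have h7 : 0 ≤ R / α * ‖θ - θ'‖ := by
    have : 0 ≤ R := (norm_nonneg _).trans h
    positivity
  rw [h6]
  rcases ha.label with hy | hy <;> rw [hy] <;> constructor <;> linarith [h5.1, h5.2]

lemma abs_margin_le (ha : a.Regular R α) (hα : 0 < α) {θ : Vec d} (h : ‖θ‖ ≤ R) :
    |a.margin θ| ≤ R ^ 2 + R ^ 2 / α := by
  have hR : 0 ≤ R := (norm_nonneg _).trans h
  have hf := ha.isManipulationCost hα
  have h1 := hf.surplus_optShift_le θ
  have h2 := hf.surplus_optShift_nonneg θ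
  have h3 : ‖θ‖ ^ 2 / (2 * α) ≤ R ^ 2 / (2 * α) := by gcongr
  have h4 : R ^ 2 / α = 2 * (R ^ 2 / (2 * α)) := by field_simp
  have h5 := abs_le.1 (ha.abs_inner_feature_le θ)
  have h6 : ‖θ‖ * R ≤ R * R := by gcongr
  rw [ha.margin_eq hα, abs_le, h4]
  have h7 : 0 ≤ R ^ 2 / (2 * α) := by positivity
  rcases ha.label with hy | hy <;> rw [hy] <;> constructor <;> nlinarith

end Regular

end AgentType

/-- The loss when the agent best-responds, for the margin loss `g`. -/
def brLoss {d : ℕ} (g : ℝ → ℝ) (a : AgentType d) (θ : Vec d) : ℝ := g (a.margin θ)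

namespace AgentType.Regular

variable {d : ℕ} {R α : ℝ} {a : AgentType d} {g : ℝ → ℝ}

/-- A nondecreasing convex function of the convex margin. -/
lemma convexOn_brLoss (ha : a.Regular R α) (hα : 0 < α) (hg : IsMarginLoss g) :
    ConvexOn ℝ univ (brLoss g a) :=
  ⟨convex_univ, fun _ hx _ hy _ _ hs ht hst =>
    (hg.mono ((ha.convexOn_margin hα).2 hx hy hs ht hst)).trans
      (hg.convex.2 (mem_univ _) (mem_univ _) hs ht hst)⟩

lemma brLoss_sub_le (ha : a.Regular R α) (hα : 0 < α) (hg : IsMarginLoss g) {θ θ' : Vec d}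
    (h : ‖θ‖ ≤ R) (h' : ‖θ'‖ ≤ R) :
    brLoss g a θ - brLoss g a θ' ≤ (R + 2 * R / α) * ‖θ - θ'‖ :=
  (le_abs_self _).trans ((hg.lipschitz _ _).trans (ha.abs_margin_sub_le hα h h'))

lemma brLoss_nonneg (hg : IsMarginLoss g) (a : AgentType d) (θ : Vec d) : 0 ≤ brLoss g a θ :=
  hg.nonneg _

lemma brLoss_le (ha : a.Regular R α) (hα : 0 < α) (hg : IsMarginLoss g) {θ : Vec d}
    (h : ‖θ‖ ≤ R) : brLoss g a θ ≤ 1 + R ^ 2 + R ^ 2 / α := by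
  have h1 := hg.le_one_add_abs (a.margin θ)
  have h2 := ha.abs_margin_le hα h
  unfold brLoss
  linarith

/-- The margin vanishes at `θ = 0`. This bounds the price of shrinking the comparator towards `0` by
`δ` per round. -/
lemma brLoss_zero_le (hg : IsMarginLoss g) (a : AgentType d) : brLoss g a 0 ≤ 1 := by
  simpa [brLoss, margin] using hg.zero_le_one

/-- The observed loss differs from the loss at the best response by at most `R` times the
distance of the responses. -/
lemma abs_loss_sub_brLoss_le (ha : a.Regular R α) (hg : IsMarginLoss g) {θ : Vec d}
    (h : ‖θ‖ ≤ R) (z : Vec d) :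
    |g (-(a.y * inner ℝ θ z)) - brLoss g a θ| ≤ R * ‖z - a.response θ‖ := by
  refine (hg.lipschitz _ _).trans ?_
  have : -(a.y * inner ℝ θ z) - a.margin θ = -a.y * inner ℝ θ (z - a.response θ) := by
    unfold margin; rw [inner_sub_right]; ring
  rw [this, abs_mul, abs_neg, ha.abs_label, one_mul]
  exact (abs_real_inner_le_norm _ _).trans (mul_le_mul_of_nonneg_right h (norm_nonneg _))

end AgentType.Regular

lemma AgentType.measurable_response {Ω : Type*} [MeasurableSpace Ω] {d : ℕ} {R α : ℝ} (hα : 0 < α)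
    {a : Ω → AgentType d} (ha : ∀ ω, (a ω).Regular R α) (hx : Measurable fun ω => (a ω).x)
    (hy : Measurable fun ω => (a ω).y)
    (hc : ∀ x' x, Measurable fun ω => (a ω).cost x' x) :
    Measurable fun p : Ω × Vec d => (a p.1).response p.2 := by
  have h1 : Measurable fun p : Ω × Vec d => optShift (a p.1).manipCost p.2 :=
    measurable_optShift (fun ω => (ha ω).isManipulationCost hα) fun z => hc z 0
  unfold AgentType.response
  refine Measurable.ite ?_ (hx.comp measurable_fst) ((hx.comp measurable_fst).add h1)
  exact (hy.comp measurable_fst) (measurableSet_singleton 1)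

/-- Joint measurability of the payoff without penalty. -/
lemma AgentType.measurable_realPayoff {Ω : Type*} [MeasurableSpace Ω] {d : ℕ} {R α : ℝ}
    (hα : 0 < α) {a : Ω → AgentType d} (ha : ∀ ω, (a ω).Regular R α)
    (hx : Measurable fun ω => (a ω).x) (hc : ∀ x' x, Measurable fun ω => (a ω).cost x' x) :
    Measurable fun p : Ω × Vec d × Vec d => (a p.1).realPayoff p.2.1 p.2.2 := by
  have h1 : Measurable fun p : Vec d × Ω => (a p.2).manipCost p.1 :=
    measurable_uncurry_of_continuous_of_measurable (u := fun z ω => (a ω).manipCost z)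
      (fun ω => ((ha ω).isManipulationCost hα).continuous) fun z => hc z 0
  unfold AgentType.realPayoff
  simp only [fun ω x' x => (ha ω).cost_eq x' x]
  refine Measurable.sub (by fun_prop) ?_
  exact h1.comp (g := fun p : Vec d × Ω => (a p.2).manipCost p.1)
    (f := fun p : Ω × Vec d × Vec d => (p.2.2 - (a p.1).x, p.1))
    ((measurable_snd.snd.sub (hx.comp measurable_fst)).prodMk measurable_fst)

lemma AgentType.measurable_payoff {Ω : Type*} [MeasurableSpace Ω] {d : ℕ} {R α : ℝ}
    (hα : 0 < α) {a : Ω → AgentType d} (ha : ∀ ω, (a ω).Regular R α)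
    (hx : Measurable fun ω => (a ω).x) (hy : Measurable fun ω => (a ω).y)
    (hc : ∀ x' x, Measurable fun ω => (a ω).cost x' x) :
    Measurable fun p : Ω × Vec d × Vec d => (a p.1).payoff p.2.1 p.2.2 := by
  have h1 := AgentType.measurable_realPayoff hα ha hx hc
  unfold AgentType.payoff
  refine Measurable.ite ?_ measurable_const h1.coe_real_ereal
  exact ((hy.comp measurable_fst) (measurableSet_singleton 1)).inter
    (measurableSet_eq_fun measurable_snd.snd (hx.comp measurable_fst)).compl

/-! ### Euclidean projection -/

section Projection

variable {d : ℕ} {K : Set (Vec d)}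

lemma euclideanProj_spec (hne : K.Nonempty) (hcl : IsClosed K) (hK : Convex ℝ K) (w : Vec d) :
    euclideanProj K w ∈ K ∧ ∀ z' ∈ K, dist w (euclideanProj K w) ≤ dist w z' := by
  refine Classical.epsilon_spec (p := fun z => z ∈ K ∧ ∀ z' ∈ K, dist w z ≤ dist w z') ?_
  obtain ⟨v, hv, h⟩ := exists_norm_eq_iInf_of_complete_convex hne hcl.isComplete hK w
  refine ⟨v, hv, fun z hz => ?_⟩
  rw [dist_eq_norm, dist_eq_norm, h]
  exact ciInf_le ⟨0, forall_mem_range.2 fun _ => norm_nonneg _⟩ (⟨z, hz⟩ : K)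

lemma inner_sub_euclideanProj_le (hne : K.Nonempty) (hcl : IsClosed K) (hK : Convex ℝ K)
    (w : Vec d) {u : Vec d} (hu : u ∈ K) :
    inner ℝ (w - euclideanProj K w) (u - euclideanProj K w) ≤ 0 := by
  obtain ⟨h1, h2⟩ := euclideanProj_spec hne hcl hK w
  refine (norm_eq_iInf_iff_real_inner_le_zero hK h1).1 ?_ u hu
  have : Nonempty K := hne.to_subtype
  refine le_antisymm (le_ciInf fun z => ?_)
    (ciInf_le ⟨0, forall_mem_range.2 fun _ => norm_nonneg _⟩ (⟨_, h1⟩ : K))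
  simpa [dist_eq_norm] using h2 z z.2

lemma norm_euclideanProj_sub_le (hne : K.Nonempty) (hcl : IsClosed K) (hK : Convex ℝ K)
    (w : Vec d) {u : Vec d} (hu : u ∈ K) : ‖euclideanProj K w - u‖ ^ 2 ≤ ‖w - u‖ ^ 2 := by
  have h := inner_sub_euclideanProj_le hne hcl hK w hu
  set z := euclideanProj K w
  have h1 : w - u = (w - z) - (u - z) := by abel
  rw [h1, norm_sub_sq_real (w - z), norm_sub_rev z u]
  nlinarith [sq_nonneg ‖w - z‖]

lemma continuous_euclideanProj (hne : K.Nonempty) (hcl : IsClosed K) (hK : Convex ℝ K) :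
    Continuous (euclideanProj K) := by
  refine (LipschitzWith.of_dist_le_mul (K := 1) fun w w' => ?_).continuous
  rw [NNReal.coe_one, one_mul, dist_eq_norm, dist_eq_norm]
  have h1 := inner_sub_euclideanProj_le hne hcl hK w (euclideanProj_spec hne hcl hK w').1
  have h2 := inner_sub_euclideanProj_le hne hcl hK w' (euclideanProj_spec hne hcl hK w).1
  set z := euclideanProj K w
  set z' := euclideanProj K w'
  -- Sum of the two variational inequalities: the projection is firmly nonexpansive.
  have h3 : ‖z - z'‖ ^ 2 ≤ inner ℝ (w - w') (z - z') := by
    rw [← real_inner_self_eq_norm_sq]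
    simp only [inner_sub_left, inner_sub_right] at *
    linarith
  have h4 := real_inner_le_norm (w - w') (z - z')
  rcases (norm_nonneg (z - z')).eq_or_lt with h | h
  · rw [← h]; exact norm_nonneg _
  · refine le_of_mul_le_mul_right ?_ h
    nlinarith

end Projection

/-! ### Shrunken domains -/

section Shrink

variable {d : ℕ} {S : Set (Vec d)} {R δ : ℝ}

/-- The conditions on the domain of the learner. -/
structure IsClassifierDomain (S : Set (Vec d)) (R : ℝ) : Prop where
  convex : Convex ℝ S
  closed : IsClosed S
  ball_subset : Metric.closedBall 0 1 ⊆ S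
  subset_ball : S ⊆ Metric.closedBall 0 R

lemma IsClassifierDomain.zero_mem (hS : IsClassifierDomain S R) : (0 : Vec d) ∈ S :=
  hS.ball_subset (Metric.mem_closedBall_self zero_le_one)

lemma IsClassifierDomain.norm_le (hS : IsClassifierDomain S R) {z : Vec d} (hz : z ∈ S) : ‖z‖ ≤ R :=
  mem_closedBall_zero_iff.1 (hS.subset_ball hz)

lemma IsClassifierDomain.zero_mem_shrink (hS : IsClassifierDomain S R) :
    (0 : Vec d) ∈ (fun z => (1 - δ) • z) '' S := ⟨0, hS.zero_mem, by simp⟩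

lemma IsClassifierDomain.convex_shrink (hS : IsClassifierDomain S R) : Convex ℝ ((fun z => (1 - δ) • z) '' S) :=
  hS.convex.smul (1 - δ)

lemma IsClassifierDomain.closed_shrink (hS : IsClassifierDomain S R) : IsClosed ((fun z => (1 - δ) • z) '' S) := by
  have : IsCompact S := (isCompact_closedBall 0 R).of_isClosed_subset hS.closed hS.subset_ball
  exact (this.image (by fun_prop)).isClosed

/-- `(1 - δ) z + δ s` is a convex combination of a point of `S` and a point of the unit ball, which
lies in `S`. So every query of the learner is a legal classifier. -/
lemma IsClassifierDomain.add_smul_mem (hS : IsClassifierDomain S R) (h0 : 0 ≤ δ) (h1 : δ ≤ 1) {v s : Vec d}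
    (hv : v ∈ (fun z => (1 - δ) • z) '' S) (hs : ‖s‖ ≤ 1) : v + δ • s ∈ S := by
  obtain ⟨z, hz, rfl⟩ := hv
  exact hS.convex hz (hS.ball_subset (mem_closedBall_zero_iff.2 hs)) (by linarith) h0 (by ring)

lemma IsClassifierDomain.shrink_subset (hS : IsClassifierDomain S R) (h0 : 0 ≤ δ) (h1 : δ ≤ 1) {v : Vec d}
    (hv : v ∈ (fun z => (1 - δ) • z) '' S) : v ∈ S := by
  simpa using hS.add_smul_mem h0 h1 (s := 0) hv (by simp)

lemma IsClassifierDomain.one_le (hS : IsClassifierDomain S R) (hd : 1 ≤ d) : 1 ≤ R := by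
  have : ‖(EuclideanSpace.single (⟨0, hd⟩ : Fin d) (1 : ℝ) : Vec d)‖ ≤ R :=
    hS.norm_le (hS.ball_subset (by simp))
  simpa using this

end Shrink

/-! ### One step of gradient descent without a gradient -/

namespace GDwoG

variable {d : ℕ} {R : ℝ} (G : GDwoG d)

lemma update_mem (hS : IsClassifierDomain G.S R) (v s : Vec d) (c : ℝ) :
    G.update v s c ∈ (fun z => (1 - G.δ) • z) '' G.S :=
  (euclideanProj_spec ⟨_, hS.zero_mem_shrink⟩ hS.closed_shrink hS.convex_shrink _).1

lemma measurable_update (hS : IsClassifierDomain G.S R) :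
    Measurable fun p : Vec d × Vec d × ℝ => G.update p.1 p.2.1 p.2.2 := by
  refine (continuous_euclideanProj ⟨_, hS.zero_mem_shrink⟩ hS.closed_shrink
    hS.convex_shrink).measurable.comp ?_
  fun_prop

lemma norm_update_sub_sq_le (hS : IsClassifierDomain G.S R) (v s : Vec d) (c : ℝ) (hs : ‖s‖ ≤ 1)
    {u : Vec d} (hu : u ∈ (fun z => (1 - G.δ) • z) '' G.S) :
    ‖G.update v s c - u‖ ^ 2 ≤
      ‖v - u‖ ^ 2 - 2 * G.η * (c * inner ℝ s (v - u)) + G.η ^ 2 * c ^ 2 := by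
  refine (norm_euclideanProj_sub_le ⟨_, hS.zero_mem_shrink⟩ hS.closed_shrink hS.convex_shrink _
    hu).trans ?_
  rw [sub_right_comm, norm_sub_sq_real (v - u), real_inner_smul_right, norm_smul,
    real_inner_comm, mul_pow, Real.norm_eq_abs, sq_abs]
  have h1 : (G.η * c) ^ 2 * ‖s‖ ^ 2 ≤ (G.η * c) ^ 2 * 1 := by
    gcongr
    exact pow_le_one₀ (norm_nonneg _) hs
  nlinarith

end GDwoG

/-! ### One-point gradient estimates on the sphere -/

section Sphere

variable {d : ℕ}

/-- The radial cutoff that decreases linearly from `1` to `0` for `1 - ε ≤ ‖y‖ ≤ 1`. -/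
def radialCutoff (ε : ℝ) (y : Vec d) : ℝ := max 0 (min 1 ((1 - ‖y‖) / ε))

lemma radialCutoff_nonneg (ε : ℝ) (y : Vec d) : 0 ≤ radialCutoff ε y := le_max_left _ _

lemma radialCutoff_le_one (ε : ℝ) (y : Vec d) : radialCutoff ε y ≤ 1 :=
  max_le zero_le_one (min_le_left _ _)

lemma radialCutoff_neg (ε : ℝ) (y : Vec d) : radialCutoff ε (-y) = radialCutoff ε y := by
  simp [radialCutoff]

lemma radialCutoff_of_one_le {ε : ℝ} (hε : 0 < ε) {y : Vec d} (hy : 1 ≤ ‖y‖) :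
    radialCutoff ε y = 0 := by
  refine max_eq_left ((min_le_right _ _).trans ?_)
  exact div_nonpos_of_nonpos_of_nonneg (by linarith) hε.le

lemma radialCutoff_of_norm_le {ε : ℝ} (hε : 0 < ε) {y : Vec d} (hy : ‖y‖ ≤ 1 - ε) :
    radialCutoff ε y = 1 := by
  have : 1 ≤ (1 - ‖y‖) / ε := by rw [le_div_iff₀ hε]; linarith
  simp [radialCutoff, this]

lemma radialCutoff_of_mem {ε : ℝ} (hε : 0 < ε) {y : Vec d} (h1 : 1 - ε ≤ ‖y‖) (h2 : ‖y‖ ≤ 1) :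
    radialCutoff ε y = (1 - ‖y‖) / ε := by
  have h3 : (1 - ‖y‖) / ε ≤ 1 := by rw [div_le_iff₀ hε]; linarith
  have h4 : 0 ≤ (1 - ‖y‖) / ε := div_nonneg (by linarith) hε.le
  rw [radialCutoff, min_eq_right h3, max_eq_right h4]

lemma lipschitzWith_radialCutoff {ε : ℝ} (hε : 0 < ε) :
    LipschitzWith (ε⁻¹).toNNReal (radialCutoff ε : Vec d → ℝ) := by
  have h : LipschitzWith (ε⁻¹).toNNReal fun y : Vec d => (1 - ‖y‖) / ε := by
    refine LipschitzWith.of_dist_le_mul fun x y => ?_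
    rw [Real.coe_toNNReal _ (by positivity), Real.dist_eq, ← sub_div, abs_div, abs_of_pos hε,
      div_eq_inv_mul, sub_sub_sub_cancel_left, dist_eq_norm, abs_sub_comm]
    gcongr
    exact abs_norm_sub_norm_le _ _
  exact (h.const_min 1).const_max 0

lemma hasCompactSupport_radialCutoff {ε : ℝ} (hε : 0 < ε) :
    HasCompactSupport (radialCutoff ε : Vec d → ℝ) := by
  refine HasCompactSupport.intro (isCompact_closedBall (0 : Vec d) 1) fun y hy => ?_
  rw [mem_closedBall_zero_iff, not_le] at hy
  exact radialCutoff_of_one_le hε hy.le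

lemma hasDerivAt_norm_add_smul {y : Vec d} (hy : y ≠ 0) (w : Vec d) :
    HasDerivAt (fun t : ℝ => ‖y + t • w‖) (inner ℝ (‖y‖⁻¹ • y) w) 0 := by
  have h1 : HasDerivAt (fun t : ℝ => y + t • w) w 0 := by
    simpa using ((hasDerivAt_id (0 : ℝ)).smul_const w).const_add y
  have h2 := h1.norm_sq.sqrt (by simpa using hy)
  simp only [zero_smul, add_zero, Real.sqrt_sq (norm_nonneg _)] at h2
  convert h2 using 1
  rw [real_inner_smul_left]
  have : ‖y‖ ≠ 0 := norm_ne_zero_iff.2 hy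
  field_simp

/-- The derivative of the cutoff off the two spheres where it has a kink. -/
lemma lineDeriv_radialCutoff {ε : ℝ} (hε : 0 < ε) (hε1 : ε < 1) {y : Vec d} (h1 : ‖y‖ ≠ 1)
    (h2 : ‖y‖ ≠ 1 - ε) (w : Vec d) :
    lineDeriv ℝ (radialCutoff ε) y (-w) =
      (Ioo (1 - ε) 1).indicator (fun r => ε⁻¹ * (r⁻¹ * inner ℝ y w)) ‖y‖ := by
  have hcont : Filter.Tendsto (fun t : ℝ => ‖y + t • (-w)‖) (nhds 0) (nhds ‖y‖) := by
    have : Continuous fun t : ℝ => ‖y + t • (-w)‖ := by fun_prop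
    simpa using this.tendsto 0
  rcases lt_or_gt_of_ne h1 with h1 | h1
  · rcases lt_or_gt_of_ne h2 with h2 | h2
    · rw [indicator_of_notMem (fun h => absurd h.1 (not_lt.2 h2.le))]
      have : (fun t : ℝ => radialCutoff ε (y + t • (-w))) =ᶠ[nhds 0] fun _ => 1 := by
        filter_upwards [hcont.eventually_lt_const h2] with t ht
        exact radialCutoff_of_norm_le hε ht.le
      rw [lineDeriv, this.deriv_eq]
      simp
    · rw [indicator_of_mem (show ‖y‖ ∈ Ioo (1 - ε) 1 from ⟨h2, h1⟩)]
      have hy : y ≠ 0 := by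
        rintro rfl; rw [norm_zero] at h2; linarith
      have : (fun t : ℝ => radialCutoff ε (y + t • (-w))) =ᶠ[nhds 0]
          fun t => (1 - ‖y + t • (-w)‖) / ε := by
        filter_upwards [hcont.eventually_lt_const h1, hcont.eventually_const_lt h2] with t ht ht'
        exact radialCutoff_of_mem hε ht'.le ht.le
      rw [lineDeriv, this.deriv_eq,
        (((hasDerivAt_norm_add_smul hy (-w)).const_sub 1).div_const ε).deriv, inner_neg_right,
        neg_neg, real_inner_smul_left, div_eq_inv_mul]
  · rw [indicator_of_notMem (fun h => absurd h.2 (not_lt.2 h1.le))]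
    have : (fun t : ℝ => radialCutoff ε (y + t • (-w))) =ᶠ[nhds 0] fun _ => 0 := by
      filter_upwards [hcont.eventually_const_lt h1] with t ht
      exact radialCutoff_of_one_le hε ht.le
    rw [lineDeriv, this.deriv_eq]
    simp

/-- Integration in polar coordinates. -/
lemma integral_eq_integral_toSphere_prod [NeZero d] {F : Vec d → ℝ} (hF : Integrable F) :
    Integrable (fun q : Metric.sphere (0 : Vec d) 1 × Ioi (0 : ℝ) => F (q.2.1 • q.1.1))
      ((volume : Measure (Vec d)).toSphere.prod (Measure.volumeIoiPow (d - 1))) ∧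
    ∫ y, F y = ∫ q : Metric.sphere (0 : Vec d) 1 × Ioi (0 : ℝ), F (q.2.1 • q.1.1)
      ∂((volume : Measure (Vec d)).toSphere.prod (Measure.volumeIoiPow (d - 1))) := by
  have : Nonempty (Fin d) := ⟨⟨0, Nat.pos_of_neZero d⟩⟩
  have hp := (volume : Measure (Vec d)).measurePreserving_homeomorphUnitSphereProd
  have h := hp.integral_comp (Homeomorph.measurableEmbedding _)
    (fun q : Metric.sphere (0 : Vec d) 1 × Ioi (0 : ℝ) => F (q.2.1 • q.1.1))
  have hi := hp.integrable_comp_emb (Homeomorph.measurableEmbedding _)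
    (g := fun q : Metric.sphere (0 : Vec d) 1 × Ioi (0 : ℝ) => F (q.2.1 • q.1.1))
  rw [finrank_euclideanSpace_fin] at h hi
  have heq : ∀ x : ({(0)}ᶜ : Set (Vec d)), F (((homeomorphUnitSphereProd (Vec d)) x).2.1 •
      ((homeomorphUnitSphereProd (Vec d)) x).1.1) = F x.1 := by
    intro x
    have : (x : Vec d) ≠ 0 := x.2
    simp [this]
  rw [← h, ← hi]
  simp only [Function.comp_def, heq]
  refine ⟨?_, ?_⟩
  · have := (integrableOn_iff_comap_subtypeVal (s := ({(0)}ᶜ : Set (Vec d)))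
      (measurableSet_singleton _).compl (f := F) (μ := volume)).1 hF.integrableOn
    exact this
  · rw [integral_subtype_comap (measurableSet_singleton _).compl fun x => F x,
      restrict_compl_singleton]

lemma integral_volumeIoiPow (n : ℕ) (F : ℝ → ℝ) :
    ∫ r : Ioi (0 : ℝ), F r ∂(Measure.volumeIoiPow n) = ∫ r in Ioi (0 : ℝ), r ^ n * F r := by
  simp only [Measure.volumeIoiPow, ENNReal.ofReal]
  rw [integral_withDensity_eq_integral_smul (measurable_subtype_coe.pow_const _).real_toNNReal,
    integral_subtype_comap measurableSet_Ioi fun a ↦ Real.toNNReal (a ^ n) • F a]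
  refine setIntegral_congr_fun measurableSet_Ioi fun x hx => ?_
  simp only [NNReal.smul_def, Real.coe_toNNReal _ (pow_nonneg hx.out.le _), smul_eq_mul]

/-- The mean over the shell `1 - ε < ‖y‖ < 1`, in polar coordinates. -/
lemma integral_shell [NeZero d] {ε : ℝ} (hε : 0 < ε) (hε1 : ε < 1) {g : Vec d → ℝ} (hg : Continuous g)
    (w : Vec d) :
    ∫ y, (Ioo (1 - ε) 1).indicator (fun r => ε⁻¹ * (r⁻¹ * inner ℝ y w)) ‖y‖ * g y =
      ∫ s : Metric.sphere (0 : Vec d) 1, (∫ τ in (0 : ℝ)..1,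
        (1 - ε * τ) ^ (d - 1) * (inner ℝ s.1 w * g ((1 - ε * τ) • s.1)))
        ∂(volume : Measure (Vec d)).toSphere := by
  let F : Vec d → ℝ := fun y =>
    (Ioo (1 - ε) 1).indicator (fun r => ε⁻¹ * (r⁻¹ * inner ℝ y w)) ‖y‖ * g y
  have hF : F = {y : Vec d | ‖y‖ ∈ Ioo (1 - ε) 1}.indicator
      fun y => ε⁻¹ * (‖y‖⁻¹ * inner ℝ y w) * g y := by
    ext y
    by_cases hy : ‖y‖ ∈ Ioo (1 - ε) 1
    · simp only [F]; rw [indicator_of_mem hy, indicator_of_mem (by exact hy)]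
    · simp only [F]; rw [indicator_of_notMem hy, indicator_of_notMem (by exact hy), zero_mul]
  have hmeas : Measurable F := by
    rw [hF]
    have := hg.measurable
    exact Measurable.indicator (by fun_prop) (measurable_norm measurableSet_Ioo)
  obtain ⟨M, hM⟩ := (isCompact_closedBall (0 : Vec d) 1).exists_bound_of_continuousOn hg.continuousOn
  have hint : Integrable F := by
    have hb : Integrable ((Metric.closedBall (0 : Vec d) 1).indicator
        fun _ => ε⁻¹ * ‖w‖ * M) := by
      refine (integrable_indicator_iff measurableSet_closedBall).2 (integrableOn_const ?_)
      exact measure_closedBall_lt_top.ne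
    refine hb.mono' hmeas.aestronglyMeasurable (Filter.Eventually.of_forall fun y => ?_)
    rw [hF]
    by_cases hy : ‖y‖ ∈ Ioo (1 - ε) 1
    · have hy1 : y ∈ Metric.closedBall (0 : Vec d) 1 := mem_closedBall_zero_iff.2 hy.2.le
      rw [indicator_of_mem (by exact hy), indicator_of_mem hy1, norm_mul, norm_mul, norm_mul,
        norm_inv, norm_inv, norm_norm, Real.norm_of_nonneg hε.le]
      have h0 : 0 < ‖y‖ := by linarith [hy.1]
      have h1 : ‖y‖⁻¹ * ‖inner ℝ y w‖ ≤ ‖w‖ := by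
        rw [inv_mul_le_iff₀ h0]
        exact norm_inner_le_norm y w
      have := hM y hy1
      gcongr
    · rw [indicator_of_notMem (by exact hy), norm_zero]
      have hM0 : 0 ≤ M := (norm_nonneg _).trans (hM 0 (by simp))
      exact indicator_nonneg (fun _ _ => by positivity) _
  obtain ⟨hp1, hp2⟩ := integral_eq_integral_toSphere_prod hint
  change ∫ y, F y = _
  rw [hp2, integral_prod _ hp1]
  congr 1
  ext s
  rw [integral_volumeIoiPow (d - 1) (fun r => F (r • s.1))]
  have hs : ‖s.1‖ = 1 := by simp
  have h1 : ∀ r ∈ Ioi (0 : ℝ), r ^ (d - 1) * F (r • s.1) = (Ioo (1 - ε) 1).indicator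
      (fun r => ε⁻¹ * (r ^ (d - 1) * (inner ℝ s.1 w * g (r • s.1)))) r := by
    intro r hr
    have hr0 : 0 < r := hr
    have hn : ‖r • s.1‖ = r := by rw [norm_smul, hs, mul_one, Real.norm_of_nonneg hr0.le]
    simp only [F]
    rw [hn]
    by_cases hr1 : r ∈ Ioo (1 - ε) 1
    · rw [indicator_of_mem hr1, indicator_of_mem hr1, real_inner_smul_left]
      field_simp
    · rw [indicator_of_notMem hr1, indicator_of_notMem hr1]; ring
  have hsub : Ioo (1 - ε) 1 ⊆ Ioi 0 := fun r hr => by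
    have := hr.1
    rw [mem_Ioi]; linarith
  rw [setIntegral_congr_fun measurableSet_Ioi h1, setIntegral_indicator measurableSet_Ioo,
    inter_eq_right.2 hsub, integral_const_mul,
    ← integral_Ioc_eq_integral_Ioo, ← intervalIntegral.integral_of_le (by linarith)]
  -- The substitution `r = 1 - ε τ` absorbs the factor `ε⁻¹` and fixes the interval, so that `ε → 0`
  -- becomes a question of continuity.
  have h2 := intervalIntegral.integral_comp_sub_mul
    (fun r : ℝ => r ^ (d - 1) * (inner ℝ s.1 w * g (r • s.1))) (a := 0) (b := 1) hε.ne' 1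
  rw [h2, mul_one, mul_zero, sub_zero, smul_eq_mul]

/-- The limit of the shell means. -/
lemma tendsto_integral_shell {g : Vec d → ℝ} (hg : Continuous g) (w : Vec d) :
    Filter.Tendsto (fun ε : ℝ => ∫ s : Metric.sphere (0 : Vec d) 1, (∫ τ in (0 : ℝ)..1,
        (1 - ε * τ) ^ (d - 1) * (inner ℝ s.1 w * g ((1 - ε * τ) • s.1)))
        ∂(volume : Measure (Vec d)).toSphere) (nhds 0)
      (nhds (∫ s : Metric.sphere (0 : Vec d) 1, inner ℝ s.1 w * g s.1
        ∂(volume : Measure (Vec d)).toSphere)) := by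
  have h1 : Continuous fun p : ℝ × Metric.sphere (0 : Vec d) 1 => ∫ τ in (0 : ℝ)..1,
      (1 - p.1 * τ) ^ (d - 1) * (inner ℝ p.2.1 w * g ((1 - p.1 * τ) • p.2.1)) := by
    refine intervalIntegral.continuous_parametric_intervalIntegral_of_continuous' ?_ 0 1
    unfold Function.uncurry
    fun_prop
  have h2 := continuous_parametric_integral_of_continuous
    (μ := (volume : Measure (Vec d)).toSphere)
    (f := fun (ε : ℝ) (s : Metric.sphere (0 : Vec d) 1) => ∫ τ in (0 : ℝ)..1,
      (1 - ε * τ) ^ (d - 1) * (inner ℝ s.1 w * g ((1 - ε * τ) • s.1))) h1 isCompact_univ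
  simp only [Measure.restrict_univ] at h2
  -- At `ε = 0` the integrand does not depend on `τ`, so the value is the integral over the sphere.
  have h3 := h2.tendsto 0
  simpa using h3

lemma tendsto_integral_radialCutoff :
    Filter.Tendsto (fun ε : ℝ => ∫ y : Vec d, radialCutoff ε y) (nhdsWithin 0 (Ioi 0))
      (nhds ((volume : Measure (Vec d)).real (Metric.ball 0 1))) := by
  have h : (volume : Measure (Vec d)).real (Metric.ball 0 1) =
      ∫ y : Vec d, (Metric.ball (0 : Vec d) 1).indicator (fun _ => (1 : ℝ)) y := by
    rw [integral_indicator measurableSet_ball]; simp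
  rw [h]
  refine tendsto_integral_filter_of_dominated_convergence
    ((Metric.ball (0 : Vec d) 1).indicator fun _ => (1 : ℝ)) ?_ ?_ ?_ ?_
  · filter_upwards [self_mem_nhdsWithin] with ε hε
    exact (lipschitzWith_radialCutoff hε).continuous.aestronglyMeasurable
  · filter_upwards [self_mem_nhdsWithin] with ε hε
    refine Filter.Eventually.of_forall fun y => ?_
    rw [Real.norm_of_nonneg (radialCutoff_nonneg _ _)]
    by_cases hy : y ∈ Metric.ball (0 : Vec d) 1
    · rw [indicator_of_mem hy]; exact radialCutoff_le_one _ _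
    · rw [indicator_of_notMem hy]
      rw [mem_ball_zero_iff, not_lt] at hy
      exact (radialCutoff_of_one_le hε hy).le
  · exact (integrable_indicator_iff measurableSet_ball).2
      (integrableOn_const measure_ball_lt_top.ne)
  · refine Filter.Eventually.of_forall fun y => ?_
    by_cases hy : y ∈ Metric.ball (0 : Vec d) 1
    · rw [indicator_of_mem hy]
      rw [mem_ball_zero_iff] at hy
      refine tendsto_const_nhds.congr' ?_
      filter_upwards [Ioo_mem_nhdsGT (show (0 : ℝ) < 1 - ‖y‖ by linarith)] with ε hε
      exact (radialCutoff_of_norm_le hε.1 (by linarith [hε.2])).symm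
    · rw [indicator_of_notMem hy]
      rw [mem_ball_zero_iff, not_lt] at hy
      refine tendsto_const_nhds.congr' ?_
      filter_upwards [self_mem_nhdsWithin] with ε hε
      exact (radialCutoff_of_one_le hε hy).symm

/-- Translating the cutoff decreases its correlation with a convex function at most by the
increase of the function. -/
lemma integral_lineDeriv_radialCutoff_mul_le {ε : ℝ} (hε : 0 < ε) {h : Vec d → ℝ}
    (hh : ConvexOn ℝ univ h) {u v : Vec d} {δ c : ℝ} (hδ : 0 < δ)
    (hc : ∀ y : Vec d, ‖y‖ ≤ 1 → h (u + δ • y) ≤ c) :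
    ∫ y, lineDeriv ℝ (radialCutoff ε) y (-(δ⁻¹ • (u - v))) * h (v + δ • y) ≤
      (c - h v) * ∫ y : Vec d, radialCutoff ε y := by
  set w := δ⁻¹ • (u - v) with hw
  have hhc : Continuous h := hh.locallyLipschitz.continuous
  set g : Vec d → ℝ := fun y => h (v + δ • y) with hg
  have hgc : Continuous g := by fun_prop
  have hφ := lipschitzWith_radialCutoff (d := d) hε
  have hφc := hφ.continuous
  have hφs := hasCompactSupport_radialCutoff (d := d) hε
  have hint : ∀ k : Vec d → ℝ, Continuous k → Integrable fun y => radialCutoff ε y * k y :=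
    fun k hk => (hφc.mul hk).integrable_of_hasCompactSupport hφs.mul_right
  have hφi : Integrable (radialCutoff ε : Vec d → ℝ) :=
    hφc.integrable_of_hasCompactSupport hφs
  -- The derivative of the cutoff is the limit of difference quotients tested against `g`. It
  -- suffices to bound these for small `t`, where a translation moves the difference onto the convex
  -- function.
  have hlim := LipschitzWith.integral_inv_smul_sub_mul_tendsto_integral_lineDeriv_mul' (μ := volume) hφ hφs hgc
    (-w)
  refine le_of_tendsto hlim ?_
  filter_upwards [Ioo_mem_nhdsGT (zero_lt_one' ℝ)] with t ht
  -- Since `δ w = u - v`, moving `y` by `t w` moves `v + δ y` the fraction `t` of the way to `u + δ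
  -- y`.
  have hconv : ∀ y, t⁻¹ * (g (y + t • w) - g y) ≤ h (u + δ • y) - g y := by
    intro y
    have h1 := hh.2 (mem_univ (v + δ • y)) (mem_univ (u + δ • y)) (by linarith [ht.2] : 0 ≤ 1 - t)
      ht.1.le (by ring)
    have h2 : v + δ • (y + t • w) = (1 - t) • (v + δ • y) + t • (u + δ • y) := by
      rw [hw, smul_add, smul_comm δ t, smul_inv_smul₀ hδ.ne']
      module
    rw [inv_mul_le_iff₀ ht.1, hg]
    simp only [h2, smul_eq_mul] at h1 ⊢
    linarith
  have hshift : ∫ y, radialCutoff ε (y + t • (-w)) * g y =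
      ∫ y, radialCutoff ε y * g (y + t • w) := by
    have := integral_sub_right_eq_self (μ := (volume : Measure (Vec d)))
      (fun y => radialCutoff ε y * g (y + t • w)) (t • w)
    rw [← this]
    congr 1
    ext y
    rw [sub_add_cancel, smul_neg, sub_eq_add_neg]
  have hshifti : Integrable fun y => radialCutoff ε (y + t • (-w)) * g y := by
    have := (hint (fun y => g (y + t • w)) (by fun_prop)).comp_sub_right (t • w)
    refine this.congr (Filter.Eventually.of_forall fun y => ?_)
    simp only [sub_add_cancel]
    rw [smul_neg, ← sub_eq_add_neg]
  -- The cutoff is even, and `h v` is at most the mean of `h` at the antipodal points `v ± δ y`.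
  have hsym : h v * ∫ y : Vec d, radialCutoff ε y ≤ ∫ y, radialCutoff ε y * g y := by
    have h1 : ∫ y, radialCutoff ε y * g (-y) = ∫ y, radialCutoff ε y * g y := by
      have := integral_neg_eq_self (μ := (volume : Measure (Vec d)))
        (fun y => radialCutoff ε y * g y)
      rw [← this]
      simp only [radialCutoff_neg]
    have h2 : ∫ y : Vec d, radialCutoff ε y * (h v) ≤
        ∫ y : Vec d, (1 / 2) * (radialCutoff ε y * g y + radialCutoff ε y * g (-y)) := by
      refine integral_mono (hφi.mul_const _)
        (((hint g hgc).add (hint (fun y => g (-y)) (by fun_prop))).const_mul _) fun y => ?_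
      have h3 := hh.2 (mem_univ (v + δ • y)) (mem_univ (v + δ • (-y)))
        (by norm_num : (0 : ℝ) ≤ 1 / 2) (by norm_num : (0 : ℝ) ≤ 1 / 2) (by norm_num)
      have h4 : (1 / 2 : ℝ) • (v + δ • y) + (1 / 2 : ℝ) • (v + δ • (-y)) = v := by module
      rw [h4, smul_eq_mul, smul_eq_mul] at h3
      have := mul_le_mul_of_nonneg_left h3 (radialCutoff_nonneg ε y)
      simp only [hg]
      linarith
    rw [integral_const_mul, integral_add (hint g hgc) (hint (fun y => g (-y)) (by fun_prop)), h1,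
      integral_mul_const] at h2
    linarith
  calc ∫ y, (t⁻¹ • (radialCutoff ε (y + t • (-w)) - radialCutoff ε y)) * g y
      = t⁻¹ * ((∫ y, radialCutoff ε (y + t • (-w)) * g y) - ∫ y, radialCutoff ε y * g y) := by
        rw [← integral_sub hshifti (hint g hgc), ← integral_const_mul]
        congr 1
        ext y
        rw [smul_eq_mul]; ring
    _ = ∫ y, radialCutoff ε y * (t⁻¹ * (g (y + t • w) - g y)) := by
        rw [hshift, ← integral_sub (hint (fun y => g (y + t • w)) (by fun_prop)) (hint g hgc),
          ← integral_const_mul]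
        congr 1
        ext y
        ring
    _ ≤ ∫ y, radialCutoff ε y * (c - g y) := by
        refine integral_mono (hint _ (by fun_prop)) (hint _ (by fun_prop)) fun y => ?_
        by_cases hy : ‖y‖ ≤ 1
        · exact mul_le_mul_of_nonneg_left ((hconv y).trans (sub_le_sub_right (hc y hy) _))
            (radialCutoff_nonneg _ _)
        · simp [radialCutoff_of_one_le hε (not_le.1 hy).le]
    _ = c * (∫ y : Vec d, radialCutoff ε y) - ∫ y, radialCutoff ε y * g y := by
        rw [← integral_const_mul, ← integral_sub (hφi.const_mul _) (hint g hgc)]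
        congr 1
        ext y
        ring
    _ ≤ _ := by linarith

/-- A weak form of the divergence theorem: as `ε → 0` the integral of the cutoff tends to the volume
of the ball, while its derivative, supported on a shell of width `ε`, turns into integration over
the sphere. -/
lemma integral_toSphere_mul_le [NeZero d] {h : Vec d → ℝ} (hh : ConvexOn ℝ univ h)
    {u v : Vec d} {δ c : ℝ} (hδ : 0 < δ) (hc : ∀ y : Vec d, ‖y‖ ≤ 1 → h (u + δ • y) ≤ c) :
    ∫ s : Metric.sphere (0 : Vec d) 1, inner ℝ s.1 (δ⁻¹ • (u - v)) * h (v + δ • s.1)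
      ∂(volume : Measure (Vec d)).toSphere ≤
      (c - h v) * (volume : Measure (Vec d)).real (Metric.ball 0 1) := by
  have hhc : Continuous h := hh.locallyLipschitz.continuous
  have h1 := (tendsto_integral_shell (g := fun y => h (v + δ • y)) (by fun_prop)
    (δ⁻¹ • (u - v))).mono_left (nhdsWithin_le_nhds (s := Ioi 0))
  have h2 := (tendsto_integral_radialCutoff (d := d)).const_mul (c - h v)
  refine le_of_tendsto_of_tendsto h1 h2 ?_
  filter_upwards [Ioo_mem_nhdsGT (zero_lt_one' ℝ)] with ε hε
  rw [← integral_shell (g := fun y => h (v + δ • y)) hε.1 hε.2 (by fun_prop)]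
  refine le_trans (le_of_eq (integral_congr_ae ?_))
    (integral_lineDeriv_radialCutoff_mul_le hε.1 hh hδ hc)
  -- The kinks of the cutoff lie on two spheres of measure zero.
  have e1 : ∀ᵐ y : Vec d, y ∉ Metric.sphere (0 : Vec d) 1 :=
    measure_eq_zero_iff_ae_notMem.1 (Measure.addHaar_sphere_of_ne_zero _ _ one_ne_zero)
  have e2 : ∀ᵐ y : Vec d, y ∉ Metric.sphere (0 : Vec d) (1 - ε) :=
    measure_eq_zero_iff_ae_notMem.1
      (Measure.addHaar_sphere_of_ne_zero _ _ (sub_pos.2 hε.2).ne')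
  filter_upwards [e1, e2] with y hy1 hy2
  rw [mem_sphere_zero_iff_norm] at hy1 hy2
  rw [lineDeriv_radialCutoff hε.1 hε.2 hy1 hy2]

lemma toSphere_univ_ne_zero [NeZero d] : (volume : Measure (Vec d)).toSphere univ ≠ 0 := by
  have : Nonempty (Fin d) := ⟨⟨0, Nat.pos_of_neZero d⟩⟩
  rw [Ne, Measure.measure_univ_eq_zero]
  exact Measure.toSphere_ne_zero _

instance [NeZero d] : IsProbabilityMeasure (uniformSphere d) := by
  have : IsProbabilityMeasure (((volume : Measure (Vec d)).toSphere univ)⁻¹ •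
      (volume : Measure (Vec d)).toSphere) :=
    ⟨by
      rw [Measure.smul_apply, smul_eq_mul]
      exact ENNReal.inv_mul_cancel toSphere_univ_ne_zero (measure_ne_top _ _)⟩
  exact Measure.isProbabilityMeasure_map measurable_subtype_coe.aemeasurable

lemma ae_norm_eq_one_uniformSphere : ∀ᵐ s ∂uniformSphere d, ‖s‖ = 1 := by
  rw [uniformSphere, ae_map_iff measurable_subtype_coe.aemeasurable
    (measurableSet_eq_fun measurable_norm measurable_const)]
  exact Filter.Eventually.of_forall fun s => by simp

/-- The one-point gradient estimate: for a convex function `h`, the vector `(d / δ) h(v + δ s) s`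
with `s` uniform on the sphere is in the mean almost a subgradient of `h` at `v`. -/
theorem integral_uniformSphere_mul_inner_le [NeZero d] {h : Vec d → ℝ} (hh : ConvexOn ℝ univ h)
    {u v : Vec d} {δ c : ℝ} (hδ : 0 < δ) (hc : ∀ y : Vec d, ‖y‖ ≤ 1 → h (u + δ • y) ≤ c) :
    d / δ * ∫ s, h (v + δ • s) * inner ℝ s (u - v) ∂uniformSphere d ≤ c - h v := by
  have h1 := integral_toSphere_mul_le (v := v) hh hδ hc
  have hhc : Continuous h := hh.locallyLipschitz.continuous
  -- The factor `d` of the estimate: the area of the sphere is `d` times the volume of the ball.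
  have hb : (volume : Measure (Vec d)).toSphere.real univ =
      d * (volume : Measure (Vec d)).real (Metric.ball 0 1) := by
    rw [Measure.toSphere_real_apply_univ, finrank_euclideanSpace_fin]
  have hpos : 0 < (volume : Measure (Vec d)).toSphere.real univ :=
    ENNReal.toReal_pos toSphere_univ_ne_zero (measure_ne_top _ _)
  have h2 : ∫ s, h (v + δ • s) * inner ℝ s (u - v) ∂uniformSphere d =
      ((volume : Measure (Vec d)).toSphere.real univ)⁻¹ *
      ∫ s : Metric.sphere (0 : Vec d) 1, h (v + δ • s.1) * inner ℝ s.1 (u - v)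
        ∂(volume : Measure (Vec d)).toSphere := by
    rw [uniformSphere, integral_map measurable_subtype_coe.aemeasurable
      (by fun_prop : Continuous _).aestronglyMeasurable, integral_smul_measure, smul_eq_mul,
      ENNReal.toReal_inv, Measure.real]
  have h3 : ∫ s : Metric.sphere (0 : Vec d) 1, inner ℝ s.1 (δ⁻¹ • (u - v)) * h (v + δ • s.1)
      ∂(volume : Measure (Vec d)).toSphere = δ⁻¹ *
      ∫ s : Metric.sphere (0 : Vec d) 1, h (v + δ • s.1) * inner ℝ s.1 (u - v)
        ∂(volume : Measure (Vec d)).toSphere := by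
    rw [← integral_const_mul]
    congr 1
    ext s
    rw [real_inner_smul_right]; ring
  have hd : (0 : ℝ) < d := Nat.cast_pos.2 (Nat.pos_of_neZero d)
  rw [h3] at h1
  rw [h2, hb]
  rw [hb] at hpos
  have hball : 0 < (volume : Measure (Vec d)).real (Metric.ball 0 1) := pos_of_mul_pos_right hpos hd.le
  generalize (∫ s : Metric.sphere (0 : Vec d) 1, h (v + δ • s.1) * inner ℝ s.1 (u - v)
    ∂(volume : Measure (Vec d)).toSphere) = I at *
  generalize (volume : Measure (Vec d)).real (Metric.ball 0 1) = b at *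
  have : d / δ * ((d * b)⁻¹ * I) = (δ⁻¹ * I) / b := by field_simp
  rw [this, div_le_iff₀ hball]
  exact h1

end Sphere

/-! ### The course of play -/

section Play

variable {d : ℕ} (G : GDwoG d) (D : ℕ) (ℓ : Vec d → Vec d → ℝ → ℝ)
  (a : ℕ → AgentType d)

/-- The iterate of the copy that is active in round `t`. -/
def iterateAt (B : (t : ℕ) → (Fin t → Vec d × Vec d) → Vec d → Vec d) (s : ℕ → Vec d)
    (t : ℕ) : Vec d :=
  (playState G D ℓ a B s t).1 (t % D)

/-- The loss observed in round `t`. -/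
def lossAt (B : (t : ℕ) → (Fin t → Vec d × Vec d) → Vec d → Vec d) (s : ℕ → Vec d)
    (t : ℕ) : ℝ :=
  ℓ (classifierAt G D ℓ a B s t) (responseAt G D ℓ a B s t) (a t).y

variable {G D ℓ a}
variable {B B' : (t : ℕ) → (Fin t → Vec d × Vec d) → Vec d → Vec d} {s s' : ℕ → Vec d}

lemma classifierAt_eq (t : ℕ) :
    classifierAt G D ℓ a B s t = iterateAt G D ℓ a B s t + G.δ • s t := rfl

lemma playState_succ_fst (t : ℕ) :
    (playState G D ℓ a B s (t + 1)).1 = Function.update (playState G D ℓ a B s t).1 (t % D)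
      (G.update (iterateAt G D ℓ a B s t) (s t) (lossAt G D ℓ a B s t)) := rfl

lemma playState_succ_snd (t : ℕ) :
    (playState G D ℓ a B s (t + 1)).2 = Fin.snoc (playState G D ℓ a B s t).2
      (classifierAt G D ℓ a B s t, responseAt G D ℓ a B s t) := rfl

/-- The state before round `t` depends only on the strategy and the directions before `t`. -/
lemma playState_congr {t : ℕ} (hB : ∀ i < t, B i = B' i) (hs : ∀ i < t, s i = s' i) :
    playState G D ℓ a B s t = playState G D ℓ a B' s' t := by
  induction t with
  | zero => rfl
  | succ t ih =>
    have h := ih (fun i hi => hB i (by omega)) (fun i hi => hs i (by omega))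
    simp only [playState, h, hB t (by omega), hs t (by omega)]

lemma iterateAt_congr {t : ℕ} (hB : ∀ i < t, B i = B' i) (hs : ∀ i < t, s i = s' i) :
    iterateAt G D ℓ a B s t = iterateAt G D ℓ a B' s' t := by
  rw [iterateAt, iterateAt, playState_congr hB hs]

lemma responseAt_congr {t : ℕ} (hB : ∀ i ≤ t, B i = B' i) :
    responseAt G D ℓ a B s t = responseAt G D ℓ a B' s t := by
  have h := playState_congr (G := G) (D := D) (ℓ := ℓ) (a := a) (s := s) (s' := s) (t := t)
    (fun i hi => hB i hi.le) (fun _ _ => rfl)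
  simp only [responseAt, classifierAt, h, hB t le_rfl]

/-- A copy keeps its iterate while it is not active. -/
lemma playState_fst_of_lt_add {t k m : ℕ} (htk : t ≤ k) (hkm : k ≤ m) (hm : m < t + D) :
    (playState G D ℓ a B s k).1 (m % D) = (playState G D ℓ a B s t).1 (m % D) := by
  induction k, htk using Nat.le_induction with
  | base => rfl
  | succ k htk ih =>
    rw [playState_succ_fst, Function.update_of_ne, ih (by omega)]
    intro h
    -- Were the copy of round `m` active in round `k`, then `D` would divide `m - k`, which lies
    -- strictly between `0` and `D`.
    have h1 : (m - k) % D = 0 := Nat.sub_mod_eq_zero_of_mod_eq h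
    rw [Nat.mod_eq_of_lt (by omega)] at h1
    omega

/-- The feedback from round `t` is not used before round `t + D`. -/
lemma classifierAt_congr_of_lt_add {t m : ℕ} (hB : ∀ i < t, B i = B' i) (hm : m < t + D) :
    classifierAt G D ℓ a B s m = classifierAt G D ℓ a B' s m := by
  rw [classifierAt_eq, classifierAt_eq]
  rcases le_total m t with h | h
  · rw [iterateAt_congr (s' := s) (fun i hi => hB i (by omega)) (fun _ _ => rfl)]
  · rw [iterateAt, iterateAt, playState_fst_of_lt_add h le_rfl hm,
      playState_fst_of_lt_add h le_rfl hm, playState_congr (s' := s) hB (fun _ _ => rfl)]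

variable {R : ℝ}

lemma playState_fst_mem (hS : IsClassifierDomain G.S R) (t r : ℕ) :
    (playState G D ℓ a B s t).1 r ∈ (fun z => (1 - G.δ) • z) '' G.S := by
  induction t with
  | zero => exact hS.zero_mem_shrink
  | succ t ih =>
    rw [playState_succ_fst, Function.update_apply]
    split_ifs
    · exact G.update_mem hS _ _ _
    · exact ih

lemma iterateAt_mem (hS : IsClassifierDomain G.S R) (t : ℕ) :
    iterateAt G D ℓ a B s t ∈ (fun z => (1 - G.δ) • z) '' G.S := playState_fst_mem hS _ _

lemma classifierAt_mem (hS : IsClassifierDomain G.S R) (h0 : 0 ≤ G.δ) (h1 : G.δ ≤ 1) {t : ℕ}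
    (hs : ‖s t‖ ≤ 1) : classifierAt G D ℓ a B s t ∈ G.S :=
  hS.add_smul_mem h0 h1 (iterateAt_mem hS t) hs

/-- The regret of all copies together, against the estimated gradients. -/
lemma sum_lossAt_mul_inner_le (hS : IsClassifierDomain G.S R) (hD : 0 < D) {T : ℕ}
    (hs : ∀ t < T, ‖s t‖ ≤ 1) {u : Vec d} (hu : u ∈ (fun z => (1 - G.δ) • z) '' G.S) :
    2 * G.η * ∑ t ∈ Finset.range T,
        lossAt G D ℓ a B s t * inner ℝ (s t) (iterateAt G D ℓ a B s t - u) ≤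
      D * ‖u‖ ^ 2 + G.η ^ 2 * ∑ t ∈ Finset.range T, lossAt G D ℓ a B s t ^ 2 := by
  -- Each round changes only the summand of the active copy, so one telescoping sum handles all
  -- copies; at the start each of the `D` summands is `‖u‖²`.
  let pot : ℕ → ℝ := fun t => ∑ r ∈ Finset.range D, ‖(playState G D ℓ a B s t).1 r - u‖ ^ 2
  have hstep : ∀ t < T, 2 * G.η *
      (lossAt G D ℓ a B s t * inner ℝ (s t) (iterateAt G D ℓ a B s t - u)) ≤
      pot t - pot (t + 1) + G.η ^ 2 * lossAt G D ℓ a B s t ^ 2 := by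
    intro t ht
    have hmem : t % D ∈ Finset.range D := Finset.mem_range.2 (Nat.mod_lt _ hD)
    have h1 := G.norm_update_sub_sq_le hS (iterateAt G D ℓ a B s t) (s t)
      (lossAt G D ℓ a B s t) (hs t ht) hu
    have h2 : pot t - pot (t + 1) = ‖iterateAt G D ℓ a B s t - u‖ ^ 2 -
        ‖G.update (iterateAt G D ℓ a B s t) (s t) (lossAt G D ℓ a B s t) - u‖ ^ 2 := by
      simp only [pot]
      rw [← Finset.sum_sub_distrib, Finset.sum_eq_single_of_mem _ hmem]
      · rw [playState_succ_fst, Function.update_self]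
        rfl
      · intro r _ hr
        rw [playState_succ_fst, Function.update_of_ne hr, sub_self]
    linarith
  have hpot0 : pot 0 = D * ‖u‖ ^ 2 := by
    simp [pot, playState]
  have hpotT : 0 ≤ pot T := Finset.sum_nonneg fun _ _ => by positivity
  have hsum := Finset.sum_le_sum fun t ht => hstep t (Finset.mem_range.1 ht)
  rw [← Finset.mul_sum, Finset.sum_add_distrib, Finset.sum_range_sub', ← Finset.mul_sum] at hsum
  linarith

end Play

/-! ### Measurability of the play -/

section PlayMeasurable

variable {d : ℕ} {G : GDwoG d} {D : ℕ} {ℓ : Vec d → Vec d → ℝ → ℝ} {R : ℝ}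
  {X : Type*} [MeasurableSpace X] {a : X → ℕ → AgentType d}
  {B : X → (t : ℕ) → (Fin t → Vec d × Vec d) → Vec d → Vec d} {s : X → ℕ → Vec d} {T : ℕ}

/-- Measurability of all data of the play before round `T`. -/
structure IsMeasurablePlay (ℓ : Vec d → Vec d → ℝ → ℝ) (a : X → ℕ → AgentType d)
    (B : X → (t : ℕ) → (Fin t → Vec d × Vec d) → Vec d → Vec d) (s : X → ℕ → Vec d) (T : ℕ) :
    Prop where
  loss : Measurable fun p : Vec d × Vec d × ℝ => ℓ p.1 p.2.1 p.2.2
  label : ∀ t < T, Measurable fun p => (a p t).y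
  strategy : ∀ t < T, Measurable fun q : X × ((Fin t → Vec d × Vec d) × Vec d) =>
    B q.1 t q.2.1 q.2.2
  direction : ∀ t < T, Measurable fun p => s p t

lemma IsMeasurablePlay.aux (h : IsMeasurablePlay ℓ a B s T) {t : ℕ} (ht : t < T)
    (h1 : Measurable fun p => iterateAt G D ℓ (a p) (B p) (s p) t)
    (h2 : Measurable fun p => (playState G D ℓ (a p) (B p) (s p) t).2) :
    Measurable (fun p => classifierAt G D ℓ (a p) (B p) (s p) t) ∧
    Measurable (fun p => responseAt G D ℓ (a p) (B p) (s p) t) ∧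
    Measurable (fun p => lossAt G D ℓ (a p) (B p) (s p) t) := by
  have hc : Measurable fun p => classifierAt G D ℓ (a p) (B p) (s p) t := by
    simp only [classifierAt_eq]
    have := h.direction t ht
    fun_prop
  have hr : Measurable fun p => responseAt G D ℓ (a p) (B p) (s p) t := by
    unfold responseAt
    exact (h.strategy t ht).comp (measurable_id.prodMk (h2.prodMk hc))
  refine ⟨hc, hr, ?_⟩
  unfold lossAt
  exact h.loss.comp (hc.prodMk (hr.prodMk (h.label t ht)))

lemma IsMeasurablePlay.playState (h : IsMeasurablePlay ℓ a B s T)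
    (hS : IsClassifierDomain G.S R) {t : ℕ} (ht : t ≤ T) :
    (∀ r, Measurable fun p => (playState G D ℓ (a p) (B p) (s p) t).1 r) ∧
    Measurable fun p => (playState G D ℓ (a p) (B p) (s p) t).2 := by
  induction t with
  | zero => exact ⟨fun r => measurable_const, measurable_const⟩
  | succ t ih =>
    obtain ⟨h1, h2⟩ := ih (by omega)
    obtain ⟨hc, hr, hl⟩ := h.aux (G := G) (D := D) (show t < T by omega) (h1 _) h2
    constructor
    · intro r
      have hu : Measurable fun p => G.update (_root_.iterateAt G D ℓ (a p) (B p) (s p) t) (s p t)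
          (_root_.lossAt G D ℓ (a p) (B p) (s p) t) :=
        (G.measurable_update hS).comp (f := fun p => (_root_.iterateAt G D ℓ (a p) (B p) (s p) t,
          s p t, _root_.lossAt G D ℓ (a p) (B p) (s p) t))
          ((h1 (t % D)).prodMk ((h.direction t (by omega)).prodMk hl))
      simp only [playState_succ_fst, Function.update_apply]
      split_ifs
      · exact hu
      · exact h1 r
    · simp only [playState_succ_snd]
      refine measurable_pi_lambda _ fun i => ?_
      refine Fin.lastCases ?_ (fun j => ?_) i
      · simpa only [Fin.snoc_last] using hc.prodMk hr
      · simp only [Fin.snoc_castSucc]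
        exact (measurable_pi_apply j).comp h2

lemma IsMeasurablePlay.iterateAt (h : IsMeasurablePlay ℓ a B s T)
    (hS : IsClassifierDomain G.S R) {t : ℕ} (ht : t < T) :
    Measurable fun p => iterateAt G D ℓ (a p) (B p) (s p) t :=
  (h.playState hS ht.le).1 _

lemma IsMeasurablePlay.classifierAt (h : IsMeasurablePlay ℓ a B s T)
    (hS : IsClassifierDomain G.S R) {t : ℕ} (ht : t < T) :
    Measurable fun p => classifierAt G D ℓ (a p) (B p) (s p) t :=
  (h.aux ht (h.iterateAt hS ht) (h.playState hS ht.le).2).1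

lemma IsMeasurablePlay.responseAt (h : IsMeasurablePlay ℓ a B s T)
    (hS : IsClassifierDomain G.S R) {t : ℕ} (ht : t < T) :
    Measurable fun p => responseAt G D ℓ (a p) (B p) (s p) t :=
  (h.aux ht (h.iterateAt hS ht) (h.playState hS ht.le).2).2.1

lemma IsMeasurablePlay.lossAt (h : IsMeasurablePlay ℓ a B s T)
    (hS : IsClassifierDomain G.S R) {t : ℕ} (ht : t < T) :
    Measurable fun p => lossAt G D ℓ (a p) (B p) (s p) t :=
  (h.aux ht (h.iterateAt hS ht) (h.playState hS ht.le).2).2.2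

end PlayMeasurable

/-! ### Expectations of extended-real random variables -/

lemma erealExpectation_congr_coe {Ω : Type*} [MeasurableSpace Ω] {μ : Measure Ω} {X : Ω → EReal}
    {Y : Ω → ℝ} (hY : Integrable Y μ) (h : ∀ᵐ ω ∂μ, X ω = Y ω) :
    erealExpectation μ X = ((∫ ω, Y ω ∂μ : ℝ) : EReal) := by
  have h1 : ∫⁻ ω, (X ω).toENNReal ∂μ = ∫⁻ ω, ENNReal.ofReal (Y ω) ∂μ :=
    lintegral_congr_ae (h.mono fun ω hω => by simp only [hω, EReal.toENNReal_of_ne_top,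
      EReal.coe_ne_top, ne_eq, not_false_iff, EReal.toReal_coe])
  have h2 : ∫⁻ ω, (-X ω).toENNReal ∂μ = ∫⁻ ω, ENNReal.ofReal (-Y ω) ∂μ :=
    lintegral_congr_ae (h.mono fun ω hω => by
      simp only [hω, ← EReal.coe_neg, EReal.toENNReal_of_ne_top,
        EReal.coe_ne_top, ne_eq, not_false_iff, EReal.toReal_coe])
  have f1 : ∫⁻ ω, ENNReal.ofReal (Y ω) ∂μ ≠ ⊤ := hY.lintegral_lt_top.ne
  have f2 : ∫⁻ ω, ENNReal.ofReal (-Y ω) ∂μ ≠ ⊤ := hY.neg.lintegral_lt_top.ne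
  rw [erealExpectation, h1, h2, integral_eq_lintegral_pos_part_sub_lintegral_neg_part hY,
    EReal.coe_sub, EReal.coe_ennreal_toReal f1, EReal.coe_ennreal_toReal f2]

/-- The upper bound makes the positive part integrable, so an infinite integral of the negative part
would force the expectation to be `⊥`. -/
lemma integrable_toReal_of_erealExpectation_ne_bot {Ω : Type*} [MeasurableSpace Ω] {μ : Measure Ω}
    [IsFiniteMeasure μ] {X : Ω → EReal} (hX : Measurable X) {M : ℝ} (hM : ∀ᵐ ω ∂μ, X ω ≤ M)
    (h : erealExpectation μ X ≠ ⊥) :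
    (∀ᵐ ω ∂μ, X ω ≠ ⊥) ∧ Integrable (fun ω => (X ω).toReal) μ := by
  have hpos : ∫⁻ ω, (X ω).toENNReal ∂μ ≠ ⊤ := by
    refine (lt_of_le_of_lt (lintegral_mono_ae (hM.mono fun ω hω => EReal.toENNReal_le_toENNReal hω))
      ?_).ne
    rw [lintegral_const]
    exact ENNReal.mul_lt_top (by simp [EReal.toENNReal_of_ne_top]) (measure_lt_top _ _)
  have hneg : ∫⁻ ω, (-X ω).toENNReal ∂μ ≠ ⊤ := by
    intro htop
    apply h
    rw [erealExpectation, htop, EReal.coe_ennreal_top, sub_eq_add_neg, EReal.neg_top,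
      EReal.add_bot]
  have hm1 : Measurable fun ω => (X ω).toENNReal := hX.ereal_toENNReal
  have hm2 : Measurable fun ω => (-X ω).toENNReal := hX.neg.ereal_toENNReal
  have hbot : ∀ᵐ ω ∂μ, X ω ≠ ⊥ := by
    filter_upwards [ae_lt_top hm2 hneg] with ω hω hb
    simp [hb] at hω
  refine ⟨hbot, hX.ereal_toReal.aestronglyMeasurable, ?_⟩
  rw [hasFiniteIntegral_iff_norm]
  have hle : ∀ᵐ ω ∂μ, ENNReal.ofReal ‖(X ω).toReal‖ ≤ (X ω).toENNReal + (-X ω).toENNReal := by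
    filter_upwards [hbot, hM] with ω hb ht
    have htop : X ω ≠ ⊤ := ne_top_of_le_ne_top (EReal.coe_ne_top M) ht
    lift X ω to ℝ using ⟨htop, hb⟩ with x
    rw [← EReal.coe_neg, EReal.toENNReal_of_ne_top (EReal.coe_ne_top _),
      EReal.toENNReal_of_ne_top (EReal.coe_ne_top _), EReal.toReal_coe, EReal.toReal_coe,
      Real.norm_eq_abs]
    rcases le_total 0 x with hx | hx
    · rw [abs_of_nonneg hx]; exact le_self_add
    · rw [abs_of_nonpos hx]; exact le_add_self
  refine (lintegral_mono_ae hle).trans_lt ?_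
  rw [lintegral_add_left hm1]
  exact ENNReal.add_lt_top.2 ⟨hpos.lt_top, hneg.lt_top⟩

/-- In `EReal` one summand `⊥` absorbs all the others. So a policy of finite utility almost surely
never incurs the penalty. -/
lemma sum_coe_mul_ne_bot {T : ℕ} {c : ℕ → ℝ} (hc : ∀ t, 0 < c t) {x : ℕ → EReal}
    (h : ∑ t ∈ Finset.range T, (c t : EReal) * x t ≠ ⊥) {t : ℕ} (ht : t < T) : x t ≠ ⊥ := by
  intro hx
  apply h
  rw [← Finset.add_sum_erase _ _ (Finset.mem_range.2 ht), hx, EReal.coe_mul_bot_of_pos (hc t),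
    EReal.bot_add]

lemma sum_coe_mul_coe {T : ℕ} (c y : ℕ → ℝ) :
    ∑ t ∈ Finset.range T, (c t : EReal) * (y t : EReal) =
      ((∑ t ∈ Finset.range T, c t * y t : ℝ) : EReal) := by
  induction T with
  | zero => simp
  | succ T ih => rw [Finset.sum_range_succ, Finset.sum_range_succ, ih]; push_cast; rfl

/-! ### The game: measurability and the incentives of the agent -/

lemma GDwoG.tuned_delta_nonneg {d : ℕ} (S : Set (Vec d)) (R C L : ℝ) (n : ℕ) :
    0 ≤ (GDwoG.tuned S R C L n).δ :=
  le_min zero_le_one (mul_nonneg (Real.sqrt_nonneg _) (Real.rpow_nonneg (Nat.cast_nonneg _) _))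

lemma GDwoG.tuned_delta_le_one {d : ℕ} (S : Set (Vec d)) (R C L : ℝ) (n : ℕ) :
    (GDwoG.tuned S R C L n).δ ≤ 1 := min_le_left _ _

lemma numCopies_pos (d T : ℕ) (R α γ : ℝ) : 0 < numCopies d T R α γ :=
  lt_of_lt_of_le one_pos (le_max_left _ _)

lemma AgentType.measurable_response_snd {H Ω : Type*} [MeasurableSpace Ω] [MeasurableSpace H]
    {d : ℕ} {R α : ℝ} (hα : 0 < α)
    {a : Ω → AgentType d} (ha : ∀ ω, (a ω).Regular R α) (hx : Measurable fun ω => (a ω).x)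
    (hy : Measurable fun ω => (a ω).y)
    (hc : ∀ x' x, Measurable fun ω => (a ω).cost x' x) :
    Measurable fun p : Ω × (H × Vec d) => (a p.1).response p.2.2 :=
  (measurable_response hα ha hx hy hc).comp (f := fun p : Ω × (H × Vec d) => (p.1, p.2.2))
    (by fun_prop)

namespace ClassificationGame

variable {d T : ℕ} {Ω : Type*} [MeasurableSpace Ω] {G : ClassificationGame d T Ω}

/-- The largest possible stage payoff, as a bound. -/
def payoffBound (G : ClassificationGame d T Ω) : ℝ := G.R ^ 2 + G.R ^ 2 / (2 * G.α)

/-- The distance of the response in round `t` from the best response. -/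
def responseError (G : ClassificationGame d T Ω) (B : AgentPolicy d G.𝓕) (t : ℕ)
    (p : Ω × (Fin T → Vec d)) : ℝ :=
  ‖G.response B t p - (G.types t p.1).response (G.classifier B t p)‖

lemma Regular.isClassifierDomain (hG : G.Regular) : IsClassifierDomain G.Θ G.R :=
  ⟨hG.convex, hG.closed, hG.ball_subset, hG.subset_ball⟩

open Classical in
/-- The policy that follows `B` before round `t` and responds myopically from round `t` on. -/
def myopicFrom (hG : G.Regular) (B : AgentPolicy d G.𝓕) (t : ℕ) : AgentPolicy d G.𝓕 where
  act i := if i < t then B.act i else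
    -- Nothing is assumed about types beyond the horizon, so a constant is used there to keep the
    -- policy measurable.
    if i < T then fun ω _ θ => (G.types i ω).response θ else fun _ _ _ => 0
  measurable_act i := by
    split_ifs with h1 h2
    · exact B.measurable_act i
    · exact @AgentType.measurable_response_snd _ Ω (G.𝓕 i) _ d G.R G.α hG.alpha_pos (G.types i)
        (hG.types_regular i h2) (hG.measurable_x i h2) (hG.measurable_y i h2)
        (hG.measurable_cost i h2)
    · exact measurable_const

lemma myopicFrom_act_of_lt (hG : G.Regular) (B : AgentPolicy d G.𝓕) {t i : ℕ} (h : i < t) :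
    (myopicFrom hG B t).act i = B.act i := by simp [myopicFrom, h]

lemma response_myopicFrom (hG : G.Regular) (B : AgentPolicy d G.𝓕) {t i : ℕ} (h : t ≤ i)
    (hi : i < T) (p : Ω × (Fin T → Vec d)) :
    G.response (myopicFrom hG B t) i p =
      (G.types i p.1).response (G.classifier (myopicFrom hG B t) i p) := by
  unfold response responseAt classifier
  simp only [myopicFrom, not_lt.2 h, hi, if_true, if_false]

lemma response_myopicFrom_of_lt (hG : G.Regular) (B : AgentPolicy d G.𝓕) {t i : ℕ} (h : i < t)
    (p : Ω × (Fin T → Vec d)) : G.response (myopicFrom hG B t) i p = G.response B i p :=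
  responseAt_congr fun j hj => by rw [myopicFrom_act_of_lt hG B (by omega)]

/-- This is what the parallel copies are for: a deviation that starts in round `t` leaves the next
`D` classifiers, including that of round `t`, unchanged. -/
lemma classifier_myopicFrom (hG : G.Regular) (B : AgentPolicy d G.𝓕) {t i : ℕ}
    (h : i < t + numCopies d T G.R G.α G.γ) (p : Ω × (Fin T → Vec d)) :
    G.classifier (myopicFrom hG B t) i p = G.classifier B i p :=
  classifierAt_congr_of_lt_add (fun j hj => by rw [myopicFrom_act_of_lt hG B hj]) h

lemma measurable_loss (hG : G.Regular) :
    Measurable fun p : Vec d × Vec d × ℝ => G.ℓ p.1 p.2.1 p.2.2 := by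
  obtain ⟨g, hg, h⟩ := exists_isMarginLoss hG.loss
  rw [h]
  have := hg.continuous.measurable
  fun_prop

lemma measurable_directions (t : ℕ) :
    Measurable fun p : Ω × (Fin T → Vec d) => directions p.2 t := by
  unfold directions
  split_ifs with h
  · exact (measurable_pi_apply _).comp measurable_snd
  · exact measurable_const

lemma isMeasurablePlay (hG : G.Regular) (B : AgentPolicy d G.𝓕) :
    IsMeasurablePlay G.ℓ (fun (p : Ω × (Fin T → Vec d)) t => G.types t p.1)
      (fun p t => B.act t p.1) (fun p => directions p.2) T where
  loss := measurable_loss hG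
  label t ht := ((hG.measurable_y t ht).mono (G.𝓕.le t) le_rfl).comp measurable_fst
  strategy t ht := by
    have h : Measurable fun q : Ω × ((Fin t → Vec d × Vec d) × Vec d) =>
        B.act t q.1 q.2.1 q.2.2 :=
      (B.measurable_act t).mono (sup_le_sup (MeasurableSpace.comap_mono (G.𝓕.le t)) le_rfl) le_rfl
    exact h.comp (f := fun q : (Ω × (Fin T → Vec d)) × ((Fin t → Vec d × Vec d) × Vec d) =>
      (q.1.1, q.2)) (by fun_prop)
  direction t _ := measurable_directions t

lemma measurable_classifier (hG : G.Regular) (B : AgentPolicy d G.𝓕) {t : ℕ} (ht : t < T) :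
    Measurable (G.classifier B t) :=
  (isMeasurablePlay hG B).classifierAt (R := G.R) hG.isClassifierDomain ht

lemma measurable_response (hG : G.Regular) (B : AgentPolicy d G.𝓕) {t : ℕ} (ht : t < T) :
    Measurable (G.response B t) :=
  (isMeasurablePlay hG B).responseAt (R := G.R) hG.isClassifierDomain ht

lemma measurable_bestResponse (hG : G.Regular) {t : ℕ} (ht : t < T) :
    Measurable fun q : Ω × Vec d => (G.types t q.1).response q.2 :=
  AgentType.measurable_response hG.alpha_pos (hG.types_regular t ht)
    ((hG.measurable_x t ht).mono (G.𝓕.le t) le_rfl)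
    ((hG.measurable_y t ht).mono (G.𝓕.le t) le_rfl)
    fun x' x => (hG.measurable_cost t ht x' x).mono (G.𝓕.le t) le_rfl

lemma measurable_responseError (hG : G.Regular) (B : AgentPolicy d G.𝓕) {t : ℕ} (ht : t < T) :
    Measurable (G.responseError B t) :=
  ((measurable_response hG B ht).sub ((measurable_bestResponse hG ht).comp
    (measurable_fst.prodMk (measurable_classifier hG B ht)))).norm

lemma measurable_payoff (hG : G.Regular) (B : AgentPolicy d G.𝓕) {t : ℕ} (ht : t < T) :
    Measurable fun p : Ω × (Fin T → Vec d) =>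
      (G.types t p.1).payoff (G.classifier B t p) (G.response B t p) :=
  (AgentType.measurable_payoff hG.alpha_pos (hG.types_regular t ht)
    ((hG.measurable_x t ht).mono (G.𝓕.le t) le_rfl)
    ((hG.measurable_y t ht).mono (G.𝓕.le t) le_rfl)
    fun x' x => (hG.measurable_cost t ht x' x).mono (G.𝓕.le t) le_rfl).comp
    (measurable_fst.prodMk ((measurable_classifier hG B ht).prodMk (measurable_response hG B ht)))

lemma measurable_realPayoff (hG : G.Regular) (B : AgentPolicy d G.𝓕) {t : ℕ} (ht : t < T) :
    Measurable fun p : Ω × (Fin T → Vec d) =>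
      (G.types t p.1).realPayoff (G.classifier B t p) (G.response B t p) :=
  (AgentType.measurable_realPayoff hG.alpha_pos (hG.types_regular t ht)
    ((hG.measurable_x t ht).mono (G.𝓕.le t) le_rfl)
    fun x' x => (hG.measurable_cost t ht x' x).mono (G.𝓕.le t) le_rfl).comp
    (g := fun q : Ω × Vec d × Vec d => (G.types t q.1).realPayoff q.2.1 q.2.2)
    (f := fun p : Ω × (Fin T → Vec d) => (p.1, G.classifier B t p, G.response B t p))
    (measurable_fst.prodMk ((measurable_classifier hG B ht).prodMk (measurable_response hG B ht)))

/-- The discounted utility without the infinite penalties. -/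
def realUtility (G : ClassificationGame d T Ω) (B : AgentPolicy d G.𝓕)
    (p : Ω × (Fin T → Vec d)) : ℝ :=
  ∑ t ∈ Finset.range T, G.γ ^ (t + 1) *
    (G.types t p.1).realPayoff (G.classifier B t p) (G.response B t p)

lemma measurable_realUtility (hG : G.Regular) (B : AgentPolicy d G.𝓕) :
    Measurable (G.realUtility B) :=
  Finset.measurable_fun_sum _ fun _ ht =>
    (measurable_realPayoff hG B (Finset.mem_range.1 ht)).const_mul _

lemma payoffBound_nonneg (hG : G.Regular) : 0 ≤ G.payoffBound := by
  have := hG.alpha_pos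
  unfold payoffBound
  positivity

lemma agentUtility_eq_of_ae {B : AgentPolicy d G.𝓕}
    (hi : Integrable (G.realUtility B) G.law)
    (hb : ∀ᵐ p ∂G.law, ∀ t < T,
      (G.types t p.1).payoff (G.classifier B t p) (G.response B t p) ≠ ⊥) :
    G.agentUtility B = ((∫ p, G.realUtility B p ∂G.law : ℝ) : EReal) := by
  refine erealExpectation_congr_coe hi (hb.mono fun p hp => ?_)
  rw [realUtility, ← sum_coe_mul_coe]
  exact Finset.sum_congr rfl fun t ht => by
    rw [AgentType.payoff_eq_of_ne_bot (hp t (Finset.mem_range.1 ht))]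

section Law

variable [NeZero d]

lemma isProbabilityMeasure_law (hG : G.Regular) : IsProbabilityMeasure G.law := by
  have := hG.prob
  unfold law
  infer_instance

lemma ae_norm_directions (hG : G.Regular) :
    ∀ᵐ p ∂G.law, ∀ t < T, ‖directions p.2 t‖ = 1 := by
  have := hG.prob
  have h1 : ∀ᵐ σ ∂(Measure.pi fun _ : Fin T => uniformSphere d), ∀ i, ‖σ i‖ = 1 :=
    ae_all_iff.2 fun i => (Measure.quasiMeasurePreserving_eval (fun _ : Fin T => uniformSphere d)
      i).ae ae_norm_eq_one_uniformSphere
  have h2 := (Measure.quasiMeasurePreserving_snd (μ := G.P)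
    (ν := Measure.pi fun _ : Fin T => uniformSphere d)).ae h1
  filter_upwards [h2] with p hp t ht
  simp [directions, ht, hp]

/-- The exceptional null set depends only on the directions, so it serves all policies at once and
the quantifier over `B` may stand inside. -/
lemma ae_classifier_mem (hG : G.Regular) :
    ∀ᵐ p ∂G.law, ∀ B : AgentPolicy d G.𝓕, ∀ t < T, G.classifier B t p ∈ G.Θ := by
  filter_upwards [ae_norm_directions hG] with p hp B t ht
  exact classifierAt_mem (G := copyParams G.Θ T G.R G.α G.γ) (R := G.R) hG.isClassifierDomain
    (GDwoG.tuned_delta_nonneg _ _ _ _ _) (GDwoG.tuned_delta_le_one _ _ _ _ _) (hp t ht).le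

lemma ae_norm_classifier_le (hG : G.Regular) :
    ∀ᵐ p ∂G.law, ∀ B : AgentPolicy d G.𝓕, ∀ t < T, ‖G.classifier B t p‖ ≤ G.R := by
  filter_upwards [ae_classifier_mem hG] with p hp B t ht
  exact hG.isClassifierDomain.norm_le (hp B t ht)

lemma one_le_R (hG : G.Regular) : 1 ≤ G.R :=
  hG.isClassifierDomain.one_le (Nat.pos_of_neZero d)

lemma realPayoff_le_payoffBound (hG : G.Regular) {t : ℕ} (ht : t < T) (ω : Ω) {θ : Vec d}
    (hθ : ‖θ‖ ≤ G.R) (z : Vec d) : (G.types t ω).realPayoff θ z ≤ G.payoffBound := by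
  have hα := hG.alpha_pos
  refine ((hG.types_regular t ht ω).realPayoff_le hα θ z).trans ?_
  have hR := one_le_R hG
  have h1 : ‖θ‖ * G.R ≤ G.R * G.R := by gcongr
  have h2 : ‖θ‖ ^ 2 / (2 * G.α) ≤ G.R ^ 2 / (2 * G.α) := by gcongr
  unfold payoffBound
  nlinarith

lemma neg_sq_le_realPayoff_response (hG : G.Regular) {t : ℕ} (ht : t < T) (ω : Ω) {θ : Vec d}
    (hθ : ‖θ‖ ≤ G.R) : -G.R ^ 2 ≤ (G.types t ω).realPayoff θ ((G.types t ω).response θ) := by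
  have h := (hG.types_regular t ht ω).le_realPayoff_response hG.alpha_pos θ
  have h1 : ‖θ‖ * G.R ≤ G.R * G.R := mul_le_mul_of_nonneg_right hθ (by linarith [one_le_R hG])
  nlinarith

lemma ae_realUtility_le (hG : G.Regular) :
    ∀ᵐ p ∂G.law, ∀ B : AgentPolicy d G.𝓕, G.realUtility B p ≤
      ∑ t ∈ Finset.range T, G.γ ^ (t + 1) * G.payoffBound := by
  filter_upwards [ae_norm_classifier_le hG] with p hp B
  refine Finset.sum_le_sum fun t ht => ?_
  have ht := Finset.mem_range.1 ht
  exact mul_le_mul_of_nonneg_left (realPayoff_le_payoffBound hG ht p.1 (hp B t ht) _)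
    (pow_nonneg hG.gamma_pos.le _)

/-- Always responding myopically has finite utility. -/
lemma agentUtility_myopicFrom_zero_ne_bot (hG : G.Regular) (B : AgentPolicy d G.𝓕) :
    G.agentUtility (myopicFrom hG B 0) ≠ ⊥ := by
  have := isProbabilityMeasure_law hG
  have hγ := hG.gamma_pos
  rw [agentUtility_eq_of_ae]
  · exact EReal.coe_ne_bot _
  · refine Integrable.of_mem_Icc (∑ t ∈ Finset.range T, G.γ ^ (t + 1) * (-G.R ^ 2))
      (∑ t ∈ Finset.range T, G.γ ^ (t + 1) * G.payoffBound)
      (measurable_realUtility hG _).aemeasurable ?_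
    filter_upwards [ae_realUtility_le hG, ae_norm_classifier_le hG] with p hp1 hp2
    refine ⟨Finset.sum_le_sum fun t ht => ?_, hp1 _⟩
    have ht := Finset.mem_range.1 ht
    rw [response_myopicFrom hG B (Nat.zero_le t) ht]
    exact mul_le_mul_of_nonneg_left (neg_sq_le_realPayoff_response hG ht p.1 (hp2 _ t ht))
      (pow_nonneg hγ.le _)
  · refine Filter.Eventually.of_forall fun p t ht => ?_
    rw [response_myopicFrom hG B (Nat.zero_le t) ht,
      AgentType.payoff_response]
    exact EReal.coe_ne_bot _

/-- A discounting agent has finite utility. -/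
lemma IsDiscounting.integrable (hG : G.Regular) {B : AgentPolicy d G.𝓕} (hB : G.IsDiscounting B) :
    Integrable (G.realUtility B) G.law ∧ ∀ᵐ p ∂G.law, ∀ t < T,
      (G.types t p.1).payoff (G.classifier B t p) (G.response B t p) ≠ ⊥ := by
  have := isProbabilityMeasure_law hG
  have hγ := hG.gamma_pos
  -- An optimal policy does at least as well as the policy that is myopic from round `0` on, whose
  -- utility is finite.
  have hne : G.agentUtility B ≠ ⊥ := fun h =>
    agentUtility_myopicFrom_zero_ne_bot hG B (le_bot_iff.1 (h ▸ hB (myopicFrom hG B 0)))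
  have hm : Measurable fun p : Ω × (Fin T → Vec d) => ∑ t ∈ Finset.range T,
      ((G.γ ^ (t + 1) : ℝ) : EReal) *
        (G.types t p.1).payoff (G.classifier B t p) (G.response B t p) :=
    Finset.measurable_fun_sum _ fun t ht =>
      (measurable_payoff hG B (Finset.mem_range.1 ht)).const_mul _
  have hle : ∀ᵐ p ∂G.law, ∑ t ∈ Finset.range T, ((G.γ ^ (t + 1) : ℝ) : EReal) *
        (G.types t p.1).payoff (G.classifier B t p) (G.response B t p) ≤
      ((∑ t ∈ Finset.range T, G.γ ^ (t + 1) * G.payoffBound : ℝ) : EReal) := by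
    filter_upwards [ae_realUtility_le hG] with p hp
    refine le_trans ?_ (EReal.coe_le_coe_iff.2 (hp B))
    rw [realUtility, ← sum_coe_mul_coe]
    refine Finset.sum_le_sum fun t _ => ?_
    exact mul_le_mul_of_nonneg_left (AgentType.payoff_le_realPayoff _ _ _)
      (EReal.coe_nonneg.2 (pow_nonneg hγ.le _))
  obtain ⟨h1, h2⟩ := integrable_toReal_of_erealExpectation_ne_bot hm hle hne
  have h3 : ∀ᵐ p ∂G.law, ∀ t < T,
      (G.types t p.1).payoff (G.classifier B t p) (G.response B t p) ≠ ⊥ :=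
    h1.mono fun p hp t ht => sum_coe_mul_ne_bot (c := fun t => G.γ ^ (t + 1))
      (fun t => pow_pos hγ _) hp ht
  refine ⟨h2.congr (h3.mono fun p hp => ?_), h3⟩
  have e : ∀ t ∈ Finset.range T, ((G.γ ^ (t + 1) : ℝ) : EReal) *
      (G.types t p.1).payoff (G.classifier B t p) (G.response B t p) =
      ((G.γ ^ (t + 1) : ℝ) : EReal) *
        ((G.types t p.1).realPayoff (G.classifier B t p) (G.response B t p) : EReal) :=
    fun t ht => by rw [AgentType.payoff_eq_of_ne_bot (hp t (Finset.mem_range.1 ht))]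
  simp only []
  rw [Finset.sum_congr rfl e, sum_coe_mul_coe, EReal.toReal_coe]
  rfl

end Law

end ClassificationGame

/-! ### The deviation argument: responses of a discounting agent are nearly best responses -/

namespace ClassificationGame

variable {d T : ℕ} {Ω : Type*} [MeasurableSpace Ω] {G : ClassificationGame d T Ω} [NeZero d]

lemma sum_ite_pow_le {γ c : ℝ} (h0 : 0 ≤ γ) (h1 : γ < 1) (hc : 0 ≤ c) (k T : ℕ) :
    ∑ i ∈ Finset.range T, (if k ≤ i then γ ^ (i + 1) * c else 0) ≤
      γ ^ (k + 1) * (1 / (1 - γ)) * c := by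
  rw [← Finset.sum_filter]
  have h : (Finset.range T).filter (k ≤ ·) = Finset.Ico k T := by
    ext i; simp only [Finset.mem_filter, Finset.mem_range, Finset.mem_Ico]; omega
  have h2 := geom_sum_Ico_le_of_lt_one (m := k) (n := T) h0 h1
  rw [h, ← Finset.sum_mul]
  refine mul_le_mul_of_nonneg_right ?_ hc
  simp only [pow_succ]
  rw [← Finset.sum_mul, mul_right_comm]
  refine mul_le_mul_of_nonneg_right ?_ h0
  rwa [mul_one_div]

/-- The cost of a suboptimal response in round `t`, when compared to responding myopically from
round `t` on: only the rounds from `t + D` on can make up for it. -/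
lemma realUtility_add_le (hG : G.Regular) (B : AgentPolicy d G.𝓕) {t : ℕ} (ht : t < T)
    {p : Ω × (Fin T → Vec d)}
    (hp : ∀ B : AgentPolicy d G.𝓕, ∀ t < T, ‖G.classifier B t p‖ ≤ G.R)
    (hb : ∀ t < T, (G.types t p.1).payoff (G.classifier B t p) (G.response B t p) ≠ ⊥) :
    G.realUtility B p + G.γ ^ (t + 1) * (G.α / 2 * G.responseError B t p ^ 2) ≤
      G.realUtility (myopicFrom hG B t) p +
        G.γ ^ (t + numCopies d T G.R G.α G.γ + 1) * (1 / (1 - G.γ)) *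
          (G.payoffBound + G.R ^ 2) := by
  set D := numCopies d T G.R G.α G.γ with hD
  have hDpos : 0 < D := numCopies_pos _ _ _ _ _
  have hγ := hG.gamma_pos
  have hM : 0 ≤ G.payoffBound + G.R ^ 2 := by
    have := payoffBound_nonneg hG
    positivity
  have hite : G.γ ^ (t + 1) * (G.α / 2 * G.responseError B t p ^ 2) =
      ∑ i ∈ Finset.range T, if i = t then G.γ ^ (i + 1) * (G.α / 2 * G.responseError B i p ^ 2)
        else 0 := by
    rw [Finset.sum_ite_eq' (Finset.range T) t, if_pos (Finset.mem_range.2 ht)]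
  refine le_trans ?_ (add_le_add_right (sum_ite_pow_le hγ.le hG.gamma_lt_one hM (t + D) T) _)
  rw [hite, realUtility, realUtility, ← Finset.sum_add_distrib, ← Finset.sum_add_distrib]
  refine Finset.sum_le_sum fun i hi => ?_
  have hi := Finset.mem_range.1 hi
  have hpow := pow_pos hγ (i + 1)
  have hreg := hG.types_regular i hi p.1
  rcases lt_or_ge i t with h | h
  -- Before round `t` the two plays coincide.
  · rw [if_neg (show ¬i = t by omega), if_neg (show ¬t + D ≤ i by omega), response_myopicFrom_of_lt hG B h,
      classifier_myopicFrom hG B (by omega)]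
  · rw [response_myopicFrom hG B h hi]
    -- Before round `t + D` both policies face the same classifier, so the myopic one loses nothing,
    -- and by quadratic growth it gains the claimed amount in round `t`. Its responses ignore the
    -- history, so the altered past does not matter.
    rcases lt_or_ge i (t + D) with h2 | h2
    · rw [if_neg (show ¬t + D ≤ i by omega), classifier_myopicFrom hG B h2, add_zero]
      have h3 := hreg.sq_norm_sub_response_le hG.alpha_pos (hb i hi)
      have h4 : (if i = t then G.γ ^ (i + 1) * (G.α / 2 * G.responseError B i p ^ 2) else 0) ≤
          G.γ ^ (i + 1) * (G.α / 2 * G.responseError B i p ^ 2) := by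
        have := hG.alpha_pos
        split_ifs
        · exact le_rfl
        · positivity
      have h5 := mul_le_mul_of_nonneg_left h3 hpow.le
      change _ * (G.α / 2 * G.responseError B i p ^ 2) ≤ _ at h5
      linarith
    -- From round `t + D` on the classifiers may differ; only the payoff range remains, from `-R²`
    -- for a best response up to `payoffBound`.
    · rw [if_neg (show ¬i = t by omega), if_pos h2]
      have h3 := realPayoff_le_payoffBound hG hi p.1 (hp B i hi) (G.response B i p)
      have h4 := neg_sq_le_realPayoff_response hG hi p.1 (hp (myopicFrom hG B t) i hi)
      rw [add_zero, ← mul_add]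
      refine mul_le_mul_of_nonneg_left ?_ hpow.le
      linarith

/-- The responses of a discounting agent are close to best responses in mean square. -/
theorem IsDiscounting.integral_responseError_sq_le (hG : G.Regular) {B : AgentPolicy d G.𝓕}
    (hB : G.IsDiscounting B) {t : ℕ} (ht : t < T) :
    Integrable (fun p => G.responseError B t p ^ 2) G.law ∧
    ∫ p, G.responseError B t p ^ 2 ∂G.law ≤
      2 / G.α * (G.γ ^ numCopies d T G.R G.α G.γ * discHorizon G.γ *
        (G.payoffBound + G.R ^ 2)) := by
  have := isProbabilityMeasure_law hG
  have hγ := hG.gamma_pos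
  have hα := hG.alpha_pos
  obtain ⟨hi, hb⟩ := hB.integrable hG
  set κ := G.γ ^ (t + numCopies d T G.R G.α G.γ + 1) * (1 / (1 - G.γ)) *
    (G.payoffBound + G.R ^ 2) with hκ
  set B' := myopicFrom hG B t with hB'
  have hkey : ∀ᵐ p ∂G.law, G.realUtility B p +
      G.γ ^ (t + 1) * (G.α / 2 * G.responseError B t p ^ 2) ≤ G.realUtility B' p + κ := by
    filter_upwards [ae_norm_classifier_le hG, hb] with p h1 h2
    exact realUtility_add_le hG B ht h1 h2
  have hb' : ∀ᵐ p ∂G.law, ∀ i < T,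
      (G.types i p.1).payoff (G.classifier B' i p) (G.response B' i p) ≠ ⊥ := by
    filter_upwards [hb] with p hp i hi
    rcases lt_or_ge i t with h | h
    · rw [response_myopicFrom_of_lt hG B h, classifier_myopicFrom hG B (by omega)]
      exact hp i hi
    · rw [response_myopicFrom hG B h hi, AgentType.payoff_response]
      exact EReal.coe_ne_bot _
  have hpos : ∀ p, 0 ≤ G.γ ^ (t + 1) * (G.α / 2 * G.responseError B t p ^ 2) := fun p => by
    positivity
  -- The deviation is squeezed between the integrable utility of `B` minus `κ` and a constant. Only
  -- then is the squared error, bounded by a difference of utilities, known to be integrable.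
  have hi' : Integrable (G.realUtility B') G.law := by
    refine integrable_of_le_of_le (measurable_realUtility hG _).aestronglyMeasurable
      (g₁ := fun p => G.realUtility B p - κ)
      (g₂ := fun _ => ∑ t ∈ Finset.range T, G.γ ^ (t + 1) * G.payoffBound) ?_ ?_
      (hi.sub (integrable_const _)) (integrable_const _)
    · filter_upwards [hkey] with p hp
      have := hpos p
      linarith
    · filter_upwards [ae_realUtility_le hG] with p hp using hp _
  have hie : Integrable (fun p => G.γ ^ (t + 1) * (G.α / 2 * G.responseError B t p ^ 2)) G.law := by
    refine integrable_of_le_of_le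
      ((((measurable_responseError hG B ht).pow_const 2).const_mul _).const_mul
        _).aestronglyMeasurable
      (g₁ := fun p => 0) (g₂ := fun p => G.realUtility B' p + κ - G.realUtility B p) ?_ ?_
      (integrable_const _) ((hi'.add (integrable_const _)).sub hi)
    · exact Filter.Eventually.of_forall hpos
    · filter_upwards [hkey] with p hp
      linarith
  have hopt := hB B'
  rw [agentUtility_eq_of_ae hi hb, agentUtility_eq_of_ae hi' hb', EReal.coe_le_coe_iff] at hopt
  have hint := integral_mono_ae (hi.add hie) (hi'.add (integrable_const κ)) hkey
  simp only [Pi.add_apply] at hint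
  rw [integral_add hi hie, integral_add hi' (integrable_const _), integral_const_mul,
    integral_const_mul, integral_const, probReal_univ, one_smul] at hint
  have hγt := pow_pos hγ (t + 1)
  constructor
  · have h := (hie.const_mul (G.γ ^ (t + 1))⁻¹).const_mul (2 / G.α)
    refine h.congr (Filter.Eventually.of_forall fun p => ?_)
    field_simp
  · have h1 : G.γ ^ (t + 1) * (G.α / 2 * ∫ p, G.responseError B t p ^ 2 ∂G.law) ≤
        G.γ ^ (t + 1) * (G.γ ^ numCopies d T G.R G.α G.γ * discHorizon G.γ *
          (G.payoffBound + G.R ^ 2)) := by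
      -- The discount of round `t` splits off and cancels, so the bound is the same in all rounds.
      have : κ = G.γ ^ (t + 1) * (G.γ ^ numCopies d T G.R G.α G.γ * discHorizon G.γ *
          (G.payoffBound + G.R ^ 2)) := by
        rw [hκ, discHorizon]; ring
      rw [← this]
      linarith
    have h2 := le_of_mul_le_mul_left h1 hγt
    rw [div_mul_eq_mul_div, le_div_iff₀ hα]
    linarith

/-- The number of copies makes the discount over `D` rounds negligible. -/
lemma pow_numCopies_le (hG : G.Regular) (hT : 1 ≤ T) :
    G.γ ^ numCopies d T G.R G.α G.γ * discHorizon G.γ * (G.payoffBound + G.R ^ 2) ≤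
      2 * targetAccuracy d T G.R G.α := by
  have hγ := hG.gamma_pos
  have hγ1 : 0 < 1 - G.γ := sub_pos.2 hG.gamma_lt_one
  have hα := hG.alpha_pos
  have hR := one_le_R hG
  have hd : (0 : ℝ) < d := Nat.cast_pos.2 (Nat.pos_of_neZero d)
  have hT' : (0 : ℝ) < T := by exact_mod_cast hT
  have hε : 0 < targetAccuracy d T G.R G.α := by
    unfold targetAccuracy
    have : 0 < G.R := by linarith
    positivity
  have hH : 0 < discHorizon G.γ := by unfold discHorizon; positivity
  set X := G.R ^ 2 * (1 + 1 / G.α) * discHorizon G.γ / targetAccuracy d T G.R G.α with hX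
  have hX0 : 0 < X := by
    have : 0 < G.R := by linarith
    positivity
  have hD : discHorizon G.γ * Real.log X ≤ numCopies d T G.R G.α G.γ := by
    unfold numCopies
    exact (Nat.le_ceil _).trans (by exact_mod_cast le_max_right _ _)
  -- `γ ≤ exp (-(1 - γ))` and `D (1 - γ) ≥ log X`.
  have hpow : G.γ ^ numCopies d T G.R G.α G.γ ≤ X⁻¹ := by
    have h1 : G.γ ≤ Real.exp (-(1 - G.γ)) := by
      have := Real.add_one_le_exp (-(1 - G.γ))
      linarith
    calc G.γ ^ numCopies d T G.R G.α G.γ ≤ Real.exp (-(1 - G.γ)) ^ numCopies d T G.R G.α G.γ := by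
          gcongr
      _ = Real.exp (-((numCopies d T G.R G.α G.γ : ℝ) * (1 - G.γ))) := by
          rw [← Real.exp_nat_mul]; congr 1; ring
      _ ≤ Real.exp (-Real.log X) := by
          gcongr
          have h2 := mul_le_mul_of_nonneg_right hD hγ1.le
          have h3 : discHorizon G.γ * Real.log X * (1 - G.γ) = Real.log X := by
            unfold discHorizon; field_simp
          linarith
      _ = X⁻¹ := by rw [Real.exp_neg, Real.exp_log hX0]
  have hM : G.payoffBound + G.R ^ 2 ≤ 2 * (G.R ^ 2 * (1 + 1 / G.α)) := by
    unfold payoffBound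
    have h1 : G.R ^ 2 / (2 * G.α) = G.R ^ 2 * (1 / G.α) / 2 := by field_simp
    have h2 : 0 ≤ G.R ^ 2 * (1 / G.α) := by positivity
    rw [h1]
    linarith
  have hM0 : 0 ≤ G.payoffBound + G.R ^ 2 := by
    have := payoffBound_nonneg hG
    positivity
  calc _ ≤ X⁻¹ * discHorizon G.γ * (2 * (G.R ^ 2 * (1 + 1 / G.α))) := by gcongr
    _ = 2 * targetAccuracy d T G.R G.α := by
      have : 0 < G.R := by linarith
      rw [hX]
      field_simp

/-- The mean square error of the responses. -/
theorem IsDiscounting.integral_responseError_sq_le' (hG : G.Regular) {B : AgentPolicy d G.𝓕}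
    (hB : G.IsDiscounting B) {t : ℕ} (ht : t < T) :
    ∫ p, G.responseError B t p ^ 2 ∂G.law ≤ 4 / (G.R ^ 4 * d * (T : ℝ) ^ (5 / 2 : ℝ)) := by
  have hα := hG.alpha_pos
  refine (hB.integral_responseError_sq_le hG ht).2.trans ?_
  have h := pow_numCopies_le (d := d) hG (by omega : 1 ≤ T)
  calc _ ≤ 2 / G.α * (2 * targetAccuracy d T G.R G.α) := by gcongr
    _ = _ := by
      unfold targetAccuracy
      field_simp
      norm_num

end ClassificationGame

/-! ### Resampling one direction -/

/-- Replacing one coordinate by a fresh sample preserves the product law: the preimage of a box is a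
box whose `i`-th condition has moved to the fresh coordinate. -/
lemma measurePreserving_update {ι X : Type*} [Fintype ι] [DecidableEq ι] [MeasurableSpace X]
    (μ : Measure X) [IsProbabilityMeasure μ] (i : ι) :
    MeasurePreserving (fun q : (ι → X) × X => Function.update q.1 i q.2)
      ((Measure.pi fun _ : ι => μ).prod μ) (Measure.pi fun _ : ι => μ) := by
  have hm : Measurable fun q : (ι → X) × X => Function.update q.1 i q.2 := by
    refine measurable_pi_lambda _ fun j => ?_
    by_cases h : j = i
    · subst h; simpa using measurable_snd
    · simp only [Function.update_of_ne h]; fun_prop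
  refine ⟨hm, (Measure.pi_eq fun A hA => ?_).symm⟩
  rw [Measure.map_apply hm (MeasurableSet.univ_pi hA)]
  have hset : (fun q : (ι → X) × X => Function.update q.1 i q.2) ⁻¹' (univ.pi A) =
      (univ.pi (Function.update A i univ)) ×ˢ A i := by
    ext ⟨σ, s⟩
    simp only [mem_preimage, mem_pi, mem_univ, true_imp_iff, mem_prod]
    constructor
    · intro h
      refine ⟨fun j => ?_, by simpa using h i⟩
      by_cases hj : j = i
      · subst hj; simp
      · simpa [hj] using h j
    · rintro ⟨h1, h2⟩ j
      by_cases hj : j = i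
      · subst hj; simpa using h2
      · simpa [hj] using h1 j
  rw [hset, Measure.prod_prod, Measure.pi_pi, ← Finset.mul_prod_erase _ _ (Finset.mem_univ i),
    ← Finset.mul_prod_erase _ (fun j => μ (A j)) (Finset.mem_univ i), Function.update_self,
    measure_univ, one_mul, mul_comm]
  congr 1
  exact Finset.prod_congr rfl fun j hj => by rw [Function.update_of_ne (Finset.ne_of_mem_erase hj)]

/-- A bound on the conditional expectation over one coordinate bounds the expectation. -/
lemma integral_prod_pi_le_of_update {Ω ι X : Type*} [MeasurableSpace Ω] [Fintype ι] [DecidableEq ι]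
    [MeasurableSpace X] (P : Measure Ω) [IsProbabilityMeasure P] (μ : Measure X)
    [IsProbabilityMeasure μ] (i : ι) {F : Ω × (ι → X) → ℝ}
    (hF : Integrable F (P.prod (Measure.pi fun _ : ι => μ))) {c : ℝ}
    (hc : ∀ ω σ, ∫ s, F (ω, Function.update σ i s) ∂μ ≤ c) :
    ∫ p, F p ∂(P.prod (Measure.pi fun _ : ι => μ)) ≤ c := by
  have hmp : MeasurePreserving (fun q : (Ω × (ι → X)) × X => (q.1.1, Function.update q.1.2 i q.2))
      ((P.prod (Measure.pi fun _ : ι => μ)).prod μ) (P.prod (Measure.pi fun _ : ι => μ)) := by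
    have h1 := (MeasurePreserving.id P).prod (measurePreserving_update μ i)
    exact h1.comp (measurePreserving_prodAssoc P (Measure.pi fun _ : ι => μ) μ)
  have hi : Integrable (fun q : (Ω × (ι → X)) × X => F (q.1.1, Function.update q.1.2 i q.2))
      ((P.prod (Measure.pi fun _ : ι => μ)).prod μ) := hmp.integrable_comp_of_integrable hF
  have h2 : ∫ p, F p ∂(P.prod (Measure.pi fun _ : ι => μ)) =
      ∫ q, F (q.1.1, Function.update q.1.2 i q.2) ∂((P.prod (Measure.pi fun _ : ι => μ)).prod μ) := by
    rw [← hmp.map_eq] at hF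
    conv_lhs => rw [← hmp.map_eq]
    rw [integral_map hmp.measurable.aemeasurable hF.aestronglyMeasurable]
  rw [h2, integral_prod _ hi]
  calc _ ≤ ∫ _, c ∂(P.prod (Measure.pi fun _ : ι => μ)) :=
        integral_mono hi.integral_prod_left (integrable_const _) fun p => hc p.1 p.2
    _ = c := by simp

/-- The pointwise bound `e ≤ (q + e² / q) / 2` yields integrability and the mean bound together. -/
lemma integrable_of_integrable_sq {Ω : Type*} [MeasurableSpace Ω] {μ : Measure Ω}
    [IsProbabilityMeasure μ] {e : Ω → ℝ} (hm : Measurable e) (h0 : ∀ ω, 0 ≤ e ω)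
    (h2 : Integrable (fun ω => e ω ^ 2) μ) {q : ℝ} (hq : 0 < q) (h : ∫ ω, e ω ^ 2 ∂μ ≤ q ^ 2) :
    Integrable e μ ∧ ∫ ω, e ω ∂μ ≤ q := by
  have hle : ∀ ω, e ω ≤ (q + e ω ^ 2 / q) / 2 := by
    intro ω
    rw [le_div_iff₀ two_pos, ← sub_le_iff_le_add', le_div_iff₀ hq]
    nlinarith [sq_nonneg (e ω - q)]
  have hi2 : Integrable (fun ω => (q + e ω ^ 2 / q) / 2) μ :=
    ((integrable_const q).add (h2.div_const q)).div_const 2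
  have hi : Integrable e μ := integrable_of_le_of_le hm.aestronglyMeasurable
    (Filter.Eventually.of_forall h0) (Filter.Eventually.of_forall hle) (integrable_const 0) hi2
  refine ⟨hi, (integral_mono hi hi2 hle).trans ?_⟩
  rw [integral_div, integral_add (integrable_const q) (h2.div_const q), integral_div]
  simp only [integral_const, probReal_univ, one_smul]
  have : (∫ ω, e ω ^ 2 ∂μ) / q ≤ q := by
    rw [div_le_iff₀ hq]; nlinarith
  linarith

/-! ### The regret -/

namespace ClassificationGame

variable {d T : ℕ} {Ω : Type*} [MeasurableSpace Ω] {G : ClassificationGame d T Ω}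

/-- The parameters of the copies that the principal runs. -/
abbrev params (G : ClassificationGame d T Ω) : GDwoG d := copyParams G.Θ T G.R G.α G.γ

/-- The number of copies. -/
abbrev copies (G : ClassificationGame d T Ω) : ℕ := numCopies d T G.R G.α G.γ

/-- The bound `C` on the losses. -/
def lossBound (G : ClassificationGame d T Ω) : ℝ := 1 + G.R ^ 2 + G.R ^ 2 / G.α

/-- The Lipschitz constant `L` of the losses. -/
def lossLip (G : ClassificationGame d T Ω) : ℝ := G.R + 2 * G.R / G.α

/-- The iterate of the copy that is active in round `t`. -/
def iterate (G : ClassificationGame d T Ω) (B : AgentPolicy d G.𝓕) (t : ℕ)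
    (p : Ω × (Fin T → Vec d)) : Vec d :=
  iterateAt G.params G.copies G.ℓ (fun t => G.types t p.1) (fun t => B.act t p.1)
    (directions p.2) t

lemma classifier_eq (B : AgentPolicy d G.𝓕) (t : ℕ) (p : Ω × (Fin T → Vec d)) :
    G.classifier B t p = G.iterate B t p + G.params.δ • directions p.2 t := rfl

lemma iterate_mem (hG : G.Regular) (B : AgentPolicy d G.𝓕) (t : ℕ) (p : Ω × (Fin T → Vec d)) :
    G.iterate B t p ∈ (fun z => (1 - G.params.δ) • z) '' G.Θ :=
  iterateAt_mem (G := G.params) (R := G.R) hG.isClassifierDomain t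

lemma measurable_iterate (hG : G.Regular) (B : AgentPolicy d G.𝓕) {t : ℕ} (ht : t < T) :
    Measurable (G.iterate B t) :=
  (isMeasurablePlay hG B).iterateAt (R := G.R) hG.isClassifierDomain ht

/-- The iterate of round `t` is determined before the direction of round `t` is drawn, so resampling
that direction leaves it fixed. -/
lemma iterate_update (B : AgentPolicy d G.𝓕) {t : ℕ} (ht : t < T) (ω : Ω) (σ : Fin T → Vec d)
    (s : Vec d) : G.iterate B t (ω, Function.update σ ⟨t, ht⟩ s) = G.iterate B t (ω, σ) := by
  refine iterateAt_congr (fun _ _ => rfl) fun i hi => ?_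
  have : (⟨i, by omega⟩ : Fin T) ≠ ⟨t, ht⟩ := by
    rw [Ne, Fin.mk.injEq]; omega
  simp [directions, show i < T by omega, this]

lemma directions_update {t : ℕ} (ht : t < T) (σ : Fin T → Vec d) (s : Vec d) :
    directions (Function.update σ ⟨t, ht⟩ s) t = s := by
  simp [directions, ht]

variable {g : ℝ → ℝ}

lemma measurable_brLoss (hG : G.Regular) (hg : IsMarginLoss g) {t : ℕ} (ht : t < T) :
    Measurable fun q : Ω × Vec d => brLoss g (G.types t q.1) q.2 := by
  have h1 := measurable_bestResponse hG ht
  have h2 : Measurable fun q : Ω × Vec d => (G.types t q.1).y :=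
    ((hG.measurable_y t ht).mono (G.𝓕.le t) le_rfl).comp measurable_fst
  have h3 := hg.continuous.measurable
  unfold brLoss AgentType.margin
  fun_prop

lemma brLoss_mem_Icc (hG : G.Regular) (hg : IsMarginLoss g) {t : ℕ} (ht : t < T) (ω : Ω)
    {θ : Vec d} (hθ : ‖θ‖ ≤ G.R) : brLoss g (G.types t ω) θ ∈ Icc 0 G.lossBound :=
  ⟨AgentType.Regular.brLoss_nonneg hg _ _, (hG.types_regular t ht ω).brLoss_le hG.alpha_pos hg hθ⟩

/-- The error of the one-point gradient estimate in round `t`. -/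
def gradientError (G : ClassificationGame d T Ω) (g : ℝ → ℝ) (B : AgentPolicy d G.𝓕) (u : Vec d)
    (t : ℕ) (p : Ω × (Fin T → Vec d)) : ℝ :=
  brLoss g (G.types t p.1) (G.classifier B t p) +
    d / G.params.δ * (brLoss g (G.types t p.1) (G.classifier B t p) *
      inner ℝ (directions p.2 t) (u - G.iterate B t p)) - brLoss g (G.types t p.1) u

/-- The observed loss. -/
def observedLoss (G : ClassificationGame d T Ω) (B : AgentPolicy d G.𝓕) (t : ℕ)
    (p : Ω × (Fin T → Vec d)) : ℝ :=
  G.ℓ (G.classifier B t p) (G.response B t p) (G.types t p.1).y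

lemma abs_observedLoss_sub_le (hG : G.Regular) (hg : IsMarginLoss g)
    (hℓ : G.ℓ = fun θ x y => g (-(y * inner ℝ θ x))) (B : AgentPolicy d G.𝓕) {t : ℕ} (ht : t < T)
    {p : Ω × (Fin T → Vec d)} (hp : ‖G.classifier B t p‖ ≤ G.R) :
    |G.observedLoss B t p - brLoss g (G.types t p.1) (G.classifier B t p)| ≤
      G.R * G.responseError B t p := by
  have h := (hG.types_regular t ht p.1).abs_loss_sub_brLoss_le hg hp (G.response B t p)
  unfold observedLoss responseError
  rw [hℓ]
  exact h

lemma abs_observedLoss_le (hG : G.Regular) (hg : IsMarginLoss g)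
    (hℓ : G.ℓ = fun θ x y => g (-(y * inner ℝ θ x))) (B : AgentPolicy d G.𝓕) {t : ℕ} (ht : t < T)
    {p : Ω × (Fin T → Vec d)} (hp : ‖G.classifier B t p‖ ≤ G.R) :
    |G.observedLoss B t p| ≤ G.lossBound + G.R * G.responseError B t p := by
  have h1 := abs_observedLoss_sub_le hG hg hℓ B ht hp
  have h2 := brLoss_mem_Icc hG hg ht p.1 hp
  rw [abs_le] at h1 ⊢
  constructor <;> linarith [h1.1, h1.2, h2.1, h2.2]

section Law

variable [NeZero d]

/-- The one-point gradient estimate for the loss of round `t`, at a fixed iterate. -/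
lemma integral_brLoss_le (hG : G.Regular) (hg : IsMarginLoss g) {t : ℕ} (ht : t < T) (ω : Ω)
    {δ : ℝ} (hδ0 : 0 < δ) (hδ1 : δ ≤ 1) {v u : Vec d}
    (hv : v ∈ (fun z => (1 - δ) • z) '' G.Θ) (hu : u ∈ (fun z => (1 - δ) • z) '' G.Θ) :
    ∫ s, (brLoss g (G.types t ω) (v + δ • s) +
        d / δ * (brLoss g (G.types t ω) (v + δ • s) * inner ℝ s (u - v)) -
          brLoss g (G.types t ω) u) ∂uniformSphere d ≤ 2 * G.lossLip * δ := by
  have hS := hG.isClassifierDomain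
  have hreg := hG.types_regular t ht ω
  have hα := hG.alpha_pos
  set h := brLoss g (G.types t ω) with hh
  have hconv : ConvexOn ℝ univ h := hreg.convexOn_brLoss hα hg
  have hcont : Continuous h := hconv.locallyLipschitz.continuous
  have hL : 0 ≤ G.lossLip := by
    have := one_le_R hG
    unfold lossLip; positivity
  -- Used twice: at `v` to compare the query with the iterate, and at `u` to supply the constant `c`
  -- of the one-point estimate. Hence the factor `2` in the conclusion.
  have hlip : ∀ w ∈ (fun z => (1 - δ) • z) '' G.Θ, ∀ y : Vec d, ‖y‖ ≤ 1 →
      h (w + δ • y) ≤ h w + G.lossLip * δ := by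
    intro w hw y hy
    have h1 := hreg.brLoss_sub_le hα hg (hS.norm_le (hS.add_smul_mem hδ0.le hδ1 hw hy))
      (hS.norm_le (hS.shrink_subset hδ0.le hδ1 hw))
    rw [add_sub_cancel_left, norm_smul, Real.norm_of_nonneg hδ0.le] at h1
    have h2 : G.lossLip * (δ * ‖y‖) ≤ G.lossLip * (δ * 1) := by gcongr
    change _ ≤ G.lossLip * (δ * ‖y‖) at h1
    linarith
  have hi1 : Integrable (fun s => h (v + δ • s)) (uniformSphere d) := by
    refine Integrable.of_mem_Icc 0 G.lossBound (by fun_prop) ?_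
    filter_upwards [ae_norm_eq_one_uniformSphere] with s hs
    exact brLoss_mem_Icc hG hg ht ω (hS.norm_le (hS.add_smul_mem hδ0.le hδ1 hv hs.le))
  have hi2 : Integrable (fun s => h (v + δ • s) * inner ℝ s (u - v)) (uniformSphere d) := by
    refine hi1.mul_bdd (c := ‖u - v‖) (by fun_prop) ?_
    filter_upwards [ae_norm_eq_one_uniformSphere] with s hs
    have := norm_inner_le_norm (𝕜 := ℝ) s (u - v)
    rwa [hs, one_mul] at this
  have e1 : ∫ s, h (v + δ • s) ∂uniformSphere d ≤ h v + G.lossLip * δ := by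
    have : ∫ s, h (v + δ • s) ∂uniformSphere d ≤
        ∫ _, (h v + G.lossLip * δ) ∂uniformSphere d := by
      refine integral_mono_ae hi1 (integrable_const _) ?_
      filter_upwards [ae_norm_eq_one_uniformSphere] with s hs
      exact hlip v hv s hs.le
    simpa using this
  have e2 := integral_uniformSphere_mul_inner_le (v := v) hconv hδ0 (hlip u hu)
  have hi3 : Integrable (fun s => h (v + δ • s) + d / δ * (h (v + δ • s) * inner ℝ s (u - v)))
      (uniformSphere d) := hi1.add (hi2.const_mul _)
  rw [integral_sub hi3 (integrable_const _), integral_add hi1 (hi2.const_mul _), integral_const_mul]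
  simp only [integral_const, probReal_univ, one_smul]
  linarith

/-- Condition on everything but the direction of round `t`. The type and the iterate are then fixed.
The response to `θ_t`, over which there is no control, does not enter, because the error is defined
with the loss at the best response. -/
lemma integral_gradientError_le (hG : G.Regular) (hg : IsMarginLoss g) (B : AgentPolicy d G.𝓕)
    (hδ : 0 < G.params.δ) {u : Vec d} (hu : u ∈ (fun z => (1 - G.params.δ) • z) '' G.Θ) {t : ℕ}
    (ht : t < T) :
    Integrable (G.gradientError g B u t) G.law ∧
      ∫ p, G.gradientError g B u t p ∂G.law ≤ 2 * G.lossLip * G.params.δ := by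
  have := hG.prob
  have hlaw := isProbabilityMeasure_law hG
  have hS := hG.isClassifierDomain
  have hδ1 : G.params.δ ≤ 1 := GDwoG.tuned_delta_le_one _ _ _ _ _
  have hmh := measurable_brLoss hG hg ht
  have hm1 : Measurable fun p : Ω × (Fin T → Vec d) =>
      brLoss g (G.types t p.1) (G.classifier B t p) :=
    hmh.comp (measurable_fst.prodMk (measurable_classifier hG B ht))
  have hm2 : Measurable fun p : Ω × (Fin T → Vec d) => brLoss g (G.types t p.1) u :=
    hmh.comp (measurable_fst.prodMk measurable_const)
  have hm3 : Measurable fun p : Ω × (Fin T → Vec d) =>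
      (inner ℝ (directions p.2 t) (u - G.iterate B t p) : ℝ) := by
    have h1 := measurable_directions (Ω := Ω) (T := T) (d := d) t
    have h2 := measurable_iterate hG B ht
    fun_prop
  have hi1 : Integrable (fun p => brLoss g (G.types t p.1) (G.classifier B t p)) G.law := by
    refine Integrable.of_mem_Icc 0 G.lossBound hm1.aemeasurable ?_
    filter_upwards [ae_norm_classifier_le hG] with p hp
    exact brLoss_mem_Icc hG hg ht p.1 (hp B t ht)
  have hi2 : Integrable (fun p : Ω × (Fin T → Vec d) => brLoss g (G.types t p.1) u) G.law :=
    Integrable.of_mem_Icc 0 G.lossBound hm2.aemeasurable (Filter.Eventually.of_forall fun p =>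
      brLoss_mem_Icc hG hg ht p.1 (hS.norm_le (hS.shrink_subset hδ.le hδ1 hu)))
  have hi3 : Integrable (fun p => brLoss g (G.types t p.1) (G.classifier B t p) *
      inner ℝ (directions p.2 t) (u - G.iterate B t p)) G.law := by
    refine hi1.mul_bdd (c := 2 * G.R) hm3.aestronglyMeasurable ?_
    filter_upwards [ae_norm_directions hG] with p hp
    have h1 := norm_inner_le_norm (𝕜 := ℝ) (directions p.2 t) (u - G.iterate B t p)
    rw [hp t ht, one_mul] at h1
    have h2 := norm_sub_le u (G.iterate B t p)
    have h3 := hS.norm_le (hS.shrink_subset hδ.le hδ1 hu)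
    have h4 := hS.norm_le (hS.shrink_subset hδ.le hδ1 (iterate_mem hG B t p))
    linarith
  have hi : Integrable (G.gradientError g B u t) G.law := (hi1.add (hi3.const_mul _)).sub hi2
  refine ⟨hi, integral_prod_pi_le_of_update G.P (uniformSphere d) ⟨t, ht⟩ hi fun ω σ => ?_⟩
  have h := integral_brLoss_le hG hg ht ω hδ hδ1 (iterate_mem hG B t (ω, σ)) hu
  simpa only [gradientError, classifier_eq, iterate_update, directions_update] using h

/-- The pathwise bound on the regret against `u`. -/
lemma totalLoss_sub_le (hG : G.Regular) (hg : IsMarginLoss g)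
    (hℓ : G.ℓ = fun θ x y => g (-(y * inner ℝ θ x))) (B : AgentPolicy d G.𝓕)
    (hδ : 0 < G.params.δ) (hη : 0 < G.params.η) {u : Vec d}
    (hu : u ∈ (fun z => (1 - G.params.δ) • z) '' G.Θ) {p : Ω × (Fin T → Vec d)}
    (hs : ∀ t < T, ‖directions p.2 t‖ = 1) (hp : ∀ t < T, ‖G.classifier B t p‖ ≤ G.R) :
    G.totalLoss B p - ∑ t ∈ Finset.range T, brLoss g (G.types t p.1) u ≤
      ∑ t ∈ Finset.range T, (G.gradientError g B u t p +
        (G.R + 2 * G.R ^ 2 * (d / G.params.δ)) * G.responseError B t p +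
        d / G.params.δ * G.params.η * (G.lossBound ^ 2 + G.R ^ 2 * G.responseError B t p ^ 2)) +
      d / G.params.δ * (G.copies * G.R ^ 2 / (2 * G.params.η)) := by
  have hS := hG.isClassifierDomain
  have hδ1 : G.params.δ ≤ 1 := GDwoG.tuned_delta_le_one _ _ _ _ _
  have hR := one_le_R hG
  have huR : ‖u‖ ≤ G.R := hS.norm_le (hS.shrink_subset hδ.le hδ1 hu)
  have hdδ : 0 ≤ (d : ℝ) / G.params.δ := by positivity
  set κ := (d : ℝ) / G.params.δ with hκ
  set η := G.params.η with hη'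
  have hgd : 2 * η * ∑ t ∈ Finset.range T, G.observedLoss B t p *
        inner ℝ (directions p.2 t) (G.iterate B t p - u) ≤
      G.copies * ‖u‖ ^ 2 + η ^ 2 * ∑ t ∈ Finset.range T, G.observedLoss B t p ^ 2 :=
    sum_lossAt_mul_inner_le (G := G.params) (R := G.R) hS (numCopies_pos _ _ _ _ _)
      (fun t ht => (hs t ht).le) hu
  have hgd2 : κ * ∑ t ∈ Finset.range T, G.observedLoss B t p *
        inner ℝ (directions p.2 t) (G.iterate B t p - u) ≤
      κ * (G.copies * G.R ^ 2 / (2 * η)) +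
        ∑ t ∈ Finset.range T, κ * (η / 2 * G.observedLoss B t p ^ 2) := by
    rw [← Finset.mul_sum, ← mul_add, ← Finset.mul_sum]
    refine mul_le_mul_of_nonneg_left ?_ hdδ
    have h1 : (G.copies : ℝ) * ‖u‖ ^ 2 ≤ G.copies * G.R ^ 2 := by gcongr
    refine le_of_mul_le_mul_left ?_ (by positivity : 0 < 2 * η)
    refine hgd.trans ((add_le_add_left h1 _).trans (le_of_eq ?_))
    field_simp
  -- The algorithm uses the observed loss, the gradient estimate the loss at the best response; they
  -- differ by at most `R e`, with `e` the response error. This costs `R e` in the loss and, as the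
  -- inner product is at most `2 R`, a further `2 R² κ e` in the gradient term.
  have hterm : ∀ t ∈ Finset.range T, G.observedLoss B t p - brLoss g (G.types t p.1) u -
      κ * (G.observedLoss B t p * inner ℝ (directions p.2 t) (G.iterate B t p - u)) +
      κ * (η / 2 * G.observedLoss B t p ^ 2) ≤
      G.gradientError g B u t p + (G.R + 2 * G.R ^ 2 * κ) * G.responseError B t p +
        κ * η * (G.lossBound ^ 2 + G.R ^ 2 * G.responseError B t p ^ 2) := by
    intro t ht
    have ht := Finset.mem_range.1 ht
    have h1 := abs_observedLoss_sub_le hG hg hℓ B ht (hp t ht)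
    have h2 := abs_observedLoss_le hG hg hℓ B ht (hp t ht)
    have he : 0 ≤ G.responseError B t p := norm_nonneg _
    have hinner : |inner ℝ (directions p.2 t) (G.iterate B t p - u)| ≤ 2 * G.R := by
      have h1 := abs_real_inner_le_norm (directions p.2 t) (G.iterate B t p - u)
      rw [hs t ht, one_mul] at h1
      have h2 := norm_sub_le (G.iterate B t p) u
      have h4 := hS.norm_le (hS.shrink_subset hδ.le hδ1 (iterate_mem hG B t p))
      linarith
    have hsq : G.observedLoss B t p ^ 2 ≤
        2 * (G.lossBound ^ 2 + G.R ^ 2 * G.responseError B t p ^ 2) := by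
      rw [← sq_abs]
      have := pow_le_pow_left₀ (abs_nonneg _) h2 2
      nlinarith [sq_nonneg (G.lossBound - G.R * G.responseError B t p)]
    have hgrad : G.gradientError g B u t p = brLoss g (G.types t p.1) (G.classifier B t p) -
        κ * (brLoss g (G.types t p.1) (G.classifier B t p) *
          inner ℝ (directions p.2 t) (G.iterate B t p - u)) - brLoss g (G.types t p.1) u := by
      unfold gradientError
      rw [← neg_sub (G.iterate B t p) u, inner_neg_right]
      ring
    rw [hgrad]
    set I := (inner ℝ (directions p.2 t) (G.iterate B t p - u) : ℝ)
    set o := G.observedLoss B t p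
    set b := brLoss g (G.types t p.1) (G.classifier B t p)
    set e := G.responseError B t p
    have hprod : |(b - o) * I| ≤ G.R * e * (2 * G.R) := by
      rw [abs_mul, abs_sub_comm]
      exact mul_le_mul h1 hinner (abs_nonneg _) (by positivity)
    have hprod2 := mul_le_mul_of_nonneg_left ((le_abs_self _).trans hprod) hdδ
    have hsq2 := mul_le_mul_of_nonneg_left hsq (by positivity : 0 ≤ κ * (η / 2))
    have h3 := (abs_le.1 h1).2
    linarith
  have hsum := Finset.sum_le_sum hterm
  simp only [Finset.sum_add_distrib, Finset.sum_sub_distrib, ← Finset.mul_sum] at hsum hgd2 ⊢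
  unfold totalLoss
  unfold observedLoss at *
  linarith

end Law

end ClassificationGame

/-! ### The regret bound in terms of the parameters -/

namespace ClassificationGame

variable {d T : ℕ} {Ω : Type*} [MeasurableSpace Ω] {G : ClassificationGame d T Ω}

/-- The bound on the mean distance of the responses from best responses. -/
def errorBound (G : ClassificationGame d T Ω) : ℝ :=
  2 / (G.R ^ 2 * Real.sqrt d * (T : ℝ) ^ (5 / 4 : ℝ))

variable {g : ℝ → ℝ}

lemma benchmarkLoss_eq (hG : G.Regular) (hℓ : G.ℓ = fun θ x y => g (-(y * inner ℝ θ x)))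
    (θ : Vec d) (ω : Ω) :
    G.benchmarkLoss θ ω = ∑ t ∈ Finset.range T, brLoss g (G.types t ω) θ :=
  Finset.sum_congr rfl fun t ht => by
    rw [(hG.types_regular t (Finset.mem_range.1 ht) ω).bestRespLoss_eq hG.alpha_pos, hℓ]
    rfl

lemma integrable_benchmarkLoss (hG : G.Regular) {θ : Vec d} (hθ : θ ∈ G.Θ) :
    Integrable (G.benchmarkLoss θ) G.P := by
  have := hG.prob
  obtain ⟨g, hg, hℓ⟩ := exists_isMarginLoss hG.loss
  rw [funext (benchmarkLoss_eq hG hℓ θ)]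
  refine integrable_finsetSum _ fun t ht => ?_
  have ht := Finset.mem_range.1 ht
  exact Integrable.of_mem_Icc 0 G.lossBound
    ((measurable_brLoss hG hg ht).comp (measurable_id.prodMk measurable_const)).aemeasurable
    (Filter.Eventually.of_forall fun ω =>
      brLoss_mem_Icc hG hg ht ω (hG.isClassifierDomain.norm_le hθ))

lemma measurable_observedLoss (hG : G.Regular) (B : AgentPolicy d G.𝓕) {t : ℕ} (ht : t < T) :
    Measurable (G.observedLoss B t) :=
  (isMeasurablePlay hG B).lossAt (R := G.R) hG.isClassifierDomain ht

/-- Convexity between `θ` and `0`: in each round the loss at `0` is at most `1` and the loss at `θ`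
is nonnegative. -/
lemma benchmarkLoss_smul_le (hG : G.Regular) (hg : IsMarginLoss g)
    (hℓ : G.ℓ = fun θ x y => g (-(y * inner ℝ θ x))) {δ : ℝ} (hδ0 : 0 ≤ δ) (hδ1 : δ ≤ 1)
    (θ : Vec d) (ω : Ω) :
    G.benchmarkLoss ((1 - δ) • θ) ω ≤ G.benchmarkLoss θ ω + T * δ := by
  rw [benchmarkLoss_eq hG hℓ, benchmarkLoss_eq hG hℓ]
  have : (T : ℝ) * δ = ∑ _t ∈ Finset.range T, δ := by simp
  rw [this, ← Finset.sum_add_distrib]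
  refine Finset.sum_le_sum fun t ht => ?_
  have h := ((hG.types_regular t (Finset.mem_range.1 ht) ω).convexOn_brLoss hG.alpha_pos hg).2
    (mem_univ θ) (mem_univ 0) (sub_nonneg.2 hδ1) hδ0 (by ring)
  rw [smul_zero, add_zero, smul_eq_mul, smul_eq_mul] at h
  have h0 := AgentType.Regular.brLoss_zero_le hg (G.types t ω)
  have h1 := AgentType.Regular.brLoss_nonneg hg (G.types t ω) θ
  nlinarith

lemma errorBound_sq : G.errorBound ^ 2 = 4 / (G.R ^ 4 * d * (T : ℝ) ^ (5 / 2 : ℝ)) := by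
  have h1 : ((T : ℝ) ^ (5 / 4 : ℝ)) ^ 2 = (T : ℝ) ^ (5 / 2 : ℝ) := by
    rw [← Real.rpow_natCast, ← Real.rpow_mul (Nat.cast_nonneg _)]
    norm_num
  unfold errorBound
  rw [div_pow, mul_pow, mul_pow, h1, Real.sq_sqrt (Nat.cast_nonneg _)]
  ring

section Law

variable [NeZero d]

lemma errorBound_pos (hG : G.Regular) (hT : 1 ≤ T) : 0 < G.errorBound := by
  have hR := one_le_R hG
  have hd : (0 : ℝ) < d := Nat.cast_pos.2 (Nat.pos_of_neZero d)
  have hT' : (0 : ℝ) < T := by exact_mod_cast hT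
  have : 0 < G.R := by linarith
  unfold errorBound
  positivity

lemma IsDiscounting.integral_responseError_le (hG : G.Regular) {B : AgentPolicy d G.𝓕}
    (hB : G.IsDiscounting B) {t : ℕ} (ht : t < T) :
    Integrable (G.responseError B t) G.law ∧ ∫ p, G.responseError B t p ∂G.law ≤ G.errorBound := by
  have := isProbabilityMeasure_law hG
  refine integrable_of_integrable_sq (measurable_responseError hG B ht) (fun _ => norm_nonneg _)
    (hB.integral_responseError_sq_le hG ht).1 (errorBound_pos hG (by omega)) ?_
  rw [errorBound_sq]
  exact hB.integral_responseError_sq_le' hG ht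

/-- The responses are unbounded, so finiteness rests on the mean bound for the response error. The
second part is the trivial bound used when `T` is small. -/
lemma IsDiscounting.integrable_totalLoss (hG : G.Regular) {B : AgentPolicy d G.𝓕}
    (hB : G.IsDiscounting B) :
    Integrable (G.totalLoss B) G.law ∧
      ∫ p, G.totalLoss B p ∂G.law ≤ T * (G.lossBound + G.R * G.errorBound) := by
  have := isProbabilityMeasure_law hG
  have hR := one_le_R hG
  obtain ⟨g, hg, hℓ⟩ := exists_isMarginLoss hG.loss
  have hcap : ∀ t < T, Integrable (fun p => G.lossBound + G.R * G.responseError B t p) G.law :=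
    fun t ht => (integrable_const _).add ((hB.integral_responseError_le hG ht).1.const_mul _)
  have hle : ∀ t < T, ∀ᵐ p ∂G.law,
      |G.observedLoss B t p| ≤ G.lossBound + G.R * G.responseError B t p := by
    intro t ht
    filter_upwards [ae_norm_classifier_le hG] with p hp
    exact abs_observedLoss_le hG hg hℓ B ht (hp B t ht)
  have hi : ∀ t < T, Integrable (G.observedLoss B t) G.law := fun t ht =>
    (hcap t ht).mono' (measurable_observedLoss hG B ht).aestronglyMeasurable (hle t ht)
  constructor
  · exact integrable_finsetSum _ fun t ht => hi t (Finset.mem_range.1 ht)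
  · have h1 : ∫ p, G.totalLoss B p ∂G.law =
        ∑ t ∈ Finset.range T, ∫ p, G.observedLoss B t p ∂G.law :=
      integral_finsetSum _ fun t ht => hi t (Finset.mem_range.1 ht)
    rw [h1]
    have h2 : (T : ℝ) * (G.lossBound + G.R * G.errorBound) =
        ∑ _t ∈ Finset.range T, (G.lossBound + G.R * G.errorBound) := by
      rw [Finset.sum_const, Finset.card_range, nsmul_eq_mul]
    rw [h2]
    refine Finset.sum_le_sum fun t ht => ?_
    have ht := Finset.mem_range.1 ht
    have h3 := integral_mono_ae (hi t ht) (hcap t ht)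
      ((hle t ht).mono fun p hp => (le_abs_self _).trans hp)
    rw [integral_add (integrable_const _) ((hB.integral_responseError_le hG ht).1.const_mul _),
      integral_const_mul, integral_const, probReal_univ, one_smul] at h3
    have h4 := mul_le_mul_of_nonneg_left (hB.integral_responseError_le hG ht).2
      (by linarith : 0 ≤ G.R)
    linarith

/-- The regret bound with explicit constants. -/
lemma IsDiscounting.regret_le (hG : G.Regular) {B : AgentPolicy d G.𝓕} (hB : G.IsDiscounting B)
    (hδ : 0 < G.params.δ) (hη : 0 < G.params.η) {θ : Vec d} (hθ : θ ∈ G.Θ) :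
    ∫ p, G.totalLoss B p ∂G.law - ∫ ω, G.benchmarkLoss θ ω ∂G.P ≤
      T * (2 * G.lossLip * G.params.δ +
        (G.R + 2 * G.R ^ 2 * (d / G.params.δ)) * G.errorBound +
        d / G.params.δ * G.params.η * (G.lossBound ^ 2 + G.R ^ 2 * G.errorBound ^ 2)) +
      d / G.params.δ * (G.copies * G.R ^ 2 / (2 * G.params.η)) + T * G.params.δ := by
  have hprob := hG.prob
  have := isProbabilityMeasure_law hG
  have hR := one_le_R hG
  obtain ⟨g, hg, hℓ⟩ := exists_isMarginLoss hG.loss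
  have hδ1 : G.params.δ ≤ 1 := GDwoG.tuned_delta_le_one _ _ _ _ _
  set u := (1 - G.params.δ) • θ with hu
  have humem : u ∈ (fun z => (1 - G.params.δ) • z) '' G.Θ := ⟨θ, hθ, rfl⟩
  have huΘ : u ∈ G.Θ := hG.isClassifierDomain.shrink_subset hδ.le hδ1 humem
  set κ := (d : ℝ) / G.params.δ with hκ
  have hκ0 : 0 ≤ κ := by positivity
  set η := G.params.η
  have hE := fun t (ht : t < T) => hB.integral_responseError_le hG ht
  have hE2 := fun t (ht : t < T) => hB.integral_responseError_sq_le hG ht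
  have hF := fun t (ht : t < T) => integral_gradientError_le hG hg B hδ humem ht
  have hbi : Integrable (fun p : Ω × (Fin T → Vec d) => G.benchmarkLoss u p.1) G.law :=
    (integrable_benchmarkLoss hG huΘ).comp_fst _
  have hbint : ∫ p : Ω × (Fin T → Vec d), G.benchmarkLoss u p.1 ∂G.law =
      ∫ ω, G.benchmarkLoss u ω ∂G.P := by
    unfold law
    rw [integral_fun_fst, probReal_univ, one_smul]
  have hbench : ∫ ω, G.benchmarkLoss u ω ∂G.P ≤
      ∫ ω, G.benchmarkLoss θ ω ∂G.P + T * G.params.δ := by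
    have h1 := integral_mono (integrable_benchmarkLoss hG huΘ)
      ((integrable_benchmarkLoss hG hθ).add (integrable_const (T * G.params.δ)))
      (benchmarkLoss_smul_le hG hg hℓ hδ.le hδ1 θ)
    simp only [Pi.add_apply] at h1
    rwa [integral_add (integrable_benchmarkLoss hG hθ) (integrable_const _), integral_const,
      probReal_univ, one_smul] at h1
  have hpath : ∀ᵐ p ∂G.law, G.totalLoss B p - G.benchmarkLoss u p.1 ≤
      ∑ t ∈ Finset.range T, (G.gradientError g B u t p +
        (G.R + 2 * G.R ^ 2 * κ) * G.responseError B t p +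
        κ * η * (G.lossBound ^ 2 + G.R ^ 2 * G.responseError B t p ^ 2)) +
      κ * (G.copies * G.R ^ 2 / (2 * η)) := by
    filter_upwards [ae_norm_directions hG, ae_norm_classifier_le hG] with p h1 h2
    rw [benchmarkLoss_eq hG hℓ]
    exact totalLoss_sub_le hG hg hℓ B hδ hη humem h1 (h2 B)
  have i1 := fun t (ht : t < T) => (hE t ht).1.const_mul (G.R + 2 * G.R ^ 2 * κ)
  have i2 := fun t (ht : t < T) => ((integrable_const (μ := G.law) (G.lossBound ^ 2)).add
    ((hE2 t ht).1.const_mul (G.R ^ 2))).const_mul (κ * η)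
  have i3 : ∀ t ∈ Finset.range T, Integrable (fun p => G.gradientError g B u t p +
        (G.R + 2 * G.R ^ 2 * κ) * G.responseError B t p +
        κ * η * (G.lossBound ^ 2 + G.R ^ 2 * G.responseError B t p ^ 2)) G.law := fun t ht => by
    have ht := Finset.mem_range.1 ht
    exact ((hF t ht).1.add (i1 t ht)).add (i2 t ht)
  have hint := integral_mono_ae ((hB.integrable_totalLoss hG).1.sub hbi)
    ((integrable_finsetSum _ i3).add (integrable_const (κ * (G.copies * G.R ^ 2 / (2 * η))))) hpath
  simp only [Pi.sub_apply, Pi.add_apply] at hint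
  rw [integral_sub (hB.integrable_totalLoss hG).1 hbi, hbint,
    integral_add (integrable_finsetSum _ i3) (integrable_const _), integral_finsetSum _ i3,
    integral_const, probReal_univ, one_smul] at hint
  have hsum : ∑ t ∈ Finset.range T, ∫ p, (G.gradientError g B u t p +
        (G.R + 2 * G.R ^ 2 * κ) * G.responseError B t p +
        κ * η * (G.lossBound ^ 2 + G.R ^ 2 * G.responseError B t p ^ 2)) ∂G.law ≤
      ∑ _t ∈ Finset.range T, (2 * G.lossLip * G.params.δ +
        (G.R + 2 * G.R ^ 2 * κ) * G.errorBound +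
        κ * η * (G.lossBound ^ 2 + G.R ^ 2 * G.errorBound ^ 2)) := by
    refine Finset.sum_le_sum fun t ht => ?_
    have ht := Finset.mem_range.1 ht
    have i12 : Integrable (fun p => G.gradientError g B u t p +
        (G.R + 2 * G.R ^ 2 * κ) * G.responseError B t p) G.law := (hF t ht).1.add (i1 t ht)
    have i4 : Integrable (fun p => G.R ^ 2 * G.responseError B t p ^ 2) G.law :=
      (hE2 t ht).1.const_mul (G.R ^ 2)
    have i5 : Integrable (fun p => κ * η * (G.lossBound ^ 2 +
      G.R ^ 2 * G.responseError B t p ^ 2)) G.law := i2 t ht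
    rw [integral_add i12 i5, integral_add (hF t ht).1 (i1 t ht), integral_const_mul,
      integral_const_mul, integral_add (integrable_const _) i4, integral_const_mul,
      integral_const, probReal_univ, one_smul]
    have e1 := (hF t ht).2
    have e2 := (hE t ht).2
    have e3 : ∫ p, G.responseError B t p ^ 2 ∂G.law ≤ G.errorBound ^ 2 := by
      rw [errorBound_sq]
      exact hB.integral_responseError_sq_le' hG ht
    have : 0 ≤ G.R := by linarith
    gcongr
  rw [Finset.sum_const, Finset.card_range, nsmul_eq_mul] at hsum
  linarith

lemma IsDiscounting.regret_le_of_le (hG : G.Regular) {B : AgentPolicy d G.𝓕}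
    (hB : G.IsDiscounting B) (θ : Vec d) :
    ∫ p, G.totalLoss B p ∂G.law - ∫ ω, G.benchmarkLoss θ ω ∂G.P ≤
      T * (G.lossBound + G.R * G.errorBound) := by
  obtain ⟨g, hg, hℓ⟩ := exists_isMarginLoss hG.loss
  have h1 := (hB.integrable_totalLoss hG).2
  have h2 : 0 ≤ ∫ ω, G.benchmarkLoss θ ω ∂G.P := by
    refine integral_nonneg fun ω => ?_
    rw [Pi.zero_apply, benchmarkLoss_eq hG hℓ]
    exact Finset.sum_nonneg fun t _ => AgentType.Regular.brLoss_nonneg hg _ _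
  linarith

end Law

end ClassificationGame

/-! ### The rate -/

/-- The tuning of the parameters, in terms of fourth roots: `T = b ^ 4`, `D = a ^ 4`, horizon
`m ^ 4` and dimension `r ^ 2`. -/
lemma tuned_regret_le {A R C L a b m r s κ δ η q : ℝ} (hA : 1 ≤ A) (hR : 1 ≤ R) (hRA : R ≤ A)
    (hC1 : 1 ≤ C) (hC : C ≤ 3 * A ^ 3) (hL : L ≤ 3 * A ^ 2) (ha : 1 ≤ a) (hb : 1 ≤ b)
    (hm : 1 ≤ m) (hr : 1 ≤ r) (hmb : m ≤ b) (hbam : b ≤ a * m) (ham : (a * m) ^ 4 ≤ 2 * b ^ 4)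
    (hs1 : r / 3 ≤ s) (hs2 : s ≤ R * r) (hδ : δ = s / m) (hη : η = R / (C * m ^ 2))
    (hκ : κ = r ^ 2 / δ) (hq : q = 2 / (R ^ 2 * r * b ^ 5)) :
    b ^ 4 * (2 * L * δ + (R + 2 * R ^ 2 * κ) * q + κ * η * (C ^ 2 + R ^ 2 * q ^ 2)) +
      κ * (a ^ 4 * R ^ 2 / (2 * η)) + b ^ 4 * δ ≤ 75 * A ^ 4 * (r * (a * b ^ 3)) := by
  have hs0 : 0 < s := by linarith
  have hm0 : 0 < m := by linarith
  have hb0 : 0 < b := by linarith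
  have ha0 : 0 < a := by linarith
  have hr0 : 0 < r := by linarith
  have hR0 : 0 < R := by linarith
  have hC0 : 0 < C := by linarith
  have hA0 : 0 < A := by linarith
  have hδ0 : 0 < δ := by rw [hδ]; positivity
  have hκ0 : 0 < κ := by rw [hκ]; positivity
  have hq0 : 0 < q := by rw [hq]; positivity
  -- `Z` is `√d D^(1/4) T^(3/4)`. The six terms `t1` to `t6` are at most `1, 6, 2, 12, 45, 9` times
  -- `A ^ 4 * Z`, which adds up to `75`.
  set Z := r * (a * b ^ 3) with hZ
  have hZ1 : 1 ≤ Z := by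
    have h3 : 1 ≤ b ^ 3 := one_le_pow₀ hb
    have h4 : 1 ≤ a * b ^ 3 := one_le_mul_of_one_le_of_one_le ha h3
    exact one_le_mul_of_one_le_of_one_le hr h4
  have hA2 : A ^ 2 ≤ A ^ 4 := pow_le_pow_right₀ hA (by norm_num)
  have hA3 : A ^ 3 ≤ A ^ 4 := pow_le_pow_right₀ hA (by norm_num)
  have hA1 : A ≤ A ^ 4 := le_self_pow₀ hA (by norm_num)
  have hA4 : 1 ≤ A ^ 4 := one_le_pow₀ hA
  -- the exploration radius
  have hbm : b ^ 4 / m ≤ a * b ^ 3 := by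
    rw [div_le_iff₀ hm0]
    have := mul_le_mul_of_nonneg_left hbam (pow_nonneg hb0.le 3)
    linarith
  have hδb : b ^ 4 * δ ≤ R * Z := by
    calc b ^ 4 * δ = s * (b ^ 4 / m) := by rw [hδ]; ring
      _ ≤ (R * r) * (a * b ^ 3) := by gcongr
      _ = R * Z := by rw [hZ]; ring
  have t1 : b ^ 4 * δ ≤ A ^ 4 * Z := hδb.trans (by gcongr; linarith)
  have t2 : b ^ 4 * (2 * L * δ) ≤ 6 * A ^ 4 * Z := by
    calc b ^ 4 * (2 * L * δ) = 2 * L * (b ^ 4 * δ) := by ring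
      _ ≤ 2 * (3 * A ^ 2) * (A * Z) :=
        mul_le_mul (by gcongr) (hδb.trans (by gcongr)) (by positivity) (by positivity)
      _ = 6 * A ^ 3 * Z := by ring
      _ ≤ 6 * A ^ 4 * Z := by gcongr
  -- the inverse exploration radius
  have hκm : κ ≤ 3 * r * m := by
    rw [hκ, hδ, div_le_iff₀ (by positivity)]
    calc r ^ 2 = 3 * r * m * (r / 3 / m) := by field_simp
      _ ≤ 3 * r * m * (s / m) := by gcongr
  -- the error terms
  have hRq : R * q ≤ 2 := by
    have : 1 ≤ R * r * b ^ 5 :=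
      one_le_mul_of_one_le_of_one_le (one_le_mul_of_one_le_of_one_le hR hr) (one_le_pow₀ hb)
    calc R * q = 2 / (R * r * b ^ 5) := by rw [hq]; field_simp
      _ ≤ 2 := div_le_self zero_le_two this
  have t3 : b ^ 4 * (R * q) ≤ 2 * A ^ 4 * Z := by
    have h1 : 1 ≤ R * r * b := one_le_mul_of_one_le_of_one_le
      (one_le_mul_of_one_le_of_one_le hR hr) hb
    calc b ^ 4 * (R * q) = 2 / (R * r * b) := by rw [hq]; field_simp
      _ ≤ 2 := div_le_self zero_le_two h1
      _ ≤ 2 * A ^ 4 * Z := by linarith [one_le_mul_of_one_le_of_one_le hA4 hZ1]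
  -- The accuracy `q` is small enough to offset `κ ≤ 3 r m`: what remains is a constant times `m / b
  -- ≤ 1`.
  have t4 : b ^ 4 * (2 * R ^ 2 * κ * q) ≤ 12 * A ^ 4 * Z := by
    calc b ^ 4 * (2 * R ^ 2 * κ * q) = 4 * κ / (r * b) := by rw [hq]; field_simp; norm_num
      _ ≤ 4 * (3 * r * m) / (r * b) := by gcongr
      _ = 12 * (m / b) := by field_simp; norm_num
      _ ≤ 12 * 1 := by gcongr; exact div_le_one_of_le₀ hmb hb0.le
      _ ≤ 12 * A ^ 4 * Z := by linarith [one_le_mul_of_one_le_of_one_le hA4 hZ1]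
  -- the second moments
  have hRC : R * C ≤ 3 * A ^ 4 := by
    calc R * C ≤ A * (3 * A ^ 3) := by gcongr
      _ = 3 * A ^ 4 := by ring
  have hC5 : C ^ 2 + R ^ 2 * q ^ 2 ≤ 5 * C ^ 2 := by
    have : R * q ≤ 2 * C := by linarith
    have := pow_le_pow_left₀ (by positivity) this 2
    rw [mul_pow, mul_pow] at this
    linarith
  have t5 : b ^ 4 * (κ * η * (C ^ 2 + R ^ 2 * q ^ 2)) ≤ 45 * A ^ 4 * Z := by
    calc b ^ 4 * (κ * η * (C ^ 2 + R ^ 2 * q ^ 2))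
        ≤ b ^ 4 * (κ * η * (5 * C ^ 2)) := by
          have : 0 < η := by rw [hη]; positivity
          gcongr
      _ = 5 * κ * (R * C) * b ^ 4 / m ^ 2 := by rw [hη]; field_simp
      _ ≤ 5 * (3 * r * m) * (3 * A ^ 4) * b ^ 4 / m ^ 2 := by gcongr
      _ = 45 * A ^ 4 * (r * (b ^ 4 / m)) := by field_simp; norm_num
      _ ≤ 45 * A ^ 4 * (r * (a * b ^ 3)) := by gcongr
  have ham3 : (a * m) ^ 3 ≤ 2 * b ^ 3 := by
    refine le_of_mul_le_mul_right ?_ hb0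
    calc (a * m) ^ 3 * b ≤ (a * m) ^ 3 * (a * m) := by gcongr
      _ = (a * m) ^ 4 := by ring
      _ ≤ 2 * b ^ 4 := ham
      _ = 2 * b ^ 3 * b := by ring
  have t6 : κ * (a ^ 4 * R ^ 2 / (2 * η)) ≤ 9 * A ^ 4 * Z := by
    calc κ * (a ^ 4 * R ^ 2 / (2 * η)) = κ * (R * C) * a ^ 4 * m ^ 2 / 2 := by
          rw [hη]; field_simp
      _ ≤ (3 * r * m) * (3 * A ^ 4) * a ^ 4 * m ^ 2 / 2 := by gcongr
      _ = 9 / 2 * A ^ 4 * (r * (a * (a * m) ^ 3)) := by ring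
      _ ≤ 9 / 2 * A ^ 4 * (r * (a * (2 * b ^ 3))) := by gcongr
      _ = 9 * A ^ 4 * Z := by rw [hZ]; ring
  calc _ = b ^ 4 * (2 * L * δ) + b ^ 4 * (R * q) + b ^ 4 * (2 * R ^ 2 * κ * q) +
        b ^ 4 * (κ * η * (C ^ 2 + R ^ 2 * q ^ 2)) + κ * (a ^ 4 * R ^ 2 / (2 * η)) + b ^ 4 * δ := by
        ring
    _ ≤ _ := by linarith

/-- The number of copies is `T_γ` up to logarithmic factors. -/
lemma numCopies_le {d T : ℕ} {R α γ A : ℝ} (hd : 1 ≤ d) (hT : 1 ≤ T) (hR : 1 ≤ R) (hα : 0 < α)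
    (hH1 : 1 ≤ discHorizon γ) (hHT : discHorizon γ ≤ T) (hRA : R ≤ A) (hαA : α⁻¹ ≤ A)
    (hA1 : 1 ≤ A) (hlog : Real.log (T + d + 1) ≤ A) :
    (numCopies d T R α γ : ℝ) ≤ 14 * A * discHorizon γ := by
  set H := discHorizon γ with hH
  have hd' : (1 : ℝ) ≤ d := by exact_mod_cast hd
  have hT' : (1 : ℝ) ≤ T := by exact_mod_cast hT
  set X := R ^ 2 * (1 + 1 / α) * H / targetAccuracy d T R α with hX
  have hTd : (T : ℝ) ≤ Real.exp A := by
    have := (Real.le_log_iff_exp_le (x := Real.log (T + d + 1)) (by positivity)).1 le_rfl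
    rw [Real.exp_log (by positivity)] at this
    have h2 := Real.exp_le_exp.2 hlog
    rw [Real.exp_log (by positivity)] at h2
    linarith
  have hdd : (d : ℝ) ≤ Real.exp A := by
    have h2 := Real.exp_le_exp.2 hlog
    rw [Real.exp_log (by positivity)] at h2
    linarith
  have hid : ∀ x : ℝ, x ≤ A → 1 + x ≤ Real.exp A := fun x hx => by
    have := Real.add_one_le_exp x
    have := Real.exp_le_exp.2 hx
    linarith
  -- All factors are at most powers of `exp A`, with exponents `6 + 1 + 1 + 1 + 3 + 1 = 13`;
  -- rounding up then turns `13` into `14`.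
  have hXle : X ≤ Real.exp (13 * A) := by
    have e1 : X = R ^ 6 * (1 + 1 / α) * H * d * (T : ℝ) ^ (5 / 2 : ℝ) * (1 / α) := by
      rw [hX, targetAccuracy]
      field_simp
    have hTT : (T : ℝ) ^ (5 / 2 : ℝ) ≤ Real.exp A ^ 3 := by
      calc (T : ℝ) ^ (5 / 2 : ℝ) ≤ (T : ℝ) ^ (3 : ℝ) := by
            apply Real.rpow_le_rpow_of_exponent_le hT'; norm_num
        _ = (T : ℝ) ^ 3 := by norm_cast
        _ ≤ _ := by gcongr
    have h1 : R ≤ Real.exp A := by linarith [hid R hRA]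
    have h2 : 1 + 1 / α ≤ Real.exp A := hid _ (by rwa [one_div])
    have h3 : 1 / α ≤ Real.exp A := by linarith
    have h4 : H ≤ Real.exp A := hHT.trans hTd
    calc X = R ^ 6 * (1 + 1 / α) * H * d * (T : ℝ) ^ (5 / 2 : ℝ) * (1 / α) := e1
      _ ≤ Real.exp A ^ 6 * Real.exp A * Real.exp A * Real.exp A * Real.exp A ^ 3 * Real.exp A := by
        gcongr
      _ = Real.exp A ^ 13 := by ring
      _ = Real.exp (13 * A) := by rw [← Real.exp_nat_mul]; norm_num
  have hX0 : 0 < X := by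
    have : 0 < R := by linarith
    have : 0 < H := by linarith
    rw [hX, targetAccuracy]
    positivity
  have hlogX : Real.log X ≤ 13 * A := (Real.log_le_iff_le_exp hX0).2 hXle
  have hceil : (⌈H * Real.log X⌉₊ : ℝ) ≤ 13 * A * H + 1 := by
    have h1 : ⌈H * Real.log X⌉₊ ≤ ⌈13 * A * H⌉₊ := Nat.ceil_le_ceil (by nlinarith)
    have h2 : (⌈H * Real.log X⌉₊ : ℝ) ≤ ⌈13 * A * H⌉₊ := by exact_mod_cast h1
    exact h2.trans (Nat.ceil_lt_add_one (by positivity)).le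
  have hAH : 1 ≤ A * H := one_le_mul_of_one_le_of_one_le hA1 hH1
  unfold numCopies
  push_cast
  refine max_le (by linarith) (hceil.trans (by linarith))

lemma rpow_quarter_pow {x : ℝ} (hx : 0 ≤ x) : (x ^ (1 / 4 : ℝ)) ^ 4 = x := by
  rw [← Real.rpow_natCast, ← Real.rpow_mul hx]
  norm_num

lemma rpow_quarter_le {x y : ℝ} (hx : 0 ≤ x) (hy : 0 ≤ y) (h : x ≤ y ^ 4) : x ^ (1 / 4 : ℝ) ≤ y :=
  le_of_pow_le_pow_left₀ four_ne_zero hy (by rwa [rpow_quarter_pow hx])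

namespace ClassificationGame

variable {d T : ℕ} {Ω : Type*} [MeasurableSpace Ω] {G : ClassificationGame d T Ω}

/-- The trivial bound covers the three degenerate cases `T ≤ T_γ`, `T < D` and exploration radius
capped at `1`, each of which implies `b ≤ 14 A² r h`. Otherwise `δ = s / m` and the horizon of a
copy is between `T / D` and `2 T / D`, so `tuned_regret_le` applies. -/
lemma IsDiscounting.regret_le_rate [NeZero d] (hG : G.Regular) {B : AgentPolicy d G.𝓕}
    (hB : G.IsDiscounting B) (hT : 1 ≤ T) {A : ℝ} (hA : 1 ≤ A) (hRA : G.R ≤ A) (hαA : G.α⁻¹ ≤ A)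
    (hlog : Real.log (T + d + 1) ≤ A) {θ : Vec d} (hθ : θ ∈ G.Θ) :
    ∫ p, G.totalLoss B p ∂G.law - ∫ ω, G.benchmarkLoss θ ω ∂G.P ≤
      1050 * A ^ 5 * (discHorizon G.γ ^ (1 / 4 : ℝ) * Real.sqrt d * (T : ℝ) ^ (3 / 4 : ℝ)) := by
  have hd : 1 ≤ d := Nat.pos_of_neZero d
  have hR := one_le_R hG
  have hα := hG.alpha_pos
  have hd' : (1 : ℝ) ≤ d := by exact_mod_cast hd
  have hT' : (1 : ℝ) ≤ T := by exact_mod_cast hT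
  have hH1 : 1 ≤ discHorizon G.γ := by
    unfold discHorizon
    rw [le_div_iff₀ (sub_pos.2 hG.gamma_lt_one)]
    linarith [hG.gamma_pos]
  have hA0 : 0 < A := by linarith
  have hR0 : 0 < G.R := by linarith
  set H := discHorizon G.γ with hHdef
  set D := numCopies d T G.R G.α G.γ with hD
  have hD1 : (1 : ℝ) ≤ D := by exact_mod_cast numCopies_pos d T G.R G.α G.γ
  set b := (T : ℝ) ^ (1 / 4 : ℝ) with hb
  set a := (D : ℝ) ^ (1 / 4 : ℝ) with ha
  set h := H ^ (1 / 4 : ℝ) with hh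
  set r := Real.sqrt d with hr
  have hb1 : 1 ≤ b := Real.one_le_rpow hT' (by norm_num)
  have ha1 : 1 ≤ a := Real.one_le_rpow hD1 (by norm_num)
  have hh1 : 1 ≤ h := Real.one_le_rpow hH1 (by norm_num)
  have hr1 : 1 ≤ r := Real.one_le_sqrt.2 hd'
  have hb4 : b ^ 4 = T := rpow_quarter_pow (by positivity)
  have ha4 : a ^ 4 = D := rpow_quarter_pow (by positivity)
  have hh4 : h ^ 4 = H := rpow_quarter_pow (by positivity)
  have hr2 : r ^ 2 = d := Real.sq_sqrt (by positivity)
  have hb3 : (T : ℝ) ^ (3 / 4 : ℝ) = b ^ 3 := by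
    rw [hb, ← Real.rpow_natCast, ← Real.rpow_mul (by positivity)]
    norm_num
  have hb5 : (T : ℝ) ^ (5 / 4 : ℝ) = b ^ 5 := by
    rw [hb, ← Real.rpow_natCast, ← Real.rpow_mul (by positivity)]
    norm_num
  have hq : G.errorBound = 2 / (G.R ^ 2 * r * b ^ 5) := by rw [errorBound, hb5]
  rw [hb3]
  have hαA' : 1 / G.α ≤ A := by rwa [one_div]
  have hα0 : 0 < 1 / G.α := by positivity
  have hA23 : A ^ 2 ≤ A ^ 3 := pow_le_pow_right₀ hA (by norm_num)
  have hA12 : A ≤ A ^ 2 := le_self_pow₀ hA (by norm_num)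
  have hC1 : 1 ≤ G.lossBound := by
    unfold lossBound
    have : 0 ≤ G.R ^ 2 + G.R ^ 2 / G.α := by positivity
    linarith
  have hC : G.lossBound ≤ 3 * A ^ 3 := by
    have h1 : G.R ^ 2 ≤ A ^ 2 := by gcongr
    have h2 : G.R ^ 2 / G.α ≤ A ^ 3 := by
      calc G.R ^ 2 / G.α = G.R ^ 2 * (1 / G.α) := by ring
        _ ≤ A ^ 2 * A := by gcongr
        _ = A ^ 3 := by ring
    unfold lossBound
    linarith
  have hL0 : 0 ≤ G.lossLip := by unfold lossLip; positivity
  have hL : G.lossLip ≤ 3 * A ^ 2 := by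
    have h2 : 2 * G.R / G.α ≤ 2 * A ^ 2 := by
      calc 2 * G.R / G.α = 2 * (G.R * (1 / G.α)) := by ring
        _ ≤ 2 * (A * A) := by gcongr
        _ = 2 * A ^ 2 := by ring
    unfold lossLip
    linarith
  -- With this, `ρ` below lies between `d / 9` and `R d`, hence `r / 3 ≤ s ≤ R r`.
  have hLC : G.lossLip ≤ 2 * G.lossBound := by
    have h1 : G.R ≤ G.R ^ 2 := le_self_pow₀ hR (by norm_num)
    have h2 : G.R / G.α ≤ G.R ^ 2 / G.α := by gcongr
    unfold lossLip lossBound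
    rw [mul_div_assoc]
    linarith
  -- the trivial bound suffices if `T` is small
  have htriv : b ≤ 14 * A ^ 2 * r * h →
      ∫ p, G.totalLoss B p ∂G.law - ∫ ω, G.benchmarkLoss θ ω ∂G.P ≤
        1050 * A ^ 5 * (h * r * b ^ 3) := by
    intro hbb
    have h1 := hB.regret_le_of_le hG θ
    have h2 : G.R * G.errorBound ≤ 2 := by
      have : 1 ≤ G.R * r * b ^ 5 :=
        one_le_mul_of_one_le_of_one_le (one_le_mul_of_one_le_of_one_le hR hr1) (one_le_pow₀ hb1)
      calc G.R * G.errorBound = 2 / (G.R * r * b ^ 5) := by rw [hq]; field_simp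
        _ ≤ 2 := div_le_self zero_le_two this
    have h3 : G.lossBound + G.R * G.errorBound ≤ 5 * A ^ 3 := by
      have := one_le_pow₀ hA (n := 3)
      linarith
    calc _ ≤ T * (G.lossBound + G.R * G.errorBound) := h1
      _ ≤ T * (5 * A ^ 3) := by gcongr
      _ = b * b ^ 3 * (5 * A ^ 3) := by rw [← hb4]; ring
      _ ≤ (14 * A ^ 2 * r * h) * b ^ 3 * (5 * A ^ 3) := by gcongr
      _ = 70 * (A ^ 5 * (h * r * b ^ 3)) := by ring
      _ ≤ 1050 * (A ^ 5 * (h * r * b ^ 3)) := by gcongr; norm_num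
      _ = _ := by ring
  have hA2r : 1 ≤ 14 * A ^ 2 * r := by
    have := one_le_mul_of_one_le_of_one_le (one_le_pow₀ hA (n := 2)) hr1
    linarith
  rcases le_total (T : ℝ) H with hTH | hHT
  · refine htriv ?_
    have h1 : b ≤ h := Real.rpow_le_rpow (by positivity) hTH (by norm_num)
    exact h1.trans (le_mul_of_one_le_left (by positivity) hA2r)
  have hDH : (D : ℝ) ≤ 14 * A * H :=
    numCopies_le hd hT hR hα hH1 hHT hRA hαA hA hlog
  have hah : a ≤ 14 * A * h := by
    refine rpow_quarter_le (by positivity) (by positivity) (hDH.trans ?_)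
    rw [mul_pow, hh4]
    have : 14 * A ≤ (14 * A) ^ 4 := le_self_pow₀ (by linarith) (by norm_num)
    gcongr
  have h14 : 14 * A * h ≤ 14 * A ^ 2 * r * h := by
    have : A ≤ A ^ 2 * r := hA12.trans (le_mul_of_one_le_right (by positivity) hr1)
    rw [mul_assoc 14 (A ^ 2) r]
    gcongr
  rcases lt_or_ge (T : ℝ) D with hTD | hDT
  · refine htriv ?_
    have h1 : b ≤ a := Real.rpow_le_rpow (by positivity) hTD.le (by norm_num)
    linarith
  set n := ⌈(T : ℝ) / (D : ℝ)⌉₊ with hn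
  set m := (n : ℝ) ^ (1 / 4 : ℝ) with hm
  have hn0 : (T : ℝ) / D ≤ n := Nat.le_ceil _
  have hTD1 : 1 ≤ (T : ℝ) / D := (one_le_div (by linarith)).2 hDT
  have hn1 : (1 : ℝ) ≤ n := hTD1.trans hn0
  have hm1 : 1 ≤ m := Real.one_le_rpow hn1 (by norm_num)
  have hm4 : m ^ 4 = n := rpow_quarter_pow (by positivity)
  -- The `1` lost by rounding up is at most `T / D`, since `D ≤ T`.
  have hn2 : (n : ℝ) ≤ 2 * (T / D) := by
    have := (Nat.ceil_lt_add_one (by positivity : 0 ≤ (T : ℝ) / D)).le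
    linarith
  have hnT : (n : ℝ) ≤ T := by
    have : n ≤ T := Nat.ceil_le.2 (div_le_self (by positivity) hD1)
    exact_mod_cast this
  have hbam : b ≤ a * m := by
    rw [ha, hm, ← Real.mul_rpow (by positivity) (by positivity)]
    refine Real.rpow_le_rpow (by positivity) ?_ (by norm_num)
    rw [div_le_iff₀ (by linarith)] at hn0
    linarith
  set C := G.lossBound with hCdef
  set ρ := G.R * d * C / (3 * (G.lossLip + C)) with hρ
  have hC0 : 0 < C := by linarith
  have hρ1 : ρ ≤ G.R * d := by
    rw [hρ, div_le_iff₀ (by positivity)]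
    exact mul_le_mul_of_nonneg_left (by linarith) (by positivity)
  have hρ2 : d / 9 ≤ ρ := by
    rw [hρ, le_div_iff₀ (by positivity)]
    have h1 : (d : ℝ) * (3 * (G.lossLip + C)) ≤ d * (9 * C) :=
      mul_le_mul_of_nonneg_left (by linarith) (by positivity)
    have h2 : (d : ℝ) * C ≤ G.R * d * C := by
      rw [mul_assoc]
      exact le_mul_of_one_le_left (by positivity) hR
    linarith
  set s := Real.sqrt ρ with hs
  have hs1 : r / 3 ≤ s := by
    apply Real.le_sqrt_of_sq_le
    rw [div_pow, hr2]
    norm_num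
    exact hρ2
  have hs2 : s ≤ G.R * r := by
    rw [hs, Real.sqrt_le_left (by positivity), mul_pow, hr2]
    refine hρ1.trans ?_
    have : G.R ≤ G.R ^ 2 := le_self_pow₀ hR (by norm_num)
    gcongr
  have hδ : G.params.δ = min 1 (s / m) := by
    have : (n : ℝ) ^ (-(1 / 4) : ℝ) = m⁻¹ := Real.rpow_neg (by positivity) _
    change min 1 (s * (n : ℝ) ^ (-(1 / 4) : ℝ)) = _
    rw [this, div_eq_mul_inv]
  rcases le_total 1 (s / m) with hsm | hsm
  · refine htriv ?_
    rw [one_le_div (by linarith)] at hsm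
    calc b ≤ a * m := hbam
      _ ≤ (14 * A * h) * (A * r) := by
        gcongr
        exact hsm.trans (hs2.trans (by gcongr))
      _ = 14 * A ^ 2 * r * h := by ring
  rw [min_eq_right hsm] at hδ
  have hη : G.params.η = G.R / (C * m ^ 2) := by
    have : Real.sqrt n = m ^ 2 := by
      rw [← hm4, show m ^ 4 = (m ^ 2) ^ 2 by ring, Real.sqrt_sq (by positivity)]
    change G.R / (C * Real.sqrt n) = _
    rw [this]
  have hδ0 : 0 < G.params.δ := by
    rw [hδ]
    have : 0 < s := by linarith
    positivity
  have hη0 : 0 < G.params.η := by rw [hη]; positivity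
  have hmain := hB.regret_le hG hδ0 hη0 hθ
  have htuned := tuned_regret_le (κ := d / G.params.δ) hA hR hRA hC1 hC hL ha1 hb1 hm1 hr1
    (Real.rpow_le_rpow (by positivity) hnT (by norm_num)) hbam
    (by
      rw [mul_pow, ha4, hm4, hb4]
      have := mul_le_mul_of_nonneg_left hn2 (by linarith : (0 : ℝ) ≤ D)
      have h2 : (D : ℝ) * (2 * (T / D)) = 2 * T := by field_simp
      linarith) hs1 hs2 hδ hη (by rw [hr2]) hq
  rw [hb4, ha4] at htuned
  refine hmain.trans (htuned.trans ?_)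
  -- Replacing `D` by `T_γ` costs a factor `14 A`, and `75 * 14 = 1050`.
  calc 75 * A ^ 4 * (r * (a * b ^ 3)) ≤ 75 * A ^ 4 * (r * ((14 * A * h) * b ^ 3)) := by gcongr
    _ = _ := by ring

end ClassificationGame

end

theorem mainTheorem10 (K : ℝ) (p : ℕ) :
    ∃ (c : ℝ) (q : ℕ), ∀ (d T : ℕ), 1 ≤ d → 1 ≤ T →
      ∀ (Ω : Type*) [MeasurableSpace Ω] (G : ClassificationGame d T Ω), G.Regular →
        G.R ≤ K * Real.log (T + d + 1) ^ p →
        G.α⁻¹ ≤ K * Real.log (T + d + 1) ^ p →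
        ∀ B : AgentPolicy d G.𝓕, G.IsDiscounting B →
          Integrable (G.totalLoss B) G.law ∧
          (∀ θ ∈ G.Θ, Integrable (G.benchmarkLoss θ) G.P) ∧
          G.stackelbergRegret B ≤
            ((c * Real.log (T + d + 1) ^ q *
              (discHorizon G.γ ^ (1 / 4 : ℝ) * Real.sqrt d * (T : ℝ) ^ (3 / 4 : ℝ) + (d : ℝ) ^ 2) : ℝ) :
              EReal) := by
  set k := max K 1 with hk
  -- `regret_le_rate` is applied with `A = k ℓ ^ (p + 1)`, and its bound contains `A ^ 5`. The
  -- exponent is `p + 1` because `A` must also dominate `ℓ` itself, even for `p = 0`.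
  refine ⟨1050 * k ^ 5, (p + 1) * 5, fun d T hd hT Ω _ G hG hR hα B hB => ?_⟩
  have : NeZero d := ⟨by omega⟩
  refine ⟨(hB.integrable_totalLoss hG).1, fun θ hθ => G.integrable_benchmarkLoss hG hθ,
    iSup₂_le fun θ hθ => EReal.coe_le_coe_iff.2 ?_⟩
  set ℓ := Real.log (T + d + 1) with hℓ
  have hk1 : 1 ≤ k := le_max_right _ _
  have hℓ1 : 1 ≤ ℓ := by
    have hd' : (1 : ℝ) ≤ d := by exact_mod_cast hd
    have hT' : (1 : ℝ) ≤ T := by exact_mod_cast hT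
    rw [hℓ, Real.le_log_iff_exp_le (by positivity)]
    linarith [Real.exp_one_lt_d9]
  have hbound : K * ℓ ^ p ≤ k * ℓ ^ (p + 1) := by
    calc K * ℓ ^ p ≤ k * ℓ ^ p := by gcongr; exact le_max_left _ _
      _ ≤ k * ℓ ^ (p + 1) := by gcongr; exact p.le_succ
  have hℓA : ℓ ≤ k * ℓ ^ (p + 1) :=
    (le_self_pow₀ hℓ1 p.succ_ne_zero).trans (le_mul_of_one_le_left (by positivity) hk1)
  refine (hB.regret_le_rate hG hT (hℓ1.trans hℓA) (hR.trans hbound) (hα.trans hbound) hℓA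
    hθ).trans ?_
  rw [mul_pow, ← pow_mul, ← mul_assoc 1050]
  exact mul_le_mul_of_nonneg_left (le_add_of_nonneg_right (sq_nonneg _)) (by positivity)
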